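/- Let $M\ge 1$ and $1<n\le N$ be integers, and let $\Omega_N\subseteq\mathbb C^N$ and $\Omega_M\subseteq\mathbb C^M$ be non-empty connected open sets. Let $F:\Omega_N\to\Omega_M$ be any map. Then $F$ is an $(M,n)$-subharmonic morphism if and only if $F$ is holomorphic or $\bar F$ is holomorphic. Here the following definitions are used. For $1\le k\le N$ let $\beta=dd^c|z|^2$ on $\mathbb C^N$, and let $\Gamma_k$ be the set of real $(1,1)$-forms $\alpha$ with constant coefficients such that $\alpha^l\wedge\beta^{N-l}\ge 0$ for $l=1,\dots,k$. An upper semicontinuous function $u:\Omega_N\to\mathbb R\cup\{-\infty\}$ is subharmonic if $u(a)$ is at most the mean value of $u$ over $B$ for every closed ball $B\subseteq\Omega_N$ with centre $a$ (the function $u\equiv-\infty$ is allowed). A subharmonic function $u$ on $\Omega_N$ is $k$-subharmonic if $u\equiv-\infty$ or $$dd^cu\wedge\alpha_1\wedge\cdots\wedge\alpha_{k-1}\wedge\beta^{N-k}\ge 0$$ in the sense of currents for all $\alpha_1,\dots,\alpha_{k-1}\in\Gamma_k$. The same definitions apply on $\Omega_M\subseteq\mathbb C^M$. For $1\le m\le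 M$ and $1\le n\le N$, a map $F:\Omega_N\to\Omega_M$ is an $(m,n)$-subharmonic morphism if $\varphi\circ F$ is $n$-subharmonic on $\Omega_N$ for every $m$-subharmonic function $\varphi$ on $\Omega_M$. -/

import Mathlib

open MeasureTheory Set
open scoped ContDiff ComplexConjugate

noncomputable section

/-- The Hermitian space of `N`-tuples of complex numbers. -/
abbrev CSpace (N : ℕ) : Type := EuclideanSpace ℂ (Fin N)

/-! ### Forms of type (1,1) with constant coefficients and their wedge products

A form `2i ∑ A j k dz_j ∧ dz̄_k` is recorded by its coefficient matrix `A`; it is real exactly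
when `A` is Hermitian. In this normalization `dd^c u = 2i ∑ (∂²u / ∂z_j ∂z̄_k) dz_j ∧ dz̄_k` has
the complex Hessian of `u` as its matrix, and `β = dd^c |z|²` has the identity matrix. -/

/-- The number `c` such that the wedge product of the `N` forms with matrices `A 0, …, A (N - 1)`
is `c` times `(2i dz_1 ∧ dz̄_1) ∧ ⋯ ∧ (2i dz_N ∧ dz̄_N)`, which is a positive multiple of the
volume form. The theorem `prod_form11` below checks this in the exterior algebra. -/
def wedgeCoeff {N : ℕ} (A : Fin N → Matrix (Fin N) (Fin N) ℂ) : ℂ :=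
  ∑ σ : Equiv.Perm (Fin N), ∑ τ : Equiv.Perm (Fin N),
    ((Equiv.Perm.sign σ : ℤ) : ℂ) * ((Equiv.Perm.sign τ : ℤ) : ℂ) * ∏ i, A i (σ i) (τ i)

/-- The exterior algebra generated by `dz_1, …, dz_N, dz̄_1, …, dz̄_N`. -/
abbrev ConstForms (N : ℕ) : Type := ExteriorAlgebra ℂ (Fin N ⊕ Fin N → ℂ)

/-- The covector `dz_j`. -/
def dz {N : ℕ} (j : Fin N) : ConstForms N := ExteriorAlgebra.ι ℂ (Pi.single (Sum.inl j) 1)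

/-- The covector `dz̄_j`. -/
def dzbar {N : ℕ} (j : Fin N) : ConstForms N := ExteriorAlgebra.ι ℂ (Pi.single (Sum.inr j) 1)

/-- The form `2i ∑ A j k dz_j ∧ dz̄_k`. -/
def form11 {N : ℕ} (A : Matrix (Fin N) (Fin N) ℂ) : ConstForms N :=
  ∑ j, ∑ k, (2 * Complex.I * A j k) • (dz j * dzbar k)

theorem ι_mul_ιMulti {V : Type*} [AddCommGroup V] [Module ℂ V] (n : ℕ) (y : V) (x : Fin n → V) :
    ExteriorAlgebra.ι ℂ y * ExteriorAlgebra.ιMulti ℂ n x =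
      ((-1 : ℂ) ^ n) • (ExteriorAlgebra.ιMulti ℂ n x * ExteriorAlgebra.ι ℂ y) := by
  induction n with
  | zero => simp
  | succ n ih =>
    rw [ExteriorAlgebra.ιMulti_succ_apply, ← mul_assoc,
      eq_neg_of_add_eq_zero_left (ExteriorAlgebra.ι_add_mul_swap (R := ℂ) y (x 0)), neg_mul,
      mul_assoc, ih, pow_succ, mul_smul_comm, ← mul_assoc]
    simp

theorem exists_prod_ι_mul_ι {V : Type*} [AddCommGroup V] [Module ℂ V] (n : ℕ) :
    ∃ c : ℂ, ∀ x y : Fin n → V,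
      (List.ofFn fun i => ExteriorAlgebra.ι ℂ (x i) * ExteriorAlgebra.ι ℂ (y i)).prod =
        c • (ExteriorAlgebra.ιMulti ℂ n x * ExteriorAlgebra.ιMulti ℂ n y) := by
  induction n with
  | zero => exact ⟨1, fun x y => by simp⟩
  | succ n ih =>
    obtain ⟨c, hc⟩ := ih
    refine ⟨c * (-1) ^ n, fun x y => ?_⟩
    rw [List.ofFn_succ, List.prod_cons, hc (fun i => x i.succ) (fun i => y i.succ),
      ExteriorAlgebra.ιMulti_succ_apply, ExteriorAlgebra.ιMulti_succ_apply]
    have h := ι_mul_ιMulti n (y 0) (Matrix.vecTail x)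
    change ExteriorAlgebra.ι ℂ (x 0) * ExteriorAlgebra.ι ℂ (y 0) *
      (c • (ExteriorAlgebra.ιMulti ℂ n (Matrix.vecTail x) *
        ExteriorAlgebra.ιMulti ℂ n (Matrix.vecTail y))) = _
    rw [mul_smul_comm, mul_assoc, ← mul_assoc (ExteriorAlgebra.ι ℂ (y 0)), h, mul_smul,
      smul_mul_assoc, mul_smul_comm]
    simp only [mul_assoc]

/-- The wedge product of `N` forms of type (1,1) is the multiple of
`(2i dz_1 ∧ dz̄_1) ∧ ⋯ ∧ (2i dz_N ∧ dz̄_N)` given by `wedgeCoeff`. -/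
theorem prod_form11 {N : ℕ} (A : Fin N → Matrix (Fin N) (Fin N) ℂ) :
    (List.ofFn fun i => form11 (A i)).prod =
      wedgeCoeff A •
        (List.ofFn fun i : Fin N => (2 * Complex.I) • (dz i * dzbar i)).prod := by
  classical
  obtain ⟨c, hc⟩ := exists_prod_ι_mul_ι (V := Fin N ⊕ Fin N → ℂ) N
  set M := MultilinearMap.mkPiAlgebraFin ℂ N (ConstForms N) with hM
  set a : Fin N → Fin N ⊕ Fin N → ℂ := fun j => Pi.single (Sum.inl j) 1 with ha
  set b : Fin N → Fin N ⊕ Fin N → ℂ := fun j => Pi.single (Sum.inr j) 1 with hb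
  have hP : ∀ s t : Fin N → Fin N, M (fun i => dz (s i) * dzbar (t i)) =
      c • (ExteriorAlgebra.ιMulti ℂ N (a ∘ s) * ExteriorAlgebra.ιMulti ℂ N (b ∘ t)) := by
    intro s t
    rw [hM, MultilinearMap.mkPiAlgebraFin_apply]
    exact hc (a ∘ s) (b ∘ t)
  have hsum : ∀ g : (Fin N → Fin N) → ConstForms N, (∀ s, ¬ Function.Injective s → g s = 0) →
      ∑ s, g s = ∑ σ : Equiv.Perm (Fin N), g σ := by
    intro g hg
    symm
    refine Finset.sum_of_injOn (fun σ : Equiv.Perm (Fin N) => (σ : Fin N → Fin N))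
      (fun σ _ τ _ h => DFunLike.coe_injective h) (by simp) ?_ (fun _ _ => rfl)
    intro s _ hs
    refine hg s fun hinj => hs ?_
    exact ⟨Equiv.ofBijective s (Finite.injective_iff_bijective.1 hinj), by simp, rfl⟩
  have hR : (List.ofFn fun i : Fin N => (2 * Complex.I) • (dz i * dzbar i)).prod =
      ((2 * Complex.I) ^ N) • (c • (ExteriorAlgebra.ιMulti ℂ N a * ExteriorAlgebra.ιMulti ℂ N b)) := by
    have h1 := M.map_smul_univ (fun _ => 2 * Complex.I) (fun i => dz i * dzbar i)
    have h2 := hP id id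
    simp only [id] at h2
    rw [h2] at h1
    simpa [hM] using h1
  have hL : (List.ofFn fun i => form11 (A i)).prod = ∑ s : Fin N → Fin N, ∑ t : Fin N → Fin N,
      (∏ i, (2 * Complex.I * A i (s i) (t i))) •
        (c • (ExteriorAlgebra.ιMulti ℂ N (a ∘ s) * ExteriorAlgebra.ιMulti ℂ N (b ∘ t))) := by
    have h1 : (List.ofFn fun i => form11 (A i)).prod = M (fun i => ∑ p : Fin N × Fin N,
        (2 * Complex.I * A i p.1 p.2) • (dz p.1 * dzbar p.2)) := by
      rw [hM, MultilinearMap.mkPiAlgebraFin_apply]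
      simp only [form11, Fintype.sum_prod_type]
    rw [h1, M.map_sum, ← Fintype.sum_prod_type',
      ← (Equiv.arrowProdEquivProdArrow (Fin N) (fun _ => Fin N) (fun _ => Fin N)).sum_comp]
    refine Finset.sum_congr rfl fun r _ => ?_
    rw [M.map_smul_univ, hP (fun i => (r i).1) (fun i => (r i).2)]
    rfl
  have hz : ∀ (v : Fin N → Fin N ⊕ Fin N → ℂ) (s : Fin N → Fin N), ¬ Function.Injective s →
      ExteriorAlgebra.ιMulti ℂ N (v ∘ s) = 0 := fun v s hs =>
    AlternatingMap.map_eq_zero_of_not_injective _ _ fun h => hs h.of_comp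
  rw [hL, hR, hsum]
  · unfold wedgeCoeff
    rw [Finset.sum_smul]
    refine Finset.sum_congr rfl fun σ _ => ?_
    rw [hsum, Finset.sum_smul]
    · refine Finset.sum_congr rfl fun τ _ => ?_
      rw [AlternatingMap.map_perm, AlternatingMap.map_perm, Finset.prod_mul_distrib]
      simp only [Units.smul_def, ← Int.cast_smul_eq_zsmul ℂ, smul_mul_assoc, mul_smul_comm,
        smul_smul, Finset.prod_const, Finset.card_univ, Fintype.card_fin]
      congr 1
      ring
    · intro t ht
      rw [hz b t ht]
      simp
  · intro s hs
    simp [hz a s hs]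

/-- The set `Γ_k` of real constant (1,1)-forms `α` with `α^l ∧ β^(N-l) ≥ 0` for `1 ≤ l ≤ k`. The
coefficient of a wedge product of real (1,1)-forms is a real number. -/
def GammaCone (N k : ℕ) : Set (Matrix (Fin N) (Fin N) ℂ) :=
  {A | A.IsHermitian ∧ ∀ l : ℕ, 1 ≤ l → l ≤ k →
    0 ≤ (wedgeCoeff fun i : Fin N => if (i : ℕ) < l then A else 1).re}

/-! ### The complex Hessian -/

/-- The Wirtinger derivative `∂f/∂z_j = (∂f/∂x_j - i ∂f/∂y_j) / 2`. -/
def wirtinger {N : ℕ} (j : Fin N) (f : CSpace N → ℂ) (z : CSpace N) : ℂ :=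
  (fderiv ℝ f z (EuclideanSpace.single j 1) -
    Complex.I * fderiv ℝ f z (EuclideanSpace.single j Complex.I)) / 2

/-- The Wirtinger derivative `∂f/∂z̄_j = (∂f/∂x_j + i ∂f/∂y_j) / 2`. -/
def wirtingerBar {N : ℕ} (j : Fin N) (f : CSpace N → ℂ) (z : CSpace N) : ℂ :=
  (fderiv ℝ f z (EuclideanSpace.single j 1) +
    Complex.I * fderiv ℝ f z (EuclideanSpace.single j Complex.I)) / 2

/-- The complex Hessian `(∂²χ / ∂z_j ∂z̄_k)`, that is, the matrix of `dd^c χ`. -/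
def complexHessian {N : ℕ} (χ : CSpace N → ℝ) (z : CSpace N) : Matrix (Fin N) (Fin N) ℂ :=
  Matrix.of fun j k => wirtinger j (wirtingerBar k fun w => (χ w : ℂ)) z

/-! ### Subharmonic and `k`-subharmonic functions -/

/-- The Lebesgue integral over `s` of an extended real function `u`, as the difference of the
integrals of the positive and the negative part. It is used for functions that are bounded above
on the bounded set `s`, so that it is a well defined element of `[-∞, ∞)`. -/
def extIntegral {N : ℕ} (s : Set (CSpace N)) (u : CSpace N → EReal) : EReal :=
  ((∫⁻ z in s, (u z).toENNReal : ENNReal) : EReal) -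
    ((∫⁻ z in s, (-u z).toENNReal : ENNReal) : EReal)

/-- `u : Ω → [-∞, ∞)` is upper semicontinuous and is at most its mean over each closed ball
contained in `Ω`. The constant `-∞` is allowed. -/
structure IsSubharmonicOn {N : ℕ} (u : CSpace N → EReal) (Ω : Set (CSpace N)) : Prop where
  usc : UpperSemicontinuousOn u Ω
  lt_top : ∀ z ∈ Ω, u z < ⊤
  submean : ∀ z ∈ Ω, ∀ r : ℝ, 0 < r → Metric.closedBall z r ⊆ Ω →
    ((volume (Metric.closedBall z r) : ENNReal) : EReal) * u z ≤
      extIntegral (Metric.closedBall z r) u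

/-- `k`-subharmonic functions on a connected open set `Ω`, for `1 ≤ k ≤ N`: subharmonic functions
`u` such that either `u` is identically `-∞`, or
`dd^c u ∧ α_1 ∧ ⋯ ∧ α_(k-1) ∧ β^(N-k) ≥ 0` in the sense of currents for all
`α_1, …, α_(k-1) ∈ Γ_k`. In the second case `u` is locally integrable, and the current is the
functional `χ ↦ ∫ u dd^c χ ∧ α_1 ∧ ⋯ ∧ α_(k-1) ∧ β^(N-k)` on test functions. -/
structure IsKSubharmonicOn {N : ℕ} (k : ℕ) (u : CSpace N → EReal) (Ω : Set (CSpace N)) :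
    Prop where
  subharmonic : IsSubharmonicOn u Ω
  current_nonneg : (∀ z ∈ Ω, u z = ⊥) ∨
    ∀ α : ℕ → Matrix (Fin N) (Fin N) ℂ, (∀ i, α i ∈ GammaCone N k) →
    ∀ χ : CSpace N → ℝ, ContDiff ℝ ∞ χ → HasCompactSupport χ → tsupport χ ⊆ Ω →
    (∀ z, 0 ≤ χ z) →
    0 ≤ ∫ z, (u z).toReal *
      (wedgeCoeff fun i : Fin N =>
        if (i : ℕ) = 0 then complexHessian χ z else if (i : ℕ) < k then α i else 1).re

/-- The map `f : Ω_N → Ω_M` (only its values on `Ω_N` matter, and they are assumed to lie in `Ω_M`)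
pulls back `m`-subharmonic functions on `Ω_M` to `n`-subharmonic functions on `Ω_N`. -/
def IsSubharmonicMorphism {N M : ℕ} (m n : ℕ) (ΩN : Set (CSpace N)) (ΩM : Set (CSpace M))
    (f : CSpace N → CSpace M) : Prop :=
  ∀ φ : CSpace M → EReal, IsKSubharmonicOn m φ ΩM → IsKSubharmonicOn n (φ ∘ f) ΩN

/-- The componentwise complex conjugate of a map. -/
def conjMap {N M : ℕ} (f : CSpace N → CSpace M) : CSpace N → CSpace M :=
  fun z => WithLp.toLp 2 fun j => conj (f z j)

end

/-! Suppose first that `F` is a morphism. If `h` is holomorphic on the target and `L` is a real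
linear functional on `ℂ`, then `L ∘ h` and its negative are smooth with vanishing Levi form, hence
`M`-subharmonic; so `u = L ∘ h ∘ F` and `-u` are both `n`-subharmonic. A function and its negative
that both satisfy the submean inequality agree with their regularizations, so `u` is smooth although
nothing was assumed about `F`. The wedge products of `dd^c u` with forms of `Γ_n` are then both
nonnegative and nonpositive. Because `n ≥ 2`, one slot can be filled with an arbitrary positive
form, and this forces the whole complex Hessian to vanish
(`hessOf_eq_zero_of_isKSubharmonicOn_neg`); for `n = 1` only its trace would vanish. Thus `h ∘ F` is
pluriharmonic.

Taking the coordinates `w_j` and the products `w_j w_k` for `h`, the product rule gives `∂F_j(v)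
∂̄F_k(v) + ∂̄F_j(v) ∂F_k(v) = 0`. Since `∂F_j` has holomorphic and `∂̄F_j` antiholomorphic
coefficients, the identity theorem lets one nonzero value of some `∂F_j` annihilate every `∂̄F_k`
(`delPart_eq_zero_or_delbarPart_eq_zero`).

Conversely, `M`-subharmonic functions on `ℂ^M` are the plurisubharmonic ones: their regularizations
have nonnegative Levi form (`exists_smooth_approximation`). A holomorphic or antiholomorphic `F`
pulls the Levi form back (`leviForm_sndDeriv_comp`), and a smooth function with nonnegative Levi
form is `n`-subharmonic for every `n`: the mean value inequality is checked on circles, and the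
inequality for currents is `garding_inequality`, because positive forms lie in `Γ_n`. Fatou's lemma
and dominated convergence carry this to the limit.

Gårding's inequality rests on hyperbolic polynomials. The determinant has no zero at `x + i c β` for
Hermitian `x` and `c > 0`; by the Gauss–Lucas theorem this survives differentiation in the direction
of `β`, so `α ↦ α^k ∧ β^(N-k)` is hyperbolic. Its hyperbolicity cone is closed under addition, mixed
products do not vanish on the cone, and a deformation to `β` shows that they are positive there. -/

/-! ### Algebra of wedge products -/

section WedgeAlgebra

open scoped ComplexOrder

variable {N : ℕ}

/-- `wedgeCoeff` as a multilinear map. -/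
noncomputable def wedgeML (N : ℕ) :
    MultilinearMap ℂ (fun _ : Fin N => Matrix (Fin N) (Fin N) ℂ) ℂ :=
  ∑ σ : Equiv.Perm (Fin N), ∑ τ : Equiv.Perm (Fin N),
    (((Equiv.Perm.sign σ : ℤ) : ℂ) * ((Equiv.Perm.sign τ : ℤ) : ℂ)) •
      (MultilinearMap.mkPiAlgebra ℂ (Fin N) ℂ).compLinearMap
        (fun i => Matrix.entryLinearMap ℂ ℂ (σ i) (τ i))

theorem wedgeML_apply (A : Fin N → Matrix (Fin N) (Fin N) ℂ) : wedgeML N A = wedgeCoeff A := by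
  simp [wedgeML, wedgeCoeff]

/-- Forms of even degree commute. Right translation of both permutations by `π` introduces the sign
of `π` twice, so it cancels. -/
theorem wedgeCoeff_comp_perm (A : Fin N → Matrix (Fin N) (Fin N) ℂ) (π : Equiv.Perm (Fin N)) :
    wedgeCoeff (A ∘ π) = wedgeCoeff A := by
  unfold wedgeCoeff
  rw [← Equiv.sum_comp (Equiv.mulRight π)]
  refine Finset.sum_congr rfl fun σ _ => ?_
  rw [← Equiv.sum_comp (Equiv.mulRight π)]
  refine Finset.sum_congr rfl fun τ _ => ?_
  have h : ∏ i, (A ∘ π) i ((σ * π) i) ((τ * π) i) = ∏ i, A i (σ i) (τ i) :=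
    Equiv.prod_comp π fun i => A i (σ i) (τ i)
  have hs : (((Equiv.Perm.sign π : ℤ) : ℂ)) * ((Equiv.Perm.sign π : ℤ) : ℂ) = 1 := by
    rcases Int.units_eq_one_or (Equiv.Perm.sign π) with h | h <;> simp [h]
  simp only [Equiv.coe_mulRight, h, Equiv.Perm.sign_mul, Units.val_mul, Int.cast_mul]
  linear_combination (((Equiv.Perm.sign σ : ℤ) : ℂ)) * ((Equiv.Perm.sign τ : ℤ) : ℂ) *
    (∏ i, A i (σ i) (τ i)) * hs

/-- Transposition exchanges the roles of `σ` and `τ`. This is what makes products of Hermitian slots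
real. -/
theorem wedgeCoeff_conjTranspose (A : Fin N → Matrix (Fin N) (Fin N) ℂ) :
    wedgeCoeff (fun i => (A i).conjTranspose) = conj (wedgeCoeff A) := by
  unfold wedgeCoeff
  rw [map_sum, Finset.sum_comm]
  refine Finset.sum_congr rfl fun σ _ => ?_
  rw [map_sum]
  refine Finset.sum_congr rfl fun τ _ => ?_
  simp only [map_mul, map_prod, Matrix.conjTranspose_apply, map_intCast, Complex.star_def]
  ring

/-- For fixed `σ` the sum over `τ` is a determinant whose `i`-th row is taken from `A i`.
Multiplicativity of the determinant thereby becomes available for mixed products. -/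
theorem wedgeCoeff_eq_sum_det (A : Fin N → Matrix (Fin N) (Fin N) ℂ) :
    wedgeCoeff A = ∑ σ : Equiv.Perm (Fin N), ((Equiv.Perm.sign σ : ℤ) : ℂ) *
      (Matrix.of fun i k => A i (σ i) k).det := by
  unfold wedgeCoeff
  refine Finset.sum_congr rfl fun σ _ => ?_
  rw [← Matrix.det_transpose, Matrix.det_apply', Finset.mul_sum]
  refine Finset.sum_congr rfl fun τ _ => ?_
  simp [mul_assoc]

theorem wedgeCoeff_mul_right (A : Fin N → Matrix (Fin N) (Fin N) ℂ)
    (V : Matrix (Fin N) (Fin N) ℂ) :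
    wedgeCoeff (fun i => A i * V) = wedgeCoeff A * V.det := by
  rw [wedgeCoeff_eq_sum_det, wedgeCoeff_eq_sum_det, Finset.sum_mul]
  refine Finset.sum_congr rfl fun σ _ => ?_
  rw [mul_assoc, ← Matrix.det_mul]
  congr 2

theorem wedgeCoeff_mul_left (A : Fin N → Matrix (Fin N) (Fin N) ℂ)
    (U : Matrix (Fin N) (Fin N) ℂ) :
    wedgeCoeff (fun i => U * A i) = U.det * wedgeCoeff A := by
  have h := wedgeCoeff_mul_right (fun i => (A i).conjTranspose) U.conjTranspose
  simp only [← Matrix.conjTranspose_mul] at h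
  rw [wedgeCoeff_conjTranspose (fun i => U * A i), wedgeCoeff_conjTranspose,
    Matrix.det_conjTranspose, Complex.star_def, ← map_mul] at h
  rw [(starRingEnd ℂ).injective h, mul_comm]

/-- The conjugation contributes `det U * det (star U) = 1`. Hence all slots may be rewritten in an
orthonormal eigenbasis of one of them. -/
theorem wedgeCoeff_unitary_conj (A : Fin N → Matrix (Fin N) (Fin N) ℂ)
    {U : Matrix (Fin N) (Fin N) ℂ} (hU : U * star U = 1) :
    wedgeCoeff (fun i => U * A i * star U) = wedgeCoeff A := by
  rw [wedgeCoeff_mul_right (fun i => U * A i), wedgeCoeff_mul_left, mul_right_comm,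
    ← Matrix.det_mul, hU, Matrix.det_one, one_mul]

/-- Only the terms with `σ = τ` survive and their signs square to one. The result is a permanent, so
nonnegative entries give a nonnegative value. -/
theorem wedgeCoeff_diagonal (d : Fin N → Fin N → ℂ) :
    wedgeCoeff (fun i => Matrix.diagonal (d i)) =
      ∑ σ : Equiv.Perm (Fin N), ∏ i, d i (σ i) := by
  unfold wedgeCoeff
  refine Finset.sum_congr rfl fun σ _ => ?_
  rw [Finset.sum_eq_single σ]
  · have hs : (((Equiv.Perm.sign σ : ℤ) : ℂ)) * ((Equiv.Perm.sign σ : ℤ) : ℂ) = 1 := by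
      rcases Int.units_eq_one_or (Equiv.Perm.sign σ) with h | h <;> simp [h]
    simp [hs]
  · intro τ _ hτ
    obtain ⟨i, hi⟩ : ∃ i, σ i ≠ τ i := by
      by_contra! h
      exact hτ (Equiv.ext fun i => (h i).symm)
    refine mul_eq_zero_of_right _ (Finset.prod_eq_zero (Finset.mem_univ i) ?_)
    exact Matrix.diagonal_apply_ne _ hi
  · simp

theorem wedgeCoeff_const (A : Matrix (Fin N) (Fin N) ℂ) :
    wedgeCoeff (fun _ => A) = (N.factorial : ℂ) * A.det := by
  have h := wedgeCoeff_mul_right (fun _ => (1 : Matrix (Fin N) (Fin N) ℂ)) A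
  have h1 := wedgeCoeff_diagonal (fun _ _ : Fin N => (1 : ℂ))
  simp only [Matrix.diagonal_one, Finset.prod_const_one, Finset.sum_const, Finset.card_univ,
    Fintype.card_perm, Fintype.card_fin, nsmul_eq_mul, mul_one] at h1
  simpa [h1] using h

theorem wedgeCoeff_im_eq_zero {A : Fin N → Matrix (Fin N) (Fin N) ℂ}
    (hA : ∀ i, (A i).IsHermitian) : (wedgeCoeff A).im = 0 := by
  have h := wedgeCoeff_conjTranspose A
  rw [show (fun i => (A i).conjTranspose) = A from funext fun i => hA i] at h
  exact Complex.conj_eq_iff_im.mp h.symm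

theorem continuous_wedgeCoeff :
    Continuous (wedgeCoeff : (Fin N → Matrix (Fin N) (Fin N) ℂ) → ℂ) := by
  unfold wedgeCoeff
  fun_prop

/-- A Hermitian matrix is unitarily diagonalizable with real eigenvalues. -/
theorem exists_unitary_diagonal {A : Matrix (Fin N) (Fin N) ℂ} (hA : A.IsHermitian) :
    ∃ (U : Matrix (Fin N) (Fin N) ℂ) (d : Fin N → ℝ), U * star U = 1 ∧ star U * U = 1 ∧
      A = U * Matrix.diagonal (fun i => (d i : ℂ)) * star U := by
  refine ⟨hA.eigenvectorUnitary, hA.eigenvalues, ?_, ?_, ?_⟩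
  · exact Unitary.mul_star_self_of_mem hA.eigenvectorUnitary.2
  · exact Unitary.star_mul_self_of_mem hA.eigenvectorUnitary.2
  · exact hA.spectral_theorem

theorem posSemidef_unitary_conj {U : Matrix (Fin N) (Fin N) ℂ} {d : Fin N → ℝ}
    (hd : ∀ i, 0 ≤ d i) :
    (U * Matrix.diagonal (fun i => (d i : ℂ)) * star U).PosSemidef := by
  refine Matrix.PosSemidef.mul_mul_conjTranspose_same (Matrix.PosSemidef.diagonal ?_) U
  intro i
  simpa using hd i

/-- In an eigenbasis the mixed product with `β` is a permanent with nonnegative entries. -/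
theorem posSemidef_mem_gammaCone {A : Matrix (Fin N) (Fin N) ℂ} (hA : A.PosSemidef) (k : ℕ) :
    A ∈ GammaCone N k := by
  refine ⟨hA.1, fun l _ _ => ?_⟩
  obtain ⟨U, d, hU, hU', h⟩ := exists_unitary_diagonal hA.1
  have hd : ∀ i, 0 ≤ d i := by
    have h2 : (star U * A * U).PosSemidef := hA.conjTranspose_mul_mul_same U
    have h3 : star U * A * U = Matrix.diagonal (fun i => (d i : ℂ)) := by
      rw [h]
      simp only [← mul_assoc, hU', one_mul]
      rw [mul_assoc, hU', mul_one]
    rw [h3, Matrix.posSemidef_diagonal_iff] at h2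
    intro i
    exact_mod_cast h2 i
  have : (fun i : Fin N => if (i : ℕ) < l then A else 1) =
      fun i : Fin N => U * Matrix.diagonal (fun j => ((if (i : ℕ) < l then d j else 1 : ℝ) : ℂ)) *
        star U := by
    funext i
    split_ifs
    · exact h
    · simp [hU]
  rw [this, wedgeCoeff_unitary_conj _ hU, wedgeCoeff_diagonal]
  simp only [← Complex.ofReal_prod, ← Complex.ofReal_sum, Complex.ofReal_re]
  refine Finset.sum_nonneg fun σ _ => Finset.prod_nonneg fun i _ => ?_
  split_ifs
  · exact hd _
  · exact zero_le_one

/-- Reading off positivity of a Hermitian matrix from wedge products with nonnegative forms. -/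
theorem posSemidef_of_wedgeCoeff_nonneg (hN : 1 ≤ N) {H : Matrix (Fin N) (Fin N) ℂ}
    (hH : H.IsHermitian)
    (h : ∀ α : ℕ → Matrix (Fin N) (Fin N) ℂ, (∀ i, α i ∈ GammaCone N N) →
      0 ≤ (wedgeCoeff fun i : Fin N =>
        if (i : ℕ) = 0 then H else if (i : ℕ) < N then α i else 1).re) : H.PosSemidef := by
  obtain ⟨U, d, hU, hU', hd⟩ := exists_unitary_diagonal hH
  rw [hd]
  refine posSemidef_unitary_conj fun j => ?_
  -- All remaining slots receive the projection that kills the `j`-th eigenvector. A permutation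
  -- then contributes only if it assigns `j` to slot `0`, and the product is a positive multiple of
  -- the eigenvalue `d j`.
  have h1 := h (fun _ => U * Matrix.diagonal (fun i => ((if i = j then 0 else 1 : ℝ) : ℂ)) * star U)
    (fun _ => posSemidef_mem_gammaCone (posSemidef_unitary_conj fun i => by split_ifs <;> simp) _)
  have : (fun i : Fin N => if (i : ℕ) = 0 then H else if (i : ℕ) < N then
      U * Matrix.diagonal (fun i => ((if i = j then 0 else 1 : ℝ) : ℂ)) * star U else 1) =
      fun i : Fin N => U * Matrix.diagonal (fun l => ((if (i : ℕ) = 0 then d l else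
        if l = j then 0 else 1 : ℝ) : ℂ)) * star U := by
    funext i
    split_ifs with h2
    · exact hd
    · rfl
    · exact absurd i.2 ‹_›
  rw [this, wedgeCoeff_unitary_conj _ hU, wedgeCoeff_diagonal] at h1
  simp only [← Complex.ofReal_prod, ← Complex.ofReal_sum, Complex.ofReal_re] at h1
  by_contra! hneg
  refine absurd h1 (not_le.mpr ?_)
  set z : Fin N := ⟨0, hN⟩
  have key : ∀ σ : Equiv.Perm (Fin N), ∏ i : Fin N, (if (i : ℕ) = 0 then d (σ i) else
      if σ i = j then 0 else 1) = if σ z = j then d j else 0 := by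
    intro σ
    split_ifs with hz
    · rw [Finset.prod_eq_single z]
      · simp [z, ← hz]
      · intro i _ hi
        have h0 : (i : ℕ) ≠ 0 := fun h => hi (Fin.ext h)
        have h2 : σ i ≠ j := fun h => hi (σ.injective (h.trans hz.symm))
        simp [h0, h2]
      · simp
    · have hi : σ.symm j ≠ z := fun h => hz (by rw [← h]; simp)
      have h0 : ((σ.symm j : Fin N) : ℕ) ≠ 0 := fun h => hi (Fin.ext h)
      exact Finset.prod_eq_zero (Finset.mem_univ (σ.symm j)) (by simp [h0])
  simp only [key]
  refine Finset.sum_neg' (fun σ _ => ?_) ⟨Equiv.swap z j, Finset.mem_univ _, ?_⟩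
  · split_ifs
    · exact hneg.le
    · exact le_rfl
  · simpa using hneg

/-- A Hermitian matrix whose wedge products with nonnegative forms vanish is zero. -/
theorem eq_zero_of_wedgeCoeff_eq_zero {k : ℕ} (hk : 1 < k) (hkN : k ≤ N)
    {H : Matrix (Fin N) (Fin N) ℂ} (hH : H.IsHermitian)
    (h : ∀ α : ℕ → Matrix (Fin N) (Fin N) ℂ, (∀ i, α i ∈ GammaCone N k) →
      (wedgeCoeff fun i : Fin N =>
        if (i : ℕ) = 0 then H else if (i : ℕ) < k then α i else 1).re = 0) : H = 0 := by
  obtain ⟨U, d, hU, hU', hd⟩ := exists_unitary_diagonal hH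
  set z : Fin N := ⟨0, by omega⟩ with hz
  set o : Fin N := ⟨1, by omega⟩ with ho
  have hzo : z ≠ o := by simp [hz, ho]
  have key : ∀ e : Fin N → ℝ, (∀ j, 0 ≤ e j) →
      ∑ σ : Equiv.Perm (Fin N), d (σ z) * e (σ o) = 0 := by
    intro e he
    -- Slot `1` is free because `1 < k`; it receives an arbitrary nonnegative diagonal form, and the
    -- slots from `2` on receive `β`.
    have h1 := h (fun i => if i = 1 then U * Matrix.diagonal (fun i => (e i : ℂ)) * star U else 1)
      (fun i => by
        split_ifs
        · exact posSemidef_mem_gammaCone (posSemidef_unitary_conj he) _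
        · exact posSemidef_mem_gammaCone Matrix.PosSemidef.one _)
    have : (fun i : Fin N => if (i : ℕ) = 0 then H else if (i : ℕ) < k then
        (if (i : ℕ) = 1 then U * Matrix.diagonal (fun i => (e i : ℂ)) * star U else 1) else 1) =
        fun i : Fin N => U * Matrix.diagonal (fun l => ((if (i : ℕ) = 0 then d l else
          if (i : ℕ) = 1 then e l else 1 : ℝ) : ℂ)) * star U := by
      funext i
      split_ifs with h2 h3 h4
      · exact hd
      · rfl
      · simp [hU]
      · omega
      · simp [hU]
    rw [this, wedgeCoeff_unitary_conj _ hU, wedgeCoeff_diagonal] at h1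
    simp only [← Complex.ofReal_prod, ← Complex.ofReal_sum, Complex.ofReal_re] at h1
    rw [← h1]
    refine Finset.sum_congr rfl fun σ _ => ?_
    rw [Finset.prod_eq_mul z o hzo]
    · simp [hz, ho]
    · intro i _ hi
      have h0 : (i : ℕ) ≠ 0 := fun h => hi.1 (Fin.ext h)
      have h1 : (i : ℕ) ≠ 1 := fun h => hi.2 (Fin.ext h)
      simp [h0, h1]
    · simp
    · simp
  have hsum : ∑ σ : Equiv.Perm (Fin N), d (σ z) = 0 := by
    simpa using key (fun _ => 1) (fun _ => zero_le_one)
  have hz0 : ∀ j, d j = 0 := by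
    -- With `e` the indicator of `j`, the sum is a positive multiple of the sum of all eigenvalues
    -- other than `d j`. Comparing `j` with `l` through the substitution `σ ↦ (j l) σ` leaves a
    -- positive multiple of `d l - d j`. So all eigenvalues agree, and `hsum` makes them zero.
    have hle : ∀ j l, ¬ d j < d l := by
      intro j l hlt
      have hjl : j ≠ l := fun h => by simp [h] at hlt
      have e1 := key (fun i => if i = j then 1 else 0) (fun i => by split_ifs <;> simp)
      have e2 := key (fun i => if i = l then 1 else 0) (fun i => by split_ifs <;> simp)
      rw [← Equiv.sum_comp (Equiv.mulLeft (Equiv.swap j l))] at e2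
      have e3 := sub_eq_zero.mpr (e1.trans e2.symm)
      rw [← Finset.sum_sub_distrib] at e3
      have e4 : ∀ σ : Equiv.Perm (Fin N),
          d (σ z) * (if σ o = j then (1 : ℝ) else 0) -
            d ((Equiv.mulLeft (Equiv.swap j l)) σ z) *
              (if (Equiv.mulLeft (Equiv.swap j l)) σ o = l then 1 else 0) =
          if σ o = j ∧ σ z = l then d l - d j else 0 := by
        intro σ
        have h1 : (Equiv.mulLeft (Equiv.swap j l)) σ o = l ↔ σ o = j := by
          simp only [Equiv.coe_mulLeft, Equiv.Perm.mul_apply]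
          rw [← Equiv.eq_symm_apply]
          simp
        by_cases h2 : σ o = j
        · have h3 : σ z ≠ j := fun h => hzo (σ.injective (h.trans h2.symm))
          by_cases h4 : σ z = l
          · simp [h2, h4, Equiv.swap_apply_right, Equiv.swap_apply_left]
          · simp [h2, h4, Equiv.swap_apply_of_ne_of_ne h3 h4]
        · simp only [h1, h2]
          simp
      simp only [e4] at e3
      refine absurd e3 (ne_of_gt (Finset.sum_pos' (fun σ _ => ?_) ?_))
      · split_ifs
        · linarith
        · exact le_rfl
      · refine ⟨Equiv.swap z l * Equiv.swap o (Equiv.swap z l j), Finset.mem_univ _, ?_⟩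
        have h5 : Equiv.swap z l j ≠ z := by
          rw [Ne, Equiv.swap_apply_eq_iff]
          simpa using hjl
        have h6 : (Equiv.swap z l * Equiv.swap o (Equiv.swap z l j)) o = j := by simp
        have h7 : (Equiv.swap z l * Equiv.swap o (Equiv.swap z l j)) z = l := by
          rw [Equiv.Perm.mul_apply, Equiv.swap_apply_of_ne_of_ne hzo (Ne.symm h5)]
          simp
        rw [if_pos ⟨h6, h7⟩]
        linarith
    intro j
    have hc : ∀ σ : Equiv.Perm (Fin N), d (σ z) = d j := fun σ =>
      le_antisymm (not_lt.mp (hle _ _)) (not_lt.mp (hle _ _))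
    simp only [hc, Finset.sum_const, Finset.card_univ, Fintype.card_perm, nsmul_eq_mul,
      mul_eq_zero, Nat.cast_eq_zero] at hsum
    exact hsum.resolve_left (Nat.factorial_ne_zero _)
  rw [hd]
  simp [hz0]

end WedgeAlgebra

/-! ### Stability of mixed wedge products -/

section Stability

open Polynomial

variable {N : ℕ}

/-- The polynomial `z ↦ wedgeCoeff` of `k` slots `x + z y` and the slots `a i`, `k ≤ i`. -/
noncomputable def slotPoly (k : ℕ) (a : Fin N → Matrix (Fin N) (Fin N) ℂ)
    (x y : Matrix (Fin N) (Fin N) ℂ) : ℂ[X] :=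
  ∑ σ : Equiv.Perm (Fin N), ∑ τ : Equiv.Perm (Fin N),
    C (((Equiv.Perm.sign σ : ℤ) : ℂ) * ((Equiv.Perm.sign τ : ℤ) : ℂ)) *
      ∏ i : Fin N, if (i : ℕ) < k then C (x (σ i) (τ i)) + X * C (y (σ i) (τ i))
        else C (a i (σ i) (τ i))

theorem eval_slotPoly (k : ℕ) (a : Fin N → Matrix (Fin N) (Fin N) ℂ)
    (x y : Matrix (Fin N) (Fin N) ℂ) (z : ℂ) :
    (slotPoly k a x y).eval z =
      wedgeCoeff (fun i : Fin N => if (i : ℕ) < k then x + z • y else a i) := by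
  unfold slotPoly wedgeCoeff
  simp only [eval_finsetSum, eval_mul, eval_C, eval_prod]
  refine Finset.sum_congr rfl fun σ _ => Finset.sum_congr rfl fun τ _ => ?_
  congr 1
  refine Finset.prod_congr rfl fun i _ => ?_
  split_ifs <;> simp [mul_comm z]

theorem card_filter_val_lt {k : ℕ} (hk : k ≤ N) :
    (Finset.univ.filter fun i : Fin N => (i : ℕ) < k).card = k := by
  rw [Fin.card_filter_val_lt, min_eq_right hk]

theorem natDegree_slotPoly_le {k : ℕ} (hk : k ≤ N) (a : Fin N → Matrix (Fin N) (Fin N) ℂ)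
    (x y : Matrix (Fin N) (Fin N) ℂ) : (slotPoly k a x y).natDegree ≤ k := by
  unfold slotPoly
  refine natDegree_sum_le_of_forall_le _ _ fun σ _ => natDegree_sum_le_of_forall_le _ _ fun τ _ => ?_
  refine (natDegree_C_mul_le _ _).trans ((natDegree_prod_le _ _).trans ?_)
  calc ∑ i : Fin N, _ ≤ ∑ i : Fin N, if (i : ℕ) < k then 1 else 0 := by
        refine Finset.sum_le_sum fun i _ => ?_
        split_ifs
        · compute_degree
        · simp
    _ = k := by rw [Finset.sum_boole, card_filter_val_lt hk]; simp

/-- The top power arises only by choosing `z y` in each of the `k` variable slots. This coefficient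
controls the degree of the polynomial and its growth. -/
theorem coeff_slotPoly {k : ℕ} (hk : k ≤ N) (a : Fin N → Matrix (Fin N) (Fin N) ℂ)
    (x y : Matrix (Fin N) (Fin N) ℂ) : (slotPoly k a x y).coeff k =
      wedgeCoeff (fun i : Fin N => if (i : ℕ) < k then y else a i) := by
  unfold slotPoly wedgeCoeff
  simp only [finsetSum_coeff, coeff_C_mul]
  refine Finset.sum_congr rfl fun σ _ => Finset.sum_congr rfl fun τ _ => ?_
  congr 1
  rw [Finset.prod_ite, ← map_prod, coeff_mul_C]
  have h := coeff_prod_of_natDegree_le (Finset.univ.filter fun i : Fin N => (i : ℕ) < k)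
    (fun i => C (x (σ i) (τ i)) + X * C (y (σ i) (τ i))) 1 (fun i _ => by compute_degree)
  rw [card_filter_val_lt hk, mul_one] at h
  rw [h]
  have h2 : ∀ i : Fin N, (if (i : ℕ) < k then y else a i) (σ i) (τ i) =
      if (i : ℕ) < k then y (σ i) (τ i) else a i (σ i) (τ i) := fun i => by split_ifs <;> rfl
  simp only [h2]
  rw [Finset.prod_ite]
  congr 1
  refine Finset.prod_congr rfl fun i _ => ?_
  simp [coeff_C]

/-- The product rule gives one term for each of the `k + 1` variable slots, with `y` in that slot.
The slots commute, so the terms coincide and `y` can be moved to slot `k`. -/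
theorem eval_derivative_slotPoly {k : ℕ} (hk : k < N) (a : Fin N → Matrix (Fin N) (Fin N) ℂ)
    (x y : Matrix (Fin N) (Fin N) ℂ) (z : ℂ) :
    (derivative (slotPoly (k + 1) a x y)).eval z = (k + 1) *
      wedgeCoeff (fun i : Fin N => if (i : ℕ) < k then x + z • y else
        if (i : ℕ) = k then y else a i) := by
  set B : Fin N → Matrix (Fin N) (Fin N) ℂ :=
    fun i => if (i : ℕ) < k + 1 then x + z • y else a i with hB
  have h1 : (derivative (slotPoly (k + 1) a x y)).eval z =
      ∑ j : Fin N, if (j : ℕ) < k + 1 then wedgeCoeff (Function.update B j y) else 0 := by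
    have h0 : ∀ j : Fin N, (if (j : ℕ) < k + 1 then wedgeCoeff (Function.update B j y) else 0) =
        ∑ σ : Equiv.Perm (Fin N), ∑ τ : Equiv.Perm (Fin N),
          (((Equiv.Perm.sign σ : ℤ) : ℂ) * ((Equiv.Perm.sign τ : ℤ) : ℂ)) *
            ((∏ i ∈ Finset.univ.erase j, B i (σ i) (τ i)) *
              if (j : ℕ) < k + 1 then y (σ j) (τ j) else 0) := by
      intro j
      split_ifs with hj
      · unfold wedgeCoeff
        refine Finset.sum_congr rfl fun σ _ => Finset.sum_congr rfl fun τ _ => ?_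
        rw [← Finset.prod_erase_mul _ _ (Finset.mem_univ j)]
        congr 2
        · refine Finset.prod_congr rfl fun i hi => ?_
          rw [Function.update_of_ne (Finset.ne_of_mem_erase hi)]
        · simp
      · simp
    simp only [h0]
    rw [Finset.sum_comm]
    unfold slotPoly
    simp only [derivative_sum, eval_finsetSum]
    refine Finset.sum_congr rfl fun σ _ => ?_
    rw [Finset.sum_comm]
    refine Finset.sum_congr rfl fun τ _ => ?_
    rw [derivative_C_mul, derivative_prod_finset, eval_mul, eval_C, eval_finsetSum,
      ← Finset.mul_sum]
    congr 1
    refine Finset.sum_congr rfl fun j _ => ?_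
    rw [eval_mul, eval_prod]
    congr 1
    · refine Finset.prod_congr rfl fun i _ => ?_
      simp only [hB]
      split_ifs <;> simp [mul_comm z]
    · split_ifs <;> simp
  have h2 : ∀ j : Fin N, (j : ℕ) < k + 1 → wedgeCoeff (Function.update B j y) =
      wedgeCoeff (fun i : Fin N => if (i : ℕ) < k then x + z • y else
        if (i : ℕ) = k then y else a i) := by
    intro j hj
    set o : Fin N := ⟨k, hk⟩ with ho
    rw [← wedgeCoeff_comp_perm _ (Equiv.swap j o)]
    congr 1
    funext i
    simp only [Function.comp_apply]
    by_cases hio : i = o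
    · subst hio
      simp [ho]
    · have hik : (i : ℕ) ≠ k := fun h => hio (Fin.ext h)
      by_cases hij : i = j
      · subst hij
        have : (i : ℕ) < k := by omega
        rw [Equiv.swap_apply_left, Function.update_of_ne (Ne.symm hio)]
        simp [hB, ho, this]
      · rw [Equiv.swap_apply_of_ne_of_ne hij hio, Function.update_of_ne hij]
        have : (i : ℕ) < k + 1 ↔ (i : ℕ) < k := by omega
        simp only [hB, this, hik, if_false]
  rw [h1, Finset.sum_congr rfl fun j _ => by rw [ite_congr rfl (h2 j) fun _ => rfl],
    ← Finset.sum_filter, Finset.sum_const, card_filter_val_lt hk]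
  simp

/-- Differentiation in the direction of a form of the cone preserves stability. -/
theorem stable_step {k : ℕ} (hk : k < N) {a : Fin N → Matrix (Fin N) (Fin N) ℂ}
    {K : Set (Matrix (Fin N) (Fin N) ℂ)} (ha : (a ⟨k, hk⟩).IsHermitian) (haK : a ⟨k, hk⟩ ∈ K)
    (hK : ∀ y ∈ K, ∀ s : ℝ, 0 ≤ s → y + (s : ℂ) • a ⟨k, hk⟩ ∈ K)
    (h : ∀ x : Matrix (Fin N) (Fin N) ℂ, x.IsHermitian → ∀ y ∈ K,
      wedgeCoeff (fun i : Fin N => if (i : ℕ) < k + 1 then x + Complex.I • y else a i) ≠ 0)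
    {x : Matrix (Fin N) (Fin N) ℂ} (hx : x.IsHermitian) {y : Matrix (Fin N) (Fin N) ℂ}
    (hy : y ∈ K) :
    wedgeCoeff (fun i : Fin N => if (i : ℕ) < k then x + Complex.I • y else a i) ≠ 0 := by
  set b := a ⟨k, hk⟩ with hb
  set p := slotPoly (k + 1) a (x + Complex.I • y) b with hp
  -- The hypothesis at `x = 0`, `y = b` says that `I ^ (k + 1)` times this coefficient is nonzero.
  have hcoeff : p.coeff (k + 1) ≠ 0 := by
    rw [hp, coeff_slotPoly hk]
    have h1 := h 0 Matrix.isHermitian_zero b haK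
    intro h2
    apply h1
    have h3 := (wedgeML N).map_smul_univ
      (fun i : Fin N => if (i : ℕ) < k + 1 then Complex.I else 1)
      (fun i => if (i : ℕ) < k + 1 then b else a i)
    rw [wedgeML_apply, wedgeML_apply, h2, smul_zero] at h3
    rw [← h3]
    congr 1
    funext i
    split_ifs <;> simp
  -- Adding `z b` to `x + i y` adds `Re z` times `b` to `x` and `Im z` times `b` to `y`. If `Im z ≥
  -- 0`, the new `y` is still in `K`.
  have hroots : ∀ z : ℂ, p.IsRoot z → z.im < 0 := by
    intro z hz
    by_contra! him
    rw [Polynomial.IsRoot, hp, eval_slotPoly] at hz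
    refine h (x + (z.re : ℂ) • b) (hx.add ?_) (y + (z.im : ℂ) • b) (hK y hy _ him) ?_
    · rw [Matrix.IsHermitian, Matrix.conjTranspose_smul, ha]
      simp
    · rw [← hz]
      congr 1
      funext i
      split_ifs
      · rw [show z • b = ((z.re : ℂ) + (z.im : ℂ) * Complex.I) • b by rw [Complex.re_add_im]]
        module
      · rfl
  have hdeg : 0 < p.degree := by
    refine lt_of_lt_of_le ?_ (le_degree_of_ne_zero hcoeff)
    exact_mod_cast Nat.succ_pos k
  have hp0 : p ≠ 0 := fun h => by simp [h] at hcoeff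
  have hp' : derivative p ≠ 0 := by
    intro h
    have := derivative_eq_zero.mp h
    rw [← natDegree_pos_iff_degree_pos] at hdeg
    omega
  intro hcontra
  have hr : (0 : ℂ) ∈ (derivative p).rootSet ℂ := by
    rw [mem_rootSet]
    refine ⟨hp', ?_⟩
    rw [coe_aeval_eq_eval, hp, eval_derivative_slotPoly hk]
    refine mul_eq_zero_of_right _ ?_
    refine Eq.trans ?_ hcontra
    congr 1
    funext i
    split_ifs with h1 h2
    · rw [zero_smul, add_zero]
    · rw [hb]
      congr 1
      exact Fin.ext h2.symm
    · rfl
  -- Gauss–Lucas: the zeros of the derivative lie in the convex hull of the zeros of `p`, hence in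
  -- the open lower half plane, which does not contain `0`.
  have h1 := rootSet_derivative_subset_convexHull_rootSet hdeg hr
  have hconv : Convex ℝ {z : ℂ | z.im < 0} := convex_halfSpace_im_lt 0
  have h2 := convexHull_min (s := p.rootSet ℂ) (t := {z : ℂ | z.im < 0}) (fun z hz => by
    rw [mem_rootSet, coe_aeval_eq_eval] at hz
    exact hroots z hz.2) hconv h1
  simp at h2

/-- Repeated differentiation freezes the slots from `m - 1` down to `j` at the forms `a i` and keeps
the absence of zeros for the slots below `j`. -/
theorem stable_descend {a : Fin N → Matrix (Fin N) (Fin N) ℂ}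
    {K : Set (Matrix (Fin N) (Fin N) ℂ)} {j m : ℕ} (hjm : j ≤ m) (hm : m ≤ N)
    (ha : ∀ i : Fin N, j ≤ (i : ℕ) → (i : ℕ) < m → (a i).IsHermitian ∧ a i ∈ K ∧
      ∀ y ∈ K, ∀ s : ℝ, 0 ≤ s → y + (s : ℂ) • a i ∈ K)
    (h : ∀ x : Matrix (Fin N) (Fin N) ℂ, x.IsHermitian → ∀ y ∈ K,
      wedgeCoeff (fun i : Fin N => if (i : ℕ) < m then x + Complex.I • y else a i) ≠ 0) :
    ∀ x : Matrix (Fin N) (Fin N) ℂ, x.IsHermitian → ∀ y ∈ K,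
      wedgeCoeff (fun i : Fin N => if (i : ℕ) < j then x + Complex.I • y else a i) ≠ 0 := by
  induction m, hjm using Nat.le_induction with
  | base => exact h
  | succ m hjm ih =>
    refine ih (by omega) (fun i h1 h2 => ha i h1 (by omega)) fun x hx y hy => ?_
    obtain ⟨h1, h2, h3⟩ := ha ⟨m, hm⟩ hjm (Nat.lt_succ_self m)
    exact stable_step hm h1 h2 h3 h hx hy

end Stability

/-! ### Gårding's inequality -/

section Garding

open Polynomial Filter Topology

variable {N k : ℕ}

/-- A polynomial without zeros in the closed upper half plane is bounded below there. -/
theorem norm_eval_ge_of_roots_im_neg {q : ℂ[X]} (hdeg : q.natDegree ≤ k) (hq : q.coeff k ≠ 0)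
    (hroots : ∀ z : ℂ, 0 ≤ z.im → q.eval z ≠ 0) {z : ℂ} (hz : 0 ≤ z.im) :
    ‖q.coeff k‖ * z.im ^ k ≤ ‖q.eval z‖ := by
  have hk : q.natDegree = k := le_antisymm hdeg (le_natDegree_of_ne_zero hq)
  have hs := IsAlgClosed.splits q
  have hq0 : q ≠ 0 := fun h => hq (by simp [h])
  rw [hs.eval_eq_prod_roots, norm_mul, leadingCoeff, hk]
  refine mul_le_mul_of_nonneg_left ?_ (norm_nonneg _)
  have hcard : q.roots.card = k := by rw [← hs.natDegree_eq_card_roots, hk]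
  have key : ∀ s : Multiset ℂ, (∀ r ∈ s, r.im < 0) →
      z.im ^ s.card ≤ ‖(s.map (z - ·)).prod‖ := by
    intro s
    induction s using Multiset.induction_on with
    | empty => simp
    | cons r s ih =>
      intro hr
      have h1 := ih fun t ht => hr t (Multiset.mem_cons_of_mem ht)
      have h2 := hr r (Multiset.mem_cons_self r s)
      rw [Multiset.card_cons, Multiset.map_cons, Multiset.prod_cons, norm_mul, pow_succ, mul_comm]
      refine mul_le_mul ?_ h1 (pow_nonneg hz _) (norm_nonneg _)
      -- Each linear factor has modulus at least `Im z - Im r`, which exceeds `Im z`.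
      have := Complex.abs_im_le_norm (z - r)
      rw [Complex.sub_im] at this
      have := le_abs_self (z.im - r.im)
      linarith
  rw [← hcard]
  refine key _ fun r hr => ?_
  by_contra! h
  exact hroots r h ((mem_roots hq0).mp hr)

/-- The form `α ↦ α^k ∧ β^(N-k)`. -/
noncomputable def kForm (k : ℕ) (X : Matrix (Fin N) (Fin N) ℂ) : ℂ :=
  wedgeCoeff fun i : Fin N => if (i : ℕ) < k then X else 1

theorem continuous_kForm : Continuous (kForm (N := N) k) := by
  unfold kForm
  refine continuous_wedgeCoeff.comp (continuous_pi fun i => ?_)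
  split_ifs <;> fun_prop

theorem kForm_smul (hk : k ≤ N) (c : ℂ) (X : Matrix (Fin N) (Fin N) ℂ) :
    kForm k (c • X) = c ^ k * kForm k X := by
  have h := (wedgeML N).map_smul_univ (fun i : Fin N => if (i : ℕ) < k then c else 1)
    (fun i => if (i : ℕ) < k then X else 1)
  rw [wedgeML_apply, wedgeML_apply, Finset.prod_ite, Finset.prod_const, Finset.prod_const_one,
    card_filter_val_lt hk, mul_one, smul_eq_mul] at h
  rw [kForm, kForm, ← h]
  congr 1
  funext i
  split_ifs <;> simp

/-- A quantitative form of the absence of zeros. Unlike nonvanishing, it passes to limits of `x`,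
since the bound depends on `a` and `z` only. -/
theorem norm_kForm_ge (hk : k ≤ N) {x a : Matrix (Fin N) (Fin N) ℂ} (ha : kForm k a ≠ 0)
    (h : ∀ z : ℂ, 0 ≤ z.im → kForm k (x + z • a) ≠ 0) {z : ℂ} (hz : 0 ≤ z.im) :
    ‖kForm k a‖ * z.im ^ k ≤ ‖kForm k (x + z • a)‖ := by
  have hc := coeff_slotPoly hk (fun _ => 1) x a
  have he := eval_slotPoly k (fun _ => 1) x a
  have := norm_eval_ge_of_roots_im_neg (natDegree_slotPoly_le hk (fun _ => 1) x a)
    (by rw [hc]; exact ha) (fun z hz => by rw [he]; exact h z hz) hz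
  rwa [hc, he] at this

/-- Zeros cannot cross the real axis along a path of polynomials without real zeros. -/
theorem kForm_ne_zero_of_path (hk : k ≤ N) {x₀ x₁ a : Matrix (Fin N) (Fin N) ℂ}
    (ha : kForm k a ≠ 0)
    (hreal : ∀ s ∈ Icc (0 : ℝ) 1, ∀ t : ℝ, kForm k (x₀ + (s : ℂ) • x₁ + (t : ℂ) • a) ≠ 0)
    (h0 : ∀ z : ℂ, 0 ≤ z.im → kForm k (x₀ + z • a) ≠ 0) :
    ∀ z : ℂ, 0 ≤ z.im → kForm k (x₀ + x₁ + z • a) ≠ 0 := by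
  set S : Set ℝ := {s | ∀ z : ℂ, 0 ≤ z.im → kForm k (x₀ + (s : ℂ) • x₁ + z • a) ≠ 0} with hS
  have hcont : Continuous fun p : ℝ × ℂ => kForm k (x₀ + (p.1 : ℂ) • x₁ + p.2 • a) :=
    continuous_kForm.comp (by fun_prop)
  -- For `Im z > 0` nonvanishing is equivalent to the lower bound of `norm_kForm_ge`, a closed
  -- condition in `s`; real `z` are covered by `hreal`.
  have hclosed : IsClosed (S ∩ Icc 0 1) := by
    have : S ∩ Icc 0 1 = {s : ℝ | ∀ z : ℂ, 0 ≤ z.im →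
        ‖kForm k a‖ * z.im ^ k ≤ ‖kForm k (x₀ + (s : ℂ) • x₁ + z • a)‖} ∩ Icc 0 1 := by
      ext s
      constructor
      · exact fun h => ⟨fun z hz => norm_kForm_ge hk ha h.1 hz, h.2⟩
      · refine fun h => ⟨fun z hz => ?_, h.2⟩
        rcases hz.eq_or_lt with h1 | h1
        · have h2 : z = (z.re : ℂ) := Complex.ext rfl h1.symm
          rw [h2]
          exact hreal s h.2 _
        · have h3 := h.1 z hz
          intro h4
          rw [h4, norm_zero] at h3
          have : 0 < ‖kForm k a‖ * z.im ^ k := mul_pos (norm_pos_iff.mpr ha) (pow_pos h1 _)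
          linarith
    rw [this]
    refine IsClosed.inter ?_ isClosed_Icc
    simp only [ofPred_forall]
    refine isClosed_iInter fun z => isClosed_iInter fun _ => ?_
    exact isClosed_le continuous_const
      ((hcont.comp (Continuous.prodMk continuous_id continuous_const)).norm)
  -- The leading coefficient `kForm k a` is nonzero, so the zeros stay bounded uniformly in `s`. By
  -- homogeneity, with `w = z⁻¹` this is nonvanishing near `w = 0`, uniform by compactness of `[0,
  -- 1]`.
  obtain ⟨R, hR⟩ : ∃ R : ℝ, ∀ s ∈ Icc (0 : ℝ) 1, ∀ z : ℂ, R < ‖z‖ →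
      kForm k (x₀ + (s : ℂ) • x₁ + z • a) ≠ 0 := by
    have h1 : ∀ᶠ w : ℂ in 𝓝 0, ∀ s ∈ Icc (0 : ℝ) 1,
        kForm k (a + w • (x₀ + (s : ℂ) • x₁)) ≠ 0 := by
      refine isCompact_Icc.eventually_forall_of_forall_eventually fun s _ => ?_
      have hc : Continuous fun p : ℂ × ℝ => kForm k (a + p.1 • (x₀ + (p.2 : ℂ) • x₁)) :=
        continuous_kForm.comp (by fun_prop)
      exact hc.continuousAt.eventually_ne (by simpa using ha)
    obtain ⟨δ, hδ, h2⟩ := Metric.eventually_nhds_iff.mp h1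
    refine ⟨δ⁻¹, fun s hs z hz => ?_⟩
    have hz0 : z ≠ 0 := by
      rintro rfl
      rw [norm_zero] at hz
      exact absurd hz (not_lt.mpr (inv_pos.mpr hδ).le)
    have h3 := h2 (y := z⁻¹) (by
      rw [dist_zero_right, norm_inv]
      exact inv_lt_of_inv_lt₀ hδ hz) s hs
    have h4 : x₀ + (s : ℂ) • x₁ + z • a = z • (a + z⁻¹ • (x₀ + (s : ℂ) • x₁)) := by
      rw [smul_add z a, smul_smul, mul_inv_cancel₀ hz0, one_smul, add_comm]
    rw [h4, kForm_smul hk]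
    exact mul_ne_zero (pow_ne_zero _ hz0) h3
  have h0S : (0 : ℝ) ∈ S := by
    intro z hz
    rw [Complex.ofReal_zero, zero_smul, add_zero]
    exact h0 z hz
  -- Inside the ball of radius `R` the closed upper half plane is compact, so nonvanishing persists
  -- for nearby `s`; outside it `hR` applies.
  have hopen : ∀ s ∈ S ∩ Ico 0 1, S ∈ 𝓝[>] s := by
    intro s hs
    have hcomp : IsCompact ({z : ℂ | 0 ≤ z.im} ∩ Metric.closedBall 0 R) :=
      (isCompact_closedBall (0 : ℂ) R).inter_left
        (isClosed_le continuous_const Complex.continuous_im)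
    have h1 : ∀ᶠ s' : ℝ in 𝓝 s, ∀ z ∈ {z : ℂ | 0 ≤ z.im} ∩ Metric.closedBall 0 R,
        kForm k (x₀ + (s' : ℂ) • x₁ + z • a) ≠ 0 := by
      refine hcomp.eventually_forall_of_forall_eventually
        (P := fun (s' : ℝ) (z : ℂ) => kForm k (x₀ + (s' : ℂ) • x₁ + z • a) ≠ 0) fun z hz => ?_
      have h2 := hs.1 z hz.1
      exact (hcont.tendsto (s, z)).eventually_ne h2
    have h2 : ∀ᶠ s' in 𝓝[>] s, s' < 1 :=
      (eventually_lt_nhds hs.2.2).filter_mono nhdsWithin_le_nhds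
    filter_upwards [h1.filter_mono nhdsWithin_le_nhds, h2, self_mem_nhdsWithin] with s' h3 h4 h5
    change ∀ z : ℂ, 0 ≤ z.im → kForm k (x₀ + (s' : ℂ) • x₁ + z • a) ≠ 0
    intro z hz
    by_cases hzR : ‖z‖ ≤ R
    · exact h3 z ⟨hz, by simpa using hzR⟩
    · exact hR s' ⟨hs.2.1.trans (le_of_lt h5), h4.le⟩ z (not_le.mp hzR)
  have h1 := hclosed.Icc_subset_of_forall_mem_nhdsWithin h0S hopen (right_mem_Icc.mpr zero_le_one)
  intro z hz
  have h2 := h1 z hz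
  rwa [Complex.ofReal_one, one_smul] at h2

theorem isHermitian_real_smul (t : ℝ) {x : Matrix (Fin N) (Fin N) ℂ} (hx : x.IsHermitian) :
    ((t : ℂ) • x).IsHermitian := by
  rw [Matrix.IsHermitian, Matrix.conjTranspose_smul, hx]
  simp

theorem kForm_one_ne_zero : kForm k (1 : Matrix (Fin N) (Fin N) ℂ) ≠ 0 := by
  have h : (fun i : Fin N => if (i : ℕ) < k then (1 : Matrix (Fin N) (Fin N) ℂ) else 1) =
    fun _ => 1 := by simp
  rw [kForm, h, wedgeCoeff_const]
  simp [Nat.factorial_ne_zero]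

/-- `kForm` is hyperbolic with respect to the identity. -/
theorem kForm_hyperbolic (hk : k ≤ N) {x : Matrix (Fin N) (Fin N) ℂ} (hx : x.IsHermitian) {t : ℝ}
    (ht : t ≠ 0) : kForm k (x + (t * Complex.I) • 1) ≠ 0 := by
  set K : Set (Matrix (Fin N) (Fin N) ℂ) := {y | ∃ c : ℝ, 0 < c ∧ y = (c : ℂ) • 1} with hK
  have key : ∀ x : Matrix (Fin N) (Fin N) ℂ, x.IsHermitian → ∀ c : ℝ, 0 < c →
      kForm k (x + (c * Complex.I) • 1) ≠ 0 := by
    intro x hx c hc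
    -- The descent starts from all `N` slots, where the form is `N!` times the determinant and its
    -- eigenvalue factors `d i + i c` are nonzero, and freezes the upper slots at `β`.
    have h := stable_descend (a := fun _ => 1) (K := K) hk le_rfl ?_ ?_ x hx ((c : ℂ) • 1)
      ⟨c, hc, rfl⟩
    · rw [smul_smul, mul_comm] at h
      exact h
    · refine fun i _ _ => ⟨Matrix.isHermitian_one, ⟨1, one_pos, by simp⟩, ?_⟩
      rintro y ⟨c, hc, rfl⟩ s hs
      exact ⟨c + s, by positivity, by rw [Complex.ofReal_add, add_smul]⟩
    · rintro x hx y ⟨c, hc, rfl⟩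
      obtain ⟨U, d, hU, hU', hd⟩ := exists_unitary_diagonal hx
      have h1 : (fun i : Fin N => if (i : ℕ) < N then x + Complex.I • (c : ℂ) • 1 else 1) =
          fun _ => U * Matrix.diagonal (fun i => (d i : ℂ) + Complex.I * c) * star U := by
        funext i
        rw [if_pos i.2, ← Matrix.diagonal_add, mul_add, add_mul, ← hd, smul_smul,
          ← Matrix.smul_one_eq_diagonal, mul_smul_comm, smul_mul_assoc, mul_one, hU]
      rw [h1, wedgeCoeff_unitary_conj _ hU, wedgeCoeff_const, Matrix.det_diagonal]
      refine mul_ne_zero (by exact_mod_cast Nat.factorial_ne_zero N)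
        (Finset.prod_ne_zero_iff.mpr fun i _ h => hc.ne' ?_)
      have := congrArg Complex.im h
      simpa using this
  rcases ht.lt_or_gt with h | h
  · have h1 := key (-x) hx.neg (-t) (by linarith)
    have h2 : x + (t * Complex.I) • (1 : Matrix (Fin N) (Fin N) ℂ) =
        (-1 : ℂ) • (-x + (((-t : ℝ) : ℂ) * Complex.I) • 1) := by
      push_cast
      module
    rw [h2, kForm_smul hk]
    exact mul_ne_zero (pow_ne_zero _ (by norm_num)) h1
  · exact key x hx t h

theorem kForm_add_smul_one_ne_zero (hk : k ≤ N) {x : Matrix (Fin N) (Fin N) ℂ}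
    (hx : x.IsHermitian) {w : ℂ} (hw : w.im ≠ 0) : kForm k (x + w • 1) ≠ 0 := by
  have h := kForm_hyperbolic hk (hx.add (isHermitian_real_smul w.re Matrix.isHermitian_one)) hw
  rwa [add_assoc, ← add_smul, Complex.re_add_im] at h

/-- The hyperbolicity cone of `kForm k`. -/
def hypCone (N k : ℕ) : Set (Matrix (Fin N) (Fin N) ℂ) :=
  {a | a.IsHermitian ∧ ∀ t : ℝ, 0 ≤ t → kForm k (a + (t : ℂ) • 1) ≠ 0}

theorem kForm_add_smul_one_ne_zero_of_hypCone (hk : k ≤ N) {a : Matrix (Fin N) (Fin N) ℂ}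
    (ha : a ∈ hypCone N k) {w : ℂ} (hw : 0 ≤ w.re) : kForm k (a + w • 1) ≠ 0 := by
  by_cases h : w.im = 0
  · rw [show w = (w.re : ℂ) from Complex.ext rfl h]
    exact ha.2 _ hw
  · exact kForm_add_smul_one_ne_zero hk ha.1 h

theorem kForm_ne_zero_of_hypCone {a : Matrix (Fin N) (Fin N) ℂ} (ha : a ∈ hypCone N k) :
    kForm k a ≠ 0 := by
  simpa using ha.2 0 le_rfl

/-- `kForm` is hyperbolic with respect to each element of the hyperbolicity cone. -/
theorem kForm_hyperbolic_of_hypCone (hk : k ≤ N) {a x : Matrix (Fin N) (Fin N) ℂ}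
    (ha : a ∈ hypCone N k) (hx : x.IsHermitian) {z : ℂ} (hz : z.im ≠ 0) :
    kForm k (x + z • a) ≠ 0 := by
  -- The term `iα β` keeps real parameters away from zeros by hyperbolicity with respect to `β`, so
  -- `x` can be switched on along a path. At its start, dividing by `z` leaves `a + (iα / z) β`, and
  -- `Re (iα / z) = α Im z / |z|² ≥ 0`.
  have step : ∀ x : Matrix (Fin N) (Fin N) ℂ, x.IsHermitian → ∀ α : ℝ, 0 < α → ∀ z : ℂ,
      0 ≤ z.im → kForm k ((α * Complex.I) • 1 + x + z • a) ≠ 0 := by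
    intro x hx α hα
    refine kForm_ne_zero_of_path hk (kForm_ne_zero_of_hypCone ha) (fun s _ t => ?_) fun z hz => ?_
    · have := kForm_hyperbolic hk ((isHermitian_real_smul s hx).add (isHermitian_real_smul t ha.1))
        hα.ne'
      rwa [add_comm, ← add_assoc] at this
    · by_cases hz0 : z = 0
      · simpa [hz0] using kForm_hyperbolic hk Matrix.isHermitian_zero hα.ne'
      · have h1 : (α * Complex.I) • (1 : Matrix (Fin N) (Fin N) ℂ) + z • a =
            z • (a + (z⁻¹ * (α * Complex.I)) • 1) := by
          rw [smul_add, smul_smul, mul_inv_cancel_left₀ hz0, add_comm]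
        rw [h1, kForm_smul hk]
        refine mul_ne_zero (pow_ne_zero _ hz0) (kForm_add_smul_one_ne_zero_of_hypCone hk ha ?_)
        have : (z⁻¹ * (α * Complex.I)).re = α * z.im / Complex.normSq z := by
          simp [Complex.inv_im]
          ring
        rw [this]
        exact div_nonneg (mul_nonneg hα.le hz) (Complex.normSq_nonneg z)
  have pos : ∀ x : Matrix (Fin N) (Fin N) ℂ, x.IsHermitian → ∀ z : ℂ, 0 < z.im →
      kForm k (x + z • a) ≠ 0 := by
    intro x hx z hz
    have hcont : Continuous fun α : ℝ => ‖kForm k ((α * Complex.I) • 1 + x + z • a)‖ :=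
      (continuous_kForm.comp (by fun_prop)).norm
    -- The lower bound does not depend on `α`, so it survives `α → 0` and excludes zeros of the
    -- unperturbed form.
    have h1 : ‖kForm k a‖ * z.im ^ k ≤ ‖kForm k ((((0 : ℝ) : ℂ) * Complex.I) • 1 + x + z • a)‖ := by
      refine ge_of_tendsto (x := 𝓝[>] (0 : ℝ)) ((hcont.tendsto 0).mono_left nhdsWithin_le_nhds) ?_
      filter_upwards [self_mem_nhdsWithin] with α hα
      exact norm_kForm_ge hk (kForm_ne_zero_of_hypCone ha) (step x hx α hα) hz.le
    intro h2
    have : 0 < ‖kForm k a‖ * z.im ^ k :=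
      mul_pos (norm_pos_iff.mpr (kForm_ne_zero_of_hypCone ha)) (pow_pos hz _)
    simp only [Complex.ofReal_zero, zero_mul, zero_smul, zero_add, h2, norm_zero] at h1
    linarith
  rcases hz.lt_or_gt with h | h
  · have h1 := pos (-x) hx.neg (-z) (by simpa using h)
    have h2 : x + z • a = (-1 : ℂ) • (-x + (-z) • a) := by module
    rw [h2, kForm_smul hk]
    exact mul_ne_zero (pow_ne_zero _ (by norm_num)) h1
  · exact pos x hx z h

/-- Move from `β` to `a` along a segment while using `-i b` as the direction of the polynomial
variable; the value at `z = i` is `a + b`. At real `t ≠ 0` hyperbolicity with respect to `b`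
excludes zeros. At `t = 0` the points of the segment are positive multiples of `a + t' β` with `t' ≥
0`, or `β` itself. -/
theorem hypCone_add (hk : k ≤ N) {a b : Matrix (Fin N) (Fin N) ℂ} (ha : a ∈ hypCone N k)
    (hb : b ∈ hypCone N k) : a + b ∈ hypCone N k := by
  have key : ∀ a ∈ hypCone N k, kForm k (a + b) ≠ 0 := by
    intro a ha
    have hI : kForm k ((-Complex.I) • b) ≠ 0 := by
      rw [kForm_smul hk]
      exact mul_ne_zero (pow_ne_zero _ (by simp)) (kForm_ne_zero_of_hypCone hb)
    have h := kForm_ne_zero_of_path hk (x₀ := 1) (x₁ := a - 1) (a := (-Complex.I) • b) hI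
      (fun s hs t => ?_) (fun z hz => ?_) Complex.I (by simp)
    · rw [smul_smul] at h
      simpa using h
    · by_cases ht : t = 0
      · subst ht
        rcases hs.1.eq_or_lt with h | h
        · simpa [← h] using kForm_one_ne_zero
        · have h1 : (1 : Matrix (Fin N) (Fin N) ℂ) + (s : ℂ) • (a - 1) +
              ((0 : ℝ) : ℂ) • (-Complex.I) • b = (s : ℂ) • (a + (((1 - s) / s : ℝ) : ℂ) • 1) := by
            have hs0 : (s : ℂ) ≠ 0 := by exact_mod_cast h.ne'
            rw [smul_add (s : ℂ) a, smul_smul (s : ℂ), Complex.ofReal_div,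
              mul_div_cancel₀ _ hs0]
            push_cast
            module
          rw [h1, kForm_smul hk]
          exact mul_ne_zero (pow_ne_zero _ (by exact_mod_cast h.ne'))
            (ha.2 _ (div_nonneg (by linarith [hs.2]) h.le))
      · rw [smul_smul]
        refine kForm_hyperbolic_of_hypCone hk hb ?_ (by simpa using ht)
        exact Matrix.isHermitian_one.add
          (isHermitian_real_smul s (ha.1.sub Matrix.isHermitian_one))
    · rw [smul_smul]
      set w := z * -Complex.I with hw
      have hwre : 0 ≤ w.re := by simpa [hw] using hz
      by_cases hw0 : w = 0
      · simpa [hw0] using kForm_one_ne_zero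
      · have h1 : (1 : Matrix (Fin N) (Fin N) ℂ) + w • b = w • (b + w⁻¹ • 1) := by
          rw [smul_add, smul_smul, mul_inv_cancel₀ hw0, one_smul, add_comm]
        rw [h1, kForm_smul hk]
        refine mul_ne_zero (pow_ne_zero _ hw0) (kForm_add_smul_one_ne_zero_of_hypCone hk hb ?_)
        rw [Complex.inv_re]
        exact div_nonneg hwre (Complex.normSq_nonneg w)
  refine ⟨ha.1.add hb.1, fun t ht => ?_⟩
  have h := key (a + (t : ℂ) • 1) ⟨ha.1.add (isHermitian_real_smul t Matrix.isHermitian_one),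
    fun s hs => by
      rw [add_assoc, ← add_smul, ← Complex.ofReal_add]
      exact ha.2 _ (add_nonneg ht hs)⟩
  rwa [add_right_comm] at h

theorem hypCone_add_smul (hk : k ≤ N) {a b : Matrix (Fin N) (Fin N) ℂ} (ha : a ∈ hypCone N k)
    (hb : b ∈ hypCone N k) {s : ℝ} (hs : 0 ≤ s) : a + (s : ℂ) • b ∈ hypCone N k := by
  rcases hs.eq_or_lt with h | h
  · simpa [← h] using ha
  · refine hypCone_add hk ha ⟨isHermitian_real_smul s hb.1, fun t ht => ?_⟩
    have hs0 : (s : ℂ) ≠ 0 := by exact_mod_cast h.ne'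
    have h1 : (s : ℂ) • b + (t : ℂ) • 1 = (s : ℂ) • (b + ((t / s : ℝ) : ℂ) • 1) := by
      rw [smul_add, smul_smul]
      push_cast
      rw [mul_div_cancel₀ _ hs0]
    rw [h1, kForm_smul hk]
    exact mul_ne_zero (pow_ne_zero _ hs0) (hb.2 _ (div_nonneg ht h.le))

/-- Hyperbolicity with respect to the whole cone is the input for a descent from `k` variable slots
to none, which leaves the mixed product of the `a i`. -/
theorem wedgeCoeff_ne_zero_of_hypCone (hk : k ≤ N) {a : Fin N → Matrix (Fin N) (Fin N) ℂ}
    (ha : ∀ i : Fin N, (i : ℕ) < k → a i ∈ hypCone N k)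
    (ha1 : ∀ i : Fin N, k ≤ (i : ℕ) → a i = 1) : wedgeCoeff a ≠ 0 := by
  have h1 : (1 : Matrix (Fin N) (Fin N) ℂ) ∈ hypCone N k := by
    refine ⟨Matrix.isHermitian_one, fun t ht => ?_⟩
    have : (1 : Matrix (Fin N) (Fin N) ℂ) + (t : ℂ) • 1 = (1 + t : ℂ) • 1 := by module
    rw [this, kForm_smul hk]
    refine mul_ne_zero (pow_ne_zero _ ?_) kForm_one_ne_zero
    exact_mod_cast (by positivity : (1 + t : ℝ) ≠ 0)
  have h := stable_descend (a := a) (K := hypCone N k) (Nat.zero_le k) hk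
    (fun i _ hi => ⟨(ha i hi).1, ha i hi, fun y hy s hs => hypCone_add_smul hk hy (ha i hi) hs⟩) ?_
    0 Matrix.isHermitian_zero 1 h1
  · simpa using h
  · intro x hx y hy
    have h2 := kForm_hyperbolic_of_hypCone hk hy hx (z := Complex.I) (by simp)
    intro h3
    apply h2
    rw [kForm, ← h3]
    congr 1
    funext i
    split_ifs with h4
    · rfl
    · exact (ha1 i (not_lt.mp h4)).symm

/-- Induction on the power `l`. The derivative of `t ↦ (A + tβ)^(l+1) ∧ β^(N-l-1)` is `(l+1) (A +
tβ)^l ∧ β^(N-l)`, positive for `t > 0`, and the value at `t = 0` is nonnegative by the definition of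
`Γ_k`. This is where all powers up to `k` are used. -/
theorem kForm_re_pos_of_gammaCone (hk : k ≤ N) {A : Matrix (Fin N) (Fin N) ℂ}
    (hA : A ∈ GammaCone N k) {t : ℝ} (ht : 0 < t) : 0 < (kForm k (A + (t : ℂ) • 1)).re := by
  suffices H : ∀ l ≤ k, ∀ t : ℝ, 0 < t → 0 < (kForm l (A + (t : ℂ) • 1)).re from H k le_rfl t ht
  intro l
  induction l with
  | zero =>
    intro _ t _
    have h : (kForm 0 (A + (t : ℂ) • 1)) = N.factorial := by
      simp only [kForm, not_lt_zero, if_false]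
      rw [wedgeCoeff_const]
      simp
    rw [h]
    simp [Nat.factorial_pos]
  | succ l ih =>
    intro hl t ht
    have ihl := ih (by omega)
    set p := slotPoly (l + 1) (fun _ => 1) A 1 with hp
    have he : ∀ s : ℝ, kForm (l + 1) (A + (s : ℂ) • 1) = p.eval (s : ℂ) := fun s => by
      rw [hp, eval_slotPoly, kForm]
    have hd : ∀ s : ℝ, HasDerivAt (fun s : ℝ => (kForm (l + 1) (A + (s : ℂ) • 1)).re)
        ((l + 1) * (kForm l (A + (s : ℂ) • 1)).re) s := by
      intro s
      have h1 := (p.hasDerivAt (s : ℂ)).real_of_complex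
      have h2 : (eval (s : ℂ) (derivative p)).re = (l + 1) * (kForm l (A + (s : ℂ) • 1)).re := by
        rw [hp, eval_derivative_slotPoly (by omega)]
        have : (((l : ℂ) + 1)) = ((l + 1 : ℝ) : ℂ) := by push_cast; rfl
        rw [this, Complex.re_ofReal_mul, kForm]
        congr 3
        funext i
        split_ifs <;> rfl
      rw [h2] at h1
      simpa only [he] using h1
    have hmono : StrictMonoOn (fun s : ℝ => (kForm (l + 1) (A + (s : ℂ) • 1)).re) (Ici 0) := by
      refine strictMonoOn_of_deriv_pos (convex_Ici 0)
        (fun s _ => (hd s).continuousAt.continuousWithinAt) fun s hs => ?_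
      rw [(hd s).deriv]
      rw [interior_Ici] at hs
      exact mul_pos (by positivity) (ihl s hs)
    have h3 := hmono self_mem_Ici ht.le ht
    refine lt_of_le_of_lt ?_ h3
    have := hA.2 (l + 1) (by omega) hl
    simpa [kForm] using this

/-- Elements of `Γ_k` may lie on the boundary of the hyperbolicity cone; a positive multiple of `β`
pushes them inside. The factor `θ ≥ 0` covers the whole deformation to `β`. -/
theorem smul_add_mem_hypCone (hk : k ≤ N) {A : Matrix (Fin N) (Fin N) ℂ}
    (hA : A ∈ GammaCone N k) {θ c : ℝ} (hθ : 0 ≤ θ) (hc : 0 < c) :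
    (θ : ℂ) • A + (c : ℂ) • 1 ∈ hypCone N k := by
  refine ⟨(isHermitian_real_smul θ hA.1).add (isHermitian_real_smul c Matrix.isHermitian_one),
    fun t ht => ?_⟩
  rw [add_assoc, ← add_smul, ← Complex.ofReal_add]
  have hct : 0 < c + t := by linarith
  rcases hθ.eq_or_lt with h | h
  · rw [← h, Complex.ofReal_zero, zero_smul, zero_add, kForm_smul hk]
    exact mul_ne_zero (pow_ne_zero _ (by exact_mod_cast hct.ne')) kForm_one_ne_zero
  · have hs0 : (θ : ℂ) ≠ 0 := by exact_mod_cast h.ne'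
    have h1 : (θ : ℂ) • A + ((c + t : ℝ) : ℂ) • 1 =
        (θ : ℂ) • (A + (((c + t) / θ : ℝ) : ℂ) • 1) := by
      rw [smul_add, smul_smul, Complex.ofReal_div, mul_div_cancel₀ _ hs0]
    rw [h1, kForm_smul hk]
    refine mul_ne_zero (pow_ne_zero _ hs0) fun h2 => ?_
    have := kForm_re_pos_of_gammaCone hk hA (div_pos hct h)
    rw [h2] at this
    exact lt_irrefl _ this

/-- **Gårding's inequality**: `α_1 ∧ ⋯ ∧ α_k ∧ β^(N-k) ≥ 0` for `α_1, …, α_k ∈ Γ_k`. -/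
theorem garding_inequality (hk : k ≤ N) {a : Fin N → Matrix (Fin N) (Fin N) ℂ}
    (ha : ∀ i : Fin N, (i : ℕ) < k → a i ∈ GammaCone N k)
    (ha1 : ∀ i : Fin N, k ≤ (i : ℕ) → a i = 1) : 0 ≤ (wedgeCoeff a).re := by
  -- The active slots run from `β` at `θ = 0` to `a i + ε β` at `θ = 1` inside the cone. The mixed
  -- product is real and never zero on the way, so it keeps the positive sign it has at `θ = 0`;
  -- finally `ε → 0`.
  set B : ℝ → ℝ → Fin N → Matrix (Fin N) (Fin N) ℂ := fun ε θ i =>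
    if (i : ℕ) < k then (θ : ℂ) • a i + ((θ * ε + (1 - θ) : ℝ) : ℂ) • 1 else 1 with hB
  have hBcont : Continuous fun p : ℝ × ℝ => (wedgeCoeff (B p.1 p.2)).re := by
    refine Complex.continuous_re.comp (continuous_wedgeCoeff.comp (continuous_pi fun i => ?_))
    simp only [hB]
    split_ifs <;> fun_prop
  have hne : ∀ ε > 0, ∀ θ ∈ Icc (0 : ℝ) 1, (wedgeCoeff (B ε θ)).re ≠ 0 := by
    intro ε hε θ hθ
    have hmem : ∀ i : Fin N, (i : ℕ) < k → B ε θ i ∈ hypCone N k := by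
      intro i hi
      simp only [hB, if_pos hi]
      refine smul_add_mem_hypCone hk (ha i hi) hθ.1 ?_
      rcases hθ.1.eq_or_lt with h | h
      · simp [← h]
      · have := mul_pos h hε
        linarith [hθ.2]
    have hone : ∀ i : Fin N, k ≤ (i : ℕ) → B ε θ i = 1 := fun i hi => by
      simp only [hB, if_neg (not_lt.mpr hi)]
    have h1 := wedgeCoeff_ne_zero_of_hypCone hk hmem hone
    have h2 : (wedgeCoeff (B ε θ)).im = 0 := wedgeCoeff_im_eq_zero fun i => by
      by_cases hi : (i : ℕ) < k
      · exact (hmem i hi).1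
      · rw [hone i (not_lt.mp hi)]
        exact Matrix.isHermitian_one
    exact fun h3 => h1 (Complex.ext h3 h2)
  have hpos : ∀ ε > 0, 0 < (wedgeCoeff (B ε 1)).re := by
    intro ε hε
    have h0 : 0 < (wedgeCoeff (B ε 0)).re := by
      have : B ε 0 = fun _ => 1 := by
        funext i
        simp [hB]
      rw [this, wedgeCoeff_const]
      simp [Nat.factorial_pos]
    by_contra! h1
    have hc : ContinuousOn (fun θ => (wedgeCoeff (B ε θ)).re) (Icc 0 1) :=
      (hBcont.comp (Continuous.prodMk continuous_const continuous_id)).continuousOn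
    obtain ⟨θ, hθ, h2⟩ := intermediate_value_Icc' zero_le_one hc ⟨h1, h0.le⟩
    exact hne ε hε θ hθ h2
  have hlim : Tendsto (fun ε : ℝ => (wedgeCoeff (B ε 1)).re) (𝓝[>] 0)
      (𝓝 (wedgeCoeff (B 0 1)).re) :=
    ((hBcont.comp (Continuous.prodMk continuous_id continuous_const)).tendsto 0).mono_left
      nhdsWithin_le_nhds
  have h0 : B 0 1 = a := by
    funext i
    simp only [hB]
    split_ifs with h
    · simp
    · exact (ha1 i (not_lt.mp h)).symm
  rw [h0] at hlim
  refine ge_of_tendsto hlim ?_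
  filter_upwards [self_mem_nhdsWithin] with ε hε
  exact (hpos ε hε).le

end Garding

/-! ### Second derivatives and the complex Hessian -/

section Hessian

open Filter Topology

variable {N : ℕ}

/-- Real bilinear forms on `CSpace N`. -/
abbrev BilForm (N : ℕ) : Type := CSpace N →L[ℝ] CSpace N →L[ℝ] ℝ

/-- The sesquilinear part of a real bilinear form, up to a factor. -/
noncomputable def sesqPart (B : BilForm N) (v w : CSpace N) : ℂ :=
  ((B v w + B (Complex.I • v) (Complex.I • w) : ℝ) : ℂ) +
    Complex.I * ((B v (Complex.I • w) - B (Complex.I • v) w : ℝ) : ℂ)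

/-- The Levi form `B(v,v) + B(iv,iv)` of a real bilinear form. -/
noncomputable def leviForm (B : BilForm N) (v : CSpace N) : ℝ :=
  B v v + B (Complex.I • v) (Complex.I • v)

theorem complex_smul_eq {V : Type*} [AddCommGroup V] [Module ℂ V] (c : ℂ) (v : V) :
    c • v = (c.re : ℝ) • v + (c.im : ℝ) • (Complex.I • v) := by
  conv_lhs => rw [← Complex.re_add_im c, add_smul, mul_smul]
  rfl

theorem I_smul_I_smul {V : Type*} [AddCommGroup V] [Module ℂ V] (v : V) :
    Complex.I • (Complex.I • v) = -v := by
  rw [smul_smul, Complex.I_mul_I, neg_one_smul]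

theorem sesqPart_smul_left (B : BilForm N) (c : ℂ) (v w : CSpace N) :
    sesqPart B (c • v) w = c * sesqPart B v w := by
  unfold sesqPart
  rw [complex_smul_eq c v, smul_add, smul_comm Complex.I, smul_comm Complex.I c.im, I_smul_I_smul]
  simp only [map_add, map_smul, add_apply, smul_apply,
    smul_neg, map_neg, neg_apply, smul_eq_mul]
  apply Complex.ext <;> simp <;> ring

theorem sesqPart_smul_right (B : BilForm N) (c : ℂ) (v w : CSpace N) :
    sesqPart B v (c • w) = conj c * sesqPart B v w := by
  unfold sesqPart
  rw [complex_smul_eq c w, smul_add, smul_comm Complex.I, smul_comm Complex.I c.im, I_smul_I_smul]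
  simp only [map_add, map_smul, smul_neg, map_neg, smul_eq_mul]
  apply Complex.ext <;> simp <;> ring

/-- `sesqPart` as a sesquilinear map. -/
noncomputable def sesqMap (B : BilForm N) : CSpace N →ₗ[ℂ] CSpace N →ₛₗ[starRingEnd ℂ] ℂ :=
  LinearMap.mk₂'ₛₗ (RingHom.id ℂ) (starRingEnd ℂ) (sesqPart B)
    (fun v v' w => by
      simp only [sesqPart, smul_add, map_add, add_apply]
      push_cast
      ring)
    (fun c v w => by rw [sesqPart_smul_left]; rfl)
    (fun v w w' => by
      simp only [sesqPart, smul_add, map_add]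
      push_cast
      ring)
    (fun c v w => by rw [sesqPart_smul_right]; rfl)

theorem sum_single_smul (v : CSpace N) :
    v = ∑ j, v j • (EuclideanSpace.single j 1 : CSpace N) := by
  have := (EuclideanSpace.basisFun (Fin N) ℂ).sum_repr v
  simpa using this.symm

theorem sesqPart_eq_sum (B : BilForm N) (v w : CSpace N) :
    sesqPart B v w = ∑ j, ∑ k, v j * conj (w k) *
      sesqPart B (EuclideanSpace.single j 1) (EuclideanSpace.single k 1) := by
  change sesqMap B v w = _
  conv_lhs => rw [sum_single_smul v, sum_single_smul w]
  have h : ∀ (a b : ℂ) (x y : CSpace N),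
      sesqMap B (a • x) (b • y) = a * conj b * sesqPart B x y := by
    intro a b x y
    change sesqPart B (a • x) (b • y) = _
    rw [sesqPart_smul_left, sesqPart_smul_right, mul_assoc]
  rw [map_sum, Finset.sum_comm]
  refine Finset.sum_congr rfl fun j _ => ?_
  rw [map_sum, LinearMap.sum_apply]
  exact Finset.sum_congr rfl fun k _ => h _ _ _ _

/-- The complex Hessian matrix of a function with second derivative `B`. -/
noncomputable def hessOf (N : ℕ) (B : BilForm N) : Matrix (Fin N) (Fin N) ℂ :=
  Matrix.of fun j k => sesqPart B (EuclideanSpace.single j 1) (EuclideanSpace.single k 1) / 4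

theorem hessOf_isHermitian {B : BilForm N} (hB : ∀ v w, B v w = B w v) :
    (hessOf N B).IsHermitian := by
  ext j k
  simp only [Matrix.conjTranspose_apply, hessOf, Matrix.of_apply,
    sesqPart, Complex.star_def]
  rw [hB (EuclideanSpace.single k 1) (EuclideanSpace.single j 1),
    hB (EuclideanSpace.single k 1) (Complex.I • EuclideanSpace.single j 1),
    hB (Complex.I • EuclideanSpace.single k 1) (EuclideanSpace.single j 1),
    hB (Complex.I • EuclideanSpace.single k 1) (Complex.I • EuclideanSpace.single j 1)]
  simp only [map_div₀, map_add, map_mul, Complex.conj_ofReal, Complex.conj_I, map_ofNat]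
  push_cast
  ring

theorem sesqPart_self {B : BilForm N} (hB : ∀ v w, B v w = B w v) (v : CSpace N) :
    sesqPart B v v = leviForm B v := by
  rw [sesqPart, hB v (Complex.I • v)]
  simp [leviForm]

theorem dotProduct_hessOf_mulVec (B : BilForm N) (v : CSpace N) :
    4 * (dotProduct (v : Fin N → ℂ) (hessOf N B |>.mulVec fun k => conj (v k))) =
      sesqPart B v v := by
  rw [sesqPart_eq_sum]
  simp only [dotProduct, Matrix.mulVec, hessOf, Matrix.of_apply,
    Finset.mul_sum]
  refine Finset.sum_congr rfl fun j _ => Finset.sum_congr rfl fun k _ => ?_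
  ring

section

open scoped ComplexOrder

/-- On the diagonal the sesquilinear part is real and equals the Levi form. Matrix and vector
conventions differ by a conjugation, harmless since all vectors are tested. -/
theorem hessOf_posSemidef_iff {B : BilForm N} (hB : ∀ v w, B v w = B w v) :
    (hessOf N B).PosSemidef ↔ ∀ v, 0 ≤ leviForm B v := by
  rw [Matrix.posSemidef_iff_dotProduct_mulVec]
  have key : ∀ x : Fin N → ℂ, 4 * (dotProduct (star x) ((hessOf N B).mulVec x)) =
      leviForm B (WithLp.toLp 2 (star x)) := by
    intro x
    rw [← sesqPart_self hB, ← dotProduct_hessOf_mulVec]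
    simp only [Pi.star_apply, Complex.star_def, Complex.conj_conj]
  constructor
  · rintro ⟨_, h⟩ v
    have h1 := h (star (v : Fin N → ℂ))
    have h2 := key (star (v : Fin N → ℂ))
    rw [star_star] at h2
    have h3 : (0 : ℂ) ≤ 4 * (dotProduct (star (star (v : Fin N → ℂ)))
        ((hessOf N B).mulVec (star (v : Fin N → ℂ)))) := mul_nonneg (by norm_num) h1
    rw [star_star] at h3
    rw [h2] at h3
    exact_mod_cast h3
  · refine fun h => ⟨hessOf_isHermitian hB, fun x => ?_⟩
    have h1 := key x
    have h2 : dotProduct (star x) ((hessOf N B).mulVec x) =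
        ((leviForm B (WithLp.toLp 2 (star x)) / 4 : ℝ) : ℂ) := by
      push_cast
      rw [← h1]
      ring
    rw [h2]
    exact_mod_cast div_nonneg (h _) (by norm_num)

end

theorem sesqPart_eq_zero_of_hessOf_eq_zero {B : BilForm N} (h : hessOf N B = 0)
    (v w : CSpace N) : sesqPart B v w = 0 := by
  rw [sesqPart_eq_sum]
  refine Finset.sum_eq_zero fun j _ => Finset.sum_eq_zero fun k _ => ?_
  have := congrFun (congrFun h j) k
  simp only [hessOf, Matrix.of_apply, Matrix.zero_apply,
    div_eq_zero_iff, OfNat.ofNat_ne_zero, or_false] at this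
  rw [this, mul_zero]

/-- The second derivative of a real function. -/
noncomputable def sndDeriv (u : CSpace N → ℝ) (z : CSpace N) : BilForm N := fderiv ℝ (fderiv ℝ u) z

theorem sndDeriv_symm {u : CSpace N → ℝ} {z : CSpace N} (hu : ContDiffAt ℝ 2 u z)
    (v w : CSpace N) : sndDeriv u z v w = sndDeriv u z w v :=
  (hu.isSymmSndFDerivAt (by simp)) v w

theorem differentiableAt_fderiv {F : Type*} [NormedAddCommGroup F] [NormedSpace ℝ F]
    {u : CSpace N → F} {z : CSpace N} (hu : ContDiffAt ℝ 2 u z) :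
    DifferentiableAt ℝ (fderiv ℝ u) z :=
  (hu.fderiv_right (m := 1) le_rfl).differentiableAt one_ne_zero

theorem fderiv_fderiv_apply {u : CSpace N → ℝ} {z : CSpace N} (hu : ContDiffAt ℝ 2 u z)
    (v w : CSpace N) : fderiv ℝ (fun x => fderiv ℝ u x v) z w = sndDeriv u z w v := by
  have := ((differentiableAt_fderiv hu).hasFDerivAt).clm_apply (hasFDerivAt_const v z)
  rw [this.fderiv]
  simp [sndDeriv]

theorem two_le_infty : (2 : WithTop ℕ∞) ≤ ∞ :=
  WithTop.coe_le_coe.mpr le_top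

theorem single_I (j : Fin N) : (EuclideanSpace.single j Complex.I : CSpace N) =
    Complex.I • EuclideanSpace.single j 1 := by
  ext i
  by_cases h : i = j
  · subst h; simp
  · simp [h]

/-- Expanding the two Wirtinger derivatives gives four real second derivatives and the factor `1/4`.
From here on only the real second derivative is needed. -/
theorem complexHessian_eq {u : CSpace N → ℝ} {z : CSpace N} (hu : ContDiffAt ℝ 2 u z) :
    complexHessian u z = hessOf N (sndDeriv u z) := by
  have hev : ∀ᶠ w in 𝓝 z, DifferentiableAt ℝ u w :=
    (hu.eventually (by simp)).mono fun w hw => hw.differentiableAt two_ne_zero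
  have hd : ∀ w, DifferentiableAt ℝ u w → ∀ v, fderiv ℝ (fun x => (u x : ℂ)) w v =
      (fderiv ℝ u w v : ℂ) := by
    intro w hw v
    have := (Complex.ofRealCLM.hasFDerivAt (x := u w)).comp w hw.hasFDerivAt
    rw [show (fun x => (u x : ℂ)) = Complex.ofRealCLM ∘ u from rfl, this.fderiv]
    rfl
  ext j k
  set a : CSpace N := EuclideanSpace.single k 1 with ha
  set b : CSpace N := Complex.I • EuclideanSpace.single k 1 with hb
  have hbar : wirtingerBar k (fun w => (u w : ℂ)) =ᶠ[𝓝 z]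
      fun w => ((fderiv ℝ u w a : ℂ) + Complex.I * (fderiv ℝ u w b : ℂ)) / 2 := by
    filter_upwards [hev] with w hw
    rw [wirtingerBar, hd w hw, hd w hw, single_I]
  have hD : ∀ c : CSpace N, HasFDerivAt (fun w => (fderiv ℝ u w c : ℂ))
      (Complex.ofRealCLM.comp ((sndDeriv u z).flip c)) z := by
    intro c
    have h1 : HasFDerivAt (fun w => fderiv ℝ u w c) ((sndDeriv u z).flip c) z := by
      have := ((differentiableAt_fderiv hu).hasFDerivAt).clm_apply (hasFDerivAt_const c z)
      rwa [ContinuousLinearMap.comp_zero, zero_add] at this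
    exact (Complex.ofRealCLM.hasFDerivAt).comp z h1
  have hF : HasFDerivAt (fun w => ((fderiv ℝ u w a : ℂ) + Complex.I * (fderiv ℝ u w b : ℂ)) / 2)
      ((2 : ℂ)⁻¹ • (Complex.ofRealCLM.comp ((sndDeriv u z).flip a) +
        Complex.I • Complex.ofRealCLM.comp ((sndDeriv u z).flip b))) z := by
    have := ((hD a).add ((hD b).const_mul Complex.I)).const_mul ((2 : ℂ)⁻¹)
    refine this.congr_of_eventuallyEq (Eventually.of_forall fun w => ?_)
    exact div_eq_inv_mul _ _
  simp only [complexHessian, Matrix.of_apply, wirtinger, hbar.fderiv_eq, hF.fderiv, single_I,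
    hessOf, sesqPart, smul_apply,
    add_apply, ContinuousLinearMap.comp_apply, ContinuousLinearMap.flip_apply,
    Complex.ofRealCLM_apply, smul_eq_mul, ← ha]
  push_cast
  linear_combination -(1 / 4 : ℂ) * ((sndDeriv u z (Complex.I • EuclideanSpace.single j 1) b : ℝ) : ℂ) * Complex.I_mul_I

/-- Wedge products are linear in the first slot. -/
theorem exists_wedgeCoeff_eq_sum (hN : 0 < N) (α : ℕ → Matrix (Fin N) (Fin N) ℂ) (k : ℕ) :
    ∃ c : Fin N → Fin N → ℂ, ∀ H : Matrix (Fin N) (Fin N) ℂ,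
      (wedgeCoeff fun i : Fin N => if (i : ℕ) = 0 then H else if (i : ℕ) < k then α i else 1) =
        ∑ j, ∑ l, H j l * c j l := by
  set m : Fin N → Matrix (Fin N) (Fin N) ℂ := fun i => if (i : ℕ) < k then α i else 1 with hm
  set L := (wedgeML N).toLinearMap m ⟨0, hN⟩ with hL
  have h : ∀ H, (wedgeCoeff fun i : Fin N =>
      if (i : ℕ) = 0 then H else if (i : ℕ) < k then α i else 1) = L H := by
    intro H
    rw [hL, MultilinearMap.toLinearMap_apply, wedgeML_apply]
    congr 1
    funext i
    by_cases h : (i : ℕ) = 0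
    · have : i = ⟨0, hN⟩ := Fin.ext h
      subst this
      simp
    · have : i ≠ ⟨0, hN⟩ := fun h' => h (congrArg Fin.val h')
      rw [Function.update_of_ne this, if_neg h]
  refine ⟨fun j l => L (Matrix.single j l 1), fun H => ?_⟩
  rw [h]
  conv_lhs => rw [Matrix.matrix_eq_sum_single H]
  rw [map_sum]
  refine Finset.sum_congr rfl fun j _ => ?_
  rw [map_sum]
  refine Finset.sum_congr rfl fun l _ => ?_
  rw [← smul_eq_mul, ← map_smul, Matrix.smul_single, smul_eq_mul, mul_one]

/-- `Re (dd^c u ∧ α_1 ∧ ⋯)` as a linear combination of second derivatives. -/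
theorem exists_wedgeCoeff_hessOf_eq_sum (hN : 0 < N) (α : ℕ → Matrix (Fin N) (Fin N) ℂ)
    (k : ℕ) : ∃ (ι : Type) (_ : Fintype ι) (c : ι → ℝ) (v w : ι → CSpace N), ∀ B : BilForm N,
      (wedgeCoeff fun i : Fin N =>
        if (i : ℕ) = 0 then hessOf N B else if (i : ℕ) < k then α i else 1).re =
        ∑ i, c i * B (v i) (w i) := by
  obtain ⟨c, hc⟩ := exists_wedgeCoeff_eq_sum hN α k
  set e : Fin N → CSpace N := fun j => EuclideanSpace.single j 1 with he
  refine ⟨Fin N × Fin N × Fin 4, inferInstance,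
    fun p => ![(c p.1 p.2.1).re / 4, (c p.1 p.2.1).re / 4, -(c p.1 p.2.1).im / 4,
      (c p.1 p.2.1).im / 4] p.2.2,
    fun p => ![e p.1, Complex.I • e p.1, e p.1, Complex.I • e p.1] p.2.2,
    fun p => ![e p.2.1, Complex.I • e p.2.1, Complex.I • e p.2.1, e p.2.1] p.2.2, fun B => ?_⟩
  rw [hc, Fintype.sum_prod_type, Complex.re_sum]
  refine Finset.sum_congr rfl fun j _ => ?_
  rw [Fintype.sum_prod_type, Complex.re_sum]
  refine Finset.sum_congr rfl fun l _ => ?_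
  rw [Fin.sum_univ_four]
  simp only [hessOf, Matrix.of_apply, sesqPart, Matrix.cons_val]
  have h4 : ∀ x : ℂ, x / 4 = ((1 / 4 : ℝ) : ℂ) * x := fun x => by push_cast; ring
  rw [h4, mul_assoc, Complex.re_ofReal_mul]
  simp only [Complex.mul_re, Complex.add_re, Complex.add_im, Complex.ofReal_re, Complex.ofReal_im,
    Complex.mul_im, Complex.I_re, Complex.I_im]
  ring

/-! ### Integration by parts against test functions -/

theorem continuous_mul_of_tsupport_subset {Ω : Set (CSpace N)} (hΩ : IsOpen Ω)
    {f g : CSpace N → ℝ} (hf : ContinuousOn f Ω) (hg : Continuous g) (hs : tsupport g ⊆ Ω) :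
    Continuous fun x => f x * g x := by
  refine continuous_of_tsupport fun x hx => ?_
  have hx' : x ∈ tsupport g := closure_mono (Function.support_mul_subset_right f g) hx
  exact (hf.continuousAt (hΩ.mem_nhds (hs hx'))).mul hg.continuousAt

theorem integrable_mul_of_tsupport_subset {Ω : Set (CSpace N)} (hΩ : IsOpen Ω)
    {f g : CSpace N → ℝ} (hf : ContinuousOn f Ω) (hg : Continuous g) (hs : tsupport g ⊆ Ω)
    (hc : HasCompactSupport g) : Integrable fun x => f x * g x :=
  (continuous_mul_of_tsupport_subset hΩ hf hg hs).integrable_of_hasCompactSupport hc.mul_left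

/-- Integration by parts, twice. -/
theorem integral_mul_sndDeriv {Ω : Set (CSpace N)} (hΩ : IsOpen Ω) {u χ : CSpace N → ℝ}
    (hu : ContDiffOn ℝ ∞ u Ω) (hχ : ContDiff ℝ ∞ χ) (hc : HasCompactSupport χ)
    (hs : tsupport χ ⊆ Ω) (v w : CSpace N) :
    ∫ z, u z * sndDeriv χ z v w = ∫ z, sndDeriv u z v w * χ z := by
  have hdu : ContDiffOn ℝ ∞ (fderiv ℝ u) Ω := hu.fderiv_of_isOpen hΩ (by simp)
  have hdv : ∀ v, ContDiffOn ℝ ∞ (fun z => fderiv ℝ u z v) Ω := fun v =>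
    hdu.clm_apply contDiffOn_const
  have hddu : ContDiffOn ℝ ∞ (fderiv ℝ (fun z => fderiv ℝ u z v)) Ω :=
    (hdv v).fderiv_of_isOpen hΩ (by simp)
  have hdχ : ContDiff ℝ ∞ (fun z => fderiv ℝ χ z w) :=
    (hχ.fderiv_right (m := ∞) (by simp)).clm_apply contDiff_const
  have hsupp : tsupport (fun z => fderiv ℝ χ z w) ⊆ tsupport χ :=
    tsupport_fderiv_apply_subset ℝ w
  have hcχ : ∀ w, HasCompactSupport (fun z => fderiv ℝ χ z w) := fun w => hc.fderiv_apply ℝ w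
  have hat : ∀ z ∈ Ω, ContDiffAt ℝ ∞ u z := fun z hz => hu.contDiffAt (hΩ.mem_nhds hz)
  -- The derivative along `v` is moved first, then the one along `w`. The order is reversed on `u`,
  -- which symmetry of its second derivative repairs.
  have h1 : ∫ z, u z * sndDeriv χ z v w = - ∫ z, fderiv ℝ u z v * fderiv ℝ χ z w := by
    rw [← integral_mul_fderiv_eq_neg_fderiv_mul_of_integrable]
    · refine integral_congr_ae (Eventually.of_forall fun z => ?_)
      simp only [fderiv_fderiv_apply (hχ.contDiffAt.of_le two_le_infty)]
    · exact integrable_mul_of_tsupport_subset hΩ (hdv v).continuousOn hdχ.continuous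
        (hsupp.trans hs) (hcχ w)
    · refine integrable_mul_of_tsupport_subset hΩ hu.continuousOn
        ((hdχ.continuous_fderiv (by simp)).clm_apply continuous_const)
        ((tsupport_fderiv_apply_subset ℝ v).trans (hsupp.trans hs)) ((hcχ w).fderiv_apply ℝ v)
    · exact integrable_mul_of_tsupport_subset hΩ hu.continuousOn hdχ.continuous
        (hsupp.trans hs) (hcχ w)
    · exact fun z hz => (hat z (hs (hsupp hz))).differentiableAt (by simp)
    · exact fun z _ => hdχ.differentiable (by simp) z
  have h2 : ∫ z, fderiv ℝ u z v * fderiv ℝ χ z w =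
      - ∫ z, fderiv ℝ (fun x => fderiv ℝ u x v) z w * χ z := by
    rw [← integral_mul_fderiv_eq_neg_fderiv_mul_of_integrable]
    · exact integrable_mul_of_tsupport_subset hΩ
        (hddu.continuousOn.clm_apply continuousOn_const) hχ.continuous hs hc
    · exact integrable_mul_of_tsupport_subset hΩ (hdv v).continuousOn hdχ.continuous
        (hsupp.trans hs) (hcχ w)
    · exact integrable_mul_of_tsupport_subset hΩ (hdv v).continuousOn hχ.continuous hs hc
    · exact fun z hz => ((hdv v).contDiffAt (hΩ.mem_nhds (hs hz))).differentiableAt (by simp)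
    · exact fun z _ => hχ.differentiable (by simp) z
  rw [h1, h2, neg_neg]
  refine integral_congr_ae (Eventually.of_forall fun z => ?_)
  by_cases hz : z ∈ tsupport χ
  · have h3 : ContDiffAt ℝ 2 u z := (hat z (hs hz)).of_le two_le_infty
    simp only [fderiv_fderiv_apply h3, sndDeriv_symm h3 w v]
  · simp only [image_eq_zero_of_notMem_tsupport hz, mul_zero]

theorem integral_mul_sum_sndDeriv {Ω : Set (CSpace N)} (hΩ : IsOpen Ω) {u χ : CSpace N → ℝ}
    (hu : ContDiffOn ℝ ∞ u Ω) (hχ : ContDiff ℝ ∞ χ) (hc : HasCompactSupport χ)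
    (hs : tsupport χ ⊆ Ω) {ι : Type} [Fintype ι] (c : ι → ℝ) (v w : ι → CSpace N) :
    ∫ z, u z * ∑ i, c i * sndDeriv χ z (v i) (w i) =
      ∫ z, (∑ i, c i * sndDeriv u z (v i) (w i)) * χ z := by
  have hχ2 : ∀ v w, Continuous fun z => sndDeriv χ z v w := fun v w =>
    ((((hχ.fderiv_right (m := ∞) (by simp)).continuous_fderiv (by simp)).clm_apply
      continuous_const).clm_apply continuous_const)
  have hts : ∀ v w, (tsupport fun z => sndDeriv χ z v w) ⊆ tsupport χ := fun v w => by
    have h1 : (fun z => sndDeriv χ z v w) = fun z => fderiv ℝ (fun x => fderiv ℝ χ x w) z v := by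
      funext z
      exact (fderiv_fderiv_apply (hχ.contDiffAt.of_le two_le_infty) w v).symm
    rw [h1]
    exact (tsupport_fderiv_apply_subset ℝ v).trans (tsupport_fderiv_apply_subset ℝ w)
  have hu2 : ∀ v w, ContinuousOn (fun z => sndDeriv u z v w) Ω := fun v w =>
    ((((hu.fderiv_of_isOpen hΩ (m := ∞) (by simp)).fderiv_of_isOpen hΩ (m := ∞)
      (by simp)).continuousOn.clm_apply continuousOn_const).clm_apply continuousOn_const)
  simp only [Finset.mul_sum, Finset.sum_mul]
  rw [integral_finsetSum, integral_finsetSum]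
  · refine Finset.sum_congr rfl fun i _ => ?_
    simp only [mul_left_comm _ (c i), mul_assoc (c i)]
    rw [integral_const_mul, integral_const_mul, integral_mul_sndDeriv hΩ hu hχ hc hs]
  · intro i _
    simp only [mul_assoc (c i)]
    exact (integrable_mul_of_tsupport_subset hΩ (hu2 _ _) hχ.continuous hs hc).const_mul _
  · intro i _
    simp only [mul_left_comm _ (c i)]
    exact (integrable_mul_of_tsupport_subset hΩ hu.continuousOn (hχ2 _ _) ((hts _ _).trans hs)
      (hc.of_isClosed_subset (isClosed_tsupport _) (hts _ _))).const_mul _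

end Hessian

/-! ### Mean value inequalities -/

section MeanValue

open Filter Topology Real

variable {N : ℕ}

/-- Differentiation under an interval integral with continuous integrands. -/
theorem hasDerivAt_intervalIntegral_of_continuousOn {F F' : ℝ → ℝ → ℝ} {U : Set ℝ} (hU : IsOpen U)
    (a b : ℝ) (hF : ContinuousOn (Function.uncurry F) (U ×ˢ univ))
    (hF' : ContinuousOn (Function.uncurry F') (U ×ˢ univ))
    (hd : ∀ r ∈ U, ∀ θ, HasDerivAt (fun r => F r θ) (F' r θ) r) {r : ℝ} (hr : r ∈ U) :
    HasDerivAt (fun r => ∫ θ in a..b, F r θ) (∫ θ in a..b, F' r θ) r := by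
  have hcont : ∀ {G : ℝ → ℝ → ℝ}, ContinuousOn (Function.uncurry G) (U ×ˢ univ) → ∀ s ∈ U,
      Continuous (G s) := fun hG s hs => by
    rw [← continuousOn_univ]
    exact hG.comp (Continuous.prodMk continuous_const continuous_id).continuousOn
      fun θ _ => ⟨hs, mem_univ _⟩
  obtain ⟨δ, hδ, hball⟩ := Metric.isOpen_iff.mp hU r hr
  have hsub : Metric.closedBall r (δ / 2) ⊆ U :=
    (Metric.closedBall_subset_ball (by linarith)).trans hball
  obtain ⟨C, hC⟩ := ((isCompact_closedBall r (δ / 2)).prod (isCompact_uIcc (a := a) (b := b))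
    ).exists_bound_of_continuousOn (hF'.mono (prod_mono hsub (subset_univ _)))
  refine (intervalIntegral.hasDerivAt_integral_of_dominated_loc_of_deriv_le
    (F' := F') (bound := fun _ => C) (Metric.ball_mem_nhds r (half_pos hδ)) ?_ ?_ ?_ ?_ ?_ ?_).2
  · filter_upwards [hU.mem_nhds hr] with s hs
    exact (hcont hF s hs).aestronglyMeasurable
  · exact (hcont hF r hr).intervalIntegrable _ _
  · exact (hcont hF' r hr).aestronglyMeasurable
  · exact Eventually.of_forall fun θ hθ s hs =>
      hC (s, θ) ⟨Metric.ball_subset_closedBall hs, uIoc_subset_uIcc hθ⟩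
  · exact intervalIntegrable_const
  · exact Eventually.of_forall fun θ _ s hs => hd s (hsub (Metric.ball_subset_closedBall hs)) θ

/-- The mean value inequality on circles for functions with nonnegative Levi form. -/
theorem circle_submean_of_leviForm_nonneg {Ω : Set (CSpace N)} (hΩ : IsOpen Ω)
    {u : CSpace N → ℝ} (hu : ContDiffOn ℝ ∞ u Ω)
    (hlevi : ∀ z ∈ Ω, ∀ v, 0 ≤ leviForm (sndDeriv u z) v) {z x : CSpace N}
    (hx : ∀ ζ : ℂ, ‖ζ‖ ≤ 1 → z + ζ • x ∈ Ω) :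
    2 * π * u z ≤ ∫ θ in (0 : ℝ)..(2 * π), u (z + Complex.exp (θ * Complex.I) • x) := by
  set e : ℝ → CSpace N := fun θ => Complex.exp (θ * Complex.I) • x with he
  have hnorm : ∀ θ : ℝ, ‖Complex.exp (θ * Complex.I)‖ = 1 := Complex.norm_exp_ofReal_mul_I
  have hed : ∀ θ, HasDerivAt e (Complex.I • e θ) θ := by
    intro θ
    have h1 : HasDerivAt (fun θ : ℝ => Complex.exp (θ * Complex.I))
        (Complex.exp (θ * Complex.I) * Complex.I) θ := by
      have := (((hasDerivAt_id (θ : ℂ)).mul_const Complex.I).cexp).comp_ofReal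
      simpa using this
    have h2 := h1.smul_const x
    rwa [mul_comm, mul_smul] at h2
  have hec : Continuous e := continuous_iff_continuousAt.mpr fun θ => (hed θ).continuousAt
  -- An open neighbourhood of `[0, 1]` of radii for which the scaled disc stays in `Ω`, so that one
  -- may differentiate at the endpoints too.
  set U : Set ℝ := {r | ∀ ζ ∈ Metric.closedBall (0 : ℂ) 1, z + ((r : ℂ) * ζ) • x ∈ Ω} with hUdef
  have hU : IsOpen U := by
    rw [isOpen_iff_eventually]
    intro r hr
    refine (isCompact_closedBall (0 : ℂ) 1).eventually_forall_of_forall_eventually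
      (P := fun (r : ℝ) (ζ : ℂ) => z + ((r : ℂ) * ζ) • x ∈ Ω) fun ζ hζ => ?_
    have hc : Continuous fun p : ℝ × ℂ => z + ((p.1 : ℂ) * p.2) • x := by fun_prop
    exact hc.continuousAt.preimage_mem_nhds (hΩ.mem_nhds (hr ζ hζ))
  have hIU : Icc (0 : ℝ) 1 ⊆ U := by
    intro r hr ζ hζ
    refine hx _ ?_
    rw [norm_mul, Complex.norm_real, Real.norm_of_nonneg hr.1]
    exact mul_le_one₀ hr.2 (norm_nonneg _) (by simpa using hζ)
  set p : ℝ → ℝ → CSpace N := fun r θ => z + r • e θ with hp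
  have hpΩ : ∀ r ∈ U, ∀ θ, p r θ ∈ Ω := by
    intro r hr θ
    have := hr (Complex.exp (θ * Complex.I)) (by simp [hnorm])
    rwa [mul_smul] at this
  have hpc : Continuous (Function.uncurry p) := by
    simp only [hp, Function.uncurry_def]
    fun_prop
  have hpmaps : MapsTo (Function.uncurry p) (U ×ˢ univ) Ω := fun q hq => hpΩ q.1 hq.1 q.2
  have hdu : ContDiffOn ℝ ∞ (fderiv ℝ u) Ω := hu.fderiv_of_isOpen hΩ (by simp)
  have hddu : ContinuousOn (sndDeriv u) Ω :=
    (hdu.fderiv_of_isOpen hΩ (m := ∞) (by simp)).continuousOn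
  have hu1 : ∀ w ∈ Ω, HasFDerivAt u (fderiv ℝ u w) w := fun w hw =>
    ((hu.contDiffAt (hΩ.mem_nhds hw)).differentiableAt (by simp)).hasFDerivAt
  have hu2 : ∀ w ∈ Ω, HasFDerivAt (fderiv ℝ u) (sndDeriv u w) w := fun w hw =>
    ((hdu.contDiffAt (hΩ.mem_nhds hw)).differentiableAt (by simp)).hasFDerivAt
  have hpr : ∀ r θ, HasDerivAt (fun r => p r θ) (e θ) r := fun r θ => by
    have := ((hasDerivAt_id r).smul_const (e θ)).const_add z
    rwa [one_smul] at this
  have hpθ : ∀ r θ, HasDerivAt (fun θ => p r θ) (r • (Complex.I • e θ)) θ := fun r θ =>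
    ((hed θ).const_smul r).const_add z
  have hcu : ContinuousOn (Function.uncurry fun r θ => u (p r θ)) (U ×ˢ univ) :=
    hu.continuousOn.comp hpc.continuousOn hpmaps
  have hcdu : ContinuousOn (fun q : ℝ × ℝ => fderiv ℝ u (p q.1 q.2)) (U ×ˢ univ) :=
    hdu.continuousOn.comp hpc.continuousOn hpmaps
  have hcddu : ContinuousOn (fun q : ℝ × ℝ => sndDeriv u (p q.1 q.2)) (U ×ˢ univ) :=
    hddu.comp hpc.continuousOn hpmaps
  have hecq : Continuous fun q : ℝ × ℝ => e q.2 := hec.comp continuous_snd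
  have hc1 : ContinuousOn (Function.uncurry fun r θ => fderiv ℝ u (p r θ) (e θ)) (U ×ˢ univ) :=
    hcdu.clm_apply hecq.continuousOn
  have hc2 : ContinuousOn (Function.uncurry fun r θ => sndDeriv u (p r θ) (e θ) (e θ))
      (U ×ˢ univ) := (hcddu.clm_apply hecq.continuousOn).clm_apply hecq.continuousOn
  have hc3 : ContinuousOn (Function.uncurry fun r θ =>
      sndDeriv u (p r θ) (Complex.I • e θ) (Complex.I • e θ)) (U ×ˢ univ) :=
    (hcddu.clm_apply (hecq.const_smul Complex.I).continuousOn).clm_apply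
      (hecq.const_smul Complex.I).continuousOn
  have hslice : ∀ {G : ℝ → ℝ → ℝ}, ContinuousOn (Function.uncurry G) (U ×ˢ univ) → ∀ s ∈ U,
      Continuous (G s) := fun hG s hs => by
    rw [← continuousOn_univ]
    exact hG.comp (Continuous.prodMk continuous_const continuous_id).continuousOn
      fun θ _ => ⟨hs, mem_univ _⟩
  set G : ℝ → ℝ := fun r => ∫ θ in (0 : ℝ)..(2 * π), u (p r θ) with hG
  set J : ℝ → ℝ := fun r => ∫ θ in (0 : ℝ)..(2 * π), fderiv ℝ u (p r θ) (e θ) with hJ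
  have hGd : ∀ r ∈ U, HasDerivAt G (J r) r := fun r hr =>
    hasDerivAt_intervalIntegral_of_continuousOn hU 0 (2 * π) hcu hc1
      (fun r hr θ => (hu1 _ (hpΩ r hr θ)).comp_hasDerivAt r (hpr r θ)) hr
  have hJd : ∀ r ∈ U, HasDerivAt J
      (∫ θ in (0 : ℝ)..(2 * π), sndDeriv u (p r θ) (e θ) (e θ)) r := fun r hr =>
    hasDerivAt_intervalIntegral_of_continuousOn hU 0 (2 * π) hc1 hc2
      (fun r hr θ => by
        have h1 := (hu2 _ (hpΩ r hr θ)).comp_hasDerivAt r (hpr r θ)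
        have h2 := h1.clm_apply (hasDerivAt_const r (e θ))
        simpa using h2) hr
  -- The angular derivative of `Du(p)(i e)` is `r D²u(ie, ie) - Du(e)`, and its integral over a full
  -- period vanishes.
  have hJ2 : ∀ r ∈ U, J r = r * ∫ θ in (0 : ℝ)..(2 * π),
      sndDeriv u (p r θ) (Complex.I • e θ) (Complex.I • e θ) := by
    intro r hr
    have hd : ∀ θ, HasDerivAt (fun θ => fderiv ℝ u (p r θ) (Complex.I • e θ))
        (r * sndDeriv u (p r θ) (Complex.I • e θ) (Complex.I • e θ) - fderiv ℝ u (p r θ) (e θ))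
        θ := by
      intro θ
      have h1 := (hu2 _ (hpΩ r hr θ)).comp_hasDerivAt θ (hpθ r θ)
      have h2 := h1.clm_apply ((hed θ).const_smul Complex.I)
      simp only [map_smul, smul_apply, smul_eq_mul, I_smul_I_smul, map_neg,
        Function.comp_apply] at h2
      rw [sub_eq_add_neg]
      exact h2
    have hi3 := (hslice hc3 r hr).intervalIntegrable (μ := volume) 0 (2 * π)
    have hi1 := (hslice hc1 r hr).intervalIntegrable (μ := volume) 0 (2 * π)
    have h := intervalIntegral.integral_eq_sub_of_hasDerivAt (a := 0) (b := 2 * π)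
      (fun θ _ => hd θ) ((hi3.const_mul r).sub hi1)
    rw [intervalIntegral.integral_sub (hi3.const_mul r) hi1,
      intervalIntegral.integral_const_mul] at h
    have hper : e (2 * π) = e 0 := by
      simp [he, Complex.exp_two_pi_mul_I]
    have hper' : p r (2 * π) = p r 0 := by simp only [hp, hper]
    rw [hper, hper', sub_self] at h
    linarith
  have hJnonneg : ∀ r ∈ Ioo (0 : ℝ) 1, 0 ≤ J r := by
    -- By `hJ2` the derivative of `r J(r)` is `r` times the integral of the Levi form along the
    -- circle. Hence `r J(r)` increases from `0`, `J ≥ 0`, and the circle integrals increase with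
    -- `r`.
    set K : ℝ → ℝ := fun r => r * J r with hK
    have hKd : ∀ r ∈ U, HasDerivAt K (1 * J r + r *
        (∫ θ in (0 : ℝ)..(2 * π), sndDeriv u (p r θ) (e θ) (e θ))) r := fun r hr =>
      (hasDerivAt_id r).mul (hJd r hr)
    have hKmono : MonotoneOn K (Icc 0 1) := by
      refine monotoneOn_of_deriv_nonneg (convex_Icc 0 1)
        (fun r hr => (hKd r (hIU hr)).continuousAt.continuousWithinAt)
        (fun r hr => (hKd r (hIU (interior_subset hr))).differentiableAt.differentiableWithinAt)
        fun r hr => ?_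
      have hrU := hIU (interior_subset hr)
      rw [(hKd r hrU).deriv, one_mul, hJ2 r hrU, ← mul_add, add_comm,
        ← intervalIntegral.integral_add ((hslice hc2 r hrU).intervalIntegrable _ _)
          ((hslice hc3 r hrU).intervalIntegrable _ _)]
      exact mul_nonneg (interior_subset hr).1 (intervalIntegral.integral_nonneg
        (by positivity) fun θ _ => hlevi _ (hpΩ r hrU θ) (e θ))
    intro r hr
    have h0 := hKmono (left_mem_Icc.mpr zero_le_one) ⟨hr.1.le, hr.2.le⟩ hr.1.le
    simp only [hK, zero_mul] at h0
    exact nonneg_of_mul_nonneg_right h0 hr.1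
  have hGmono : MonotoneOn G (Icc 0 1) := by
    refine monotoneOn_of_deriv_nonneg (convex_Icc 0 1)
      (fun r hr => (hGd r (hIU hr)).continuousAt.continuousWithinAt)
      (fun r hr => (hGd r (hIU (interior_subset hr))).differentiableAt.differentiableWithinAt)
      fun r hr => ?_
    rw [(hGd r (hIU (interior_subset hr))).deriv]
    rw [interior_Icc] at hr
    exact hJnonneg r hr
  have h := hGmono (left_mem_Icc.mpr zero_le_one) (right_mem_Icc.mpr zero_le_one) zero_le_one
  have h0 : G 0 = 2 * π * u z := by simp [hG, hp]
  have h1 : G 1 = ∫ θ in (0 : ℝ)..(2 * π), u (z + Complex.exp (θ * Complex.I) • x) := by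
    simp [hG, hp, he]
  rwa [h0, h1] at h

/-- Multiplication by a complex number of modulus one. -/
noncomputable def unitScaling (N : ℕ) (c : ℂ) (hc : ‖c‖ = 1) : CSpace N ≃ₗᵢ[ℝ] CSpace N where
  toLinearEquiv := (LinearEquiv.smulOfNeZero ℂ (CSpace N) c
    (fun h => by simp [h] at hc)).restrictScalars ℝ
  norm_map' v := by
    change ‖c • v‖ = ‖v‖
    rw [norm_smul, hc, one_mul]

/-- The mean value inequality on circles implies the mean value inequality on balls. -/
theorem ball_submean_of_circle_submean {u : CSpace N → ℝ} {z : CSpace N} {r : ℝ}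
    (hu : ContinuousOn u (Metric.closedBall z r))
    (hcirc : ∀ x ∈ Metric.closedBall (0 : CSpace N) r,
      2 * π * u z ≤ ∫ θ in (0 : ℝ)..(2 * π), u (z + Complex.exp (θ * Complex.I) • x)) :
    (volume (Metric.closedBall z r)).toReal * u z ≤ ∫ x in Metric.closedBall z r, u x := by
  set B : Set (CSpace N) := Metric.closedBall 0 r with hB
  have hBc : IsCompact B := isCompact_closedBall 0 r
  have hBm : MeasurableSet B := Metric.isClosed_closedBall.measurableSet
  have hmaps : ∀ c : ℂ, ‖c‖ = 1 → ∀ x ∈ B, z + c • x ∈ Metric.closedBall z r := by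
    intro c hc x hx
    rw [Metric.mem_closedBall, dist_eq_norm, add_sub_cancel_left, norm_smul, hc, one_mul]
    simpa [hB] using hx
  -- Multiplication by a unit complex number preserves the ball and its volume. So integrating the
  -- circle inequality over the ball and exchanging the integrals returns the ball integral itself.
  have hrot : ∀ c : ℂ, ‖c‖ = 1 → ∫ x in B, u (z + c • x) = ∫ x in Metric.closedBall z r, u x := by
    intro c hc
    have h1 : MeasurePreserving (fun x : CSpace N => z + c • x) volume volume :=
      (measurePreserving_add_left volume z).comp (unitScaling N c hc).measurePreserving
    have h2 : MeasurableEmbedding (fun x : CSpace N => z + c • x) :=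
      (measurableEmbedding_addLeft z).comp
        (unitScaling N c hc).toHomeomorph.measurableEmbedding
    have h3 : (fun x : CSpace N => z + c • x) ⁻¹' Metric.closedBall z r = B := by
      ext x
      rw [mem_preimage, Metric.mem_closedBall, dist_eq_norm, add_sub_cancel_left, norm_smul, hc,
        one_mul]
      simp [hB]
    have h4 := h1.setIntegral_preimage_emb h2 u (Metric.closedBall z r)
    rwa [h3] at h4
  have hnorm : ∀ θ : ℝ, ‖Complex.exp (θ * Complex.I)‖ = 1 := Complex.norm_exp_ofReal_mul_I
  set I := ∫ x in Metric.closedBall z r, u x with hI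
  have hcont : ContinuousOn (Function.uncurry fun (θ : ℝ) (x : CSpace N) =>
      u (z + Complex.exp (θ * Complex.I) • x)) (univ ×ˢ B) :=
    hu.comp (by fun_prop) fun q hq => hmaps _ (hnorm _) _ hq.2
  have hint : Integrable (Function.uncurry fun (θ : ℝ) (x : CSpace N) =>
      u (z + Complex.exp (θ * Complex.I) • x))
      ((volume.restrict (Ioc 0 (2 * π))).prod (volume.restrict B)) := by
    rw [Measure.prod_restrict]
    have h1 := (hcont.mono (prod_mono_left (subset_univ (Icc (0 : ℝ) (2 * π))))
      ).integrableOn_compact (μ := (volume : Measure ℝ).prod (volume : Measure (CSpace N)))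
      (isCompact_Icc.prod hBc)
    exact h1.mono_set (prod_mono_left Ioc_subset_Icc_self)
  have hswap := integral_integral_swap hint
  have h2π : (0 : ℝ) ≤ 2 * π := by positivity
  have hL : ∫ θ in Ioc 0 (2 * π), ∫ x in B, u (z + Complex.exp ((θ : ℝ) * Complex.I) • x) =
      2 * π * I := by
    simp only [hrot _ (hnorm _)]
    simp [h2π]
  rw [hL] at hswap
  have hle : ∫ _x in B, 2 * π * u z ≤
      ∫ x in B, ∫ θ in Ioc 0 (2 * π), u (z + Complex.exp ((θ : ℝ) * Complex.I) • x) := by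
    refine setIntegral_mono_on ?_ hint.integral_prod_right hBm fun x hx => ?_
    · exact integrableOn_const hBc.measure_lt_top.ne
    · have := hcirc x hx
      rwa [intervalIntegral.integral_of_le h2π] at this
  rw [← hswap, setIntegral_const, smul_eq_mul] at hle
  have hvol : (volume (Metric.closedBall z r)).toReal = volume.real B := by
    rw [Measure.addHaar_closedBall_center]
    rfl
  rw [hvol]
  have h2π' : (0 : ℝ) < 2 * π := by positivity
  refine le_of_mul_le_mul_left ?_ h2π'
  linarith

end MeanValue

/-! ### Extended real integrals and subharmonic functions -/

section Subharmonic

open Filter Topology Real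

variable {N : ℕ}

/-- Only the positive parts `a` and `p` must be finite; an infinite `b` or `q` represents the value
`-∞`. -/
theorem ereal_sub_le_sub_iff {a b p q : ENNReal} (ha : a ≠ ⊤) (hp : p ≠ ⊤) :
    (a : EReal) - b ≤ (p : EReal) - q ↔ a + q ≤ p + b := by
  lift a to NNReal using ha
  lift p to NNReal using hp
  by_cases hb : b = ⊤
  · subst hb
    simp
  · lift b to NNReal using hb
    by_cases hq : q = ⊤
    · subst hq
      have h1 : ((a : ENNReal) : EReal) - ((b : ENNReal) : EReal) = ((a - b : ℝ) : EReal) := rfl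
      rw [h1]
      have h2 : (((p : ENNReal) : EReal) - ((⊤ : ENNReal) : EReal)) = ⊥ := by
        simp
      rw [h2, le_bot_iff]
      simp only [EReal.coe_ne_bot, add_top, top_le_iff, false_iff]
      exact_mod_cast ENNReal.coe_ne_top
    · lift q to NNReal using hq
      have h1 : ((a : ENNReal) : EReal) - ((b : ENNReal) : EReal) = ((a - b : ℝ) : EReal) := rfl
      have h2 : ((p : ENNReal) : EReal) - ((q : ENNReal) : EReal) = ((p - q : ℝ) : EReal) := rfl
      rw [h1, h2, EReal.coe_le_coe_iff, ← ENNReal.coe_add, ← ENNReal.coe_add, ENNReal.coe_le_coe,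
        ← NNReal.coe_le_coe]
      push_cast
      constructor <;> intro h <;> linarith

theorem ereal_mul_eq_sub {V : ENNReal} (h0 : V ≠ 0) (ht : V ≠ ⊤) {x : EReal} (hx : x ≠ ⊤) :
    (V : EReal) * x = ((V * x.toENNReal : ENNReal) : EReal) - ((V * (-x).toENNReal : ENNReal) : EReal) := by
  lift V to NNReal using ht
  have hV : 0 < V := by
    rw [pos_iff_ne_zero]
    exact_mod_cast h0
  induction x with
  | bot =>
    have : ((V : ENNReal) : EReal) * ⊥ = ⊥ := EReal.coe_mul_bot_of_pos (x := (V : ℝ)) hV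
    rw [this]
    simp [ENNReal.mul_top h0]
  | coe x =>
    have e1 : ((V : ENNReal) : EReal) = ((V : ℝ) : EReal) := rfl
    have e2 : ((x : EReal)).toENNReal = ENNReal.ofReal x := rfl
    have e3 : (-(x : EReal)).toENNReal = ENNReal.ofReal (-x) := rfl
    rw [e1, e2, e3, ← EReal.coe_mul, EReal.coe_ennreal_mul, EReal.coe_ennreal_mul,
      EReal.coe_ennreal_ofReal, EReal.coe_ennreal_ofReal, e1, ← EReal.coe_mul, ← EReal.coe_mul,
      ← EReal.coe_sub, EReal.coe_eq_coe_iff, ← mul_sub]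
    congr 1
    rcases le_total 0 x with h | h
    · rw [max_eq_left h, max_eq_right (by linarith)]
      ring
    · rw [max_eq_right h, max_eq_left (by linarith)]
      ring
  | top => exact absurd rfl hx

theorem ereal_const_sub_toENNReal {C : ℝ} (hC : 0 ≤ C) {x : EReal} (hx : x ≤ C) :
    ((C : EReal) - x).toENNReal + x.toENNReal = ENNReal.ofReal C + (-x).toENNReal := by
  induction x with
  | bot => simp
  | coe x =>
    have hxC : x ≤ C := by exact_mod_cast hx
    have e1 : ((C : EReal) - x).toENNReal = ENNReal.ofReal (C - x) := rfl
    have e2 : ((x : EReal)).toENNReal = ENNReal.ofReal x := rfl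
    have e3 : (-(x : EReal)).toENNReal = ENNReal.ofReal (-x) := rfl
    rw [e1, e2, e3]
    rcases le_total 0 x with h | h
    · rw [← ENNReal.ofReal_add (by linarith) h, ENNReal.ofReal_of_nonpos (p := -x) (by linarith)]
      simp
    · rw [ENNReal.ofReal_of_nonpos h, ← ENNReal.ofReal_add hC (by linarith)]
      simp [sub_eq_add_neg]
  | top => simp at hx

theorem lintegral_toENNReal_ne_top {C : ℝ} {s : Set (CSpace N)} (hs : MeasurableSet s)
    (hs' : volume s ≠ ⊤) {u : CSpace N → EReal} (hC : ∀ y ∈ s, u y ≤ C) :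
    ∫⁻ z in s, (u z).toENNReal ≠ ⊤ := by
  refine ne_top_of_le_ne_top ?_ (setLIntegral_mono' (g := fun _ => ENNReal.ofReal C) hs
    fun z hz => EReal.toENNReal_le_toENNReal (hC z hz))
  rw [setLIntegral_const]
  exact ENNReal.mul_ne_top ENNReal.ofReal_ne_top hs'

/-- The mean value inequality for `u` in terms of the nonnegative function `C - u`. -/
theorem mul_le_extIntegral_iff {C : ℝ} (hC : 0 ≤ C) {s : Set (CSpace N)} (hs : MeasurableSet s)
    (hs0 : volume s ≠ 0) (hs' : volume s ≠ ⊤) {u : CSpace N → EReal}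
    (hu : AEMeasurable u (volume.restrict s)) (huC : ∀ y ∈ s, u y ≤ C) {z : CSpace N}
    (hz : z ∈ s) :
    ((volume s : ENNReal) : EReal) * u z ≤ extIntegral s u ↔
      ∫⁻ y in s, ((C : EReal) - u y).toENNReal ≤ volume s * ((C : EReal) - u z).toENNReal := by
  have hzt : u z ≠ ⊤ := ne_top_of_le_ne_top (EReal.coe_ne_top C) (huC z hz)
  have hP := lintegral_toENNReal_ne_top hs hs' huC
  set P := ∫⁻ y in s, (u y).toENNReal with hPdef
  set Q := ∫⁻ y in s, (-u y).toENNReal with hQdef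
  have ha : volume s * (u z).toENNReal ≠ ⊤ :=
    ENNReal.mul_ne_top hs' (by simpa using hzt)
  rw [ereal_mul_eq_sub hs0 hs' hzt, extIntegral, ereal_sub_le_sub_iff ha hP]
  have h1 : (∫⁻ y in s, ((C : EReal) - u y).toENNReal) + P = volume s * ENNReal.ofReal C + Q := by
    rw [hPdef, hQdef, ← lintegral_add_right' _ hu.ereal_toENNReal]
    have : volume s * ENNReal.ofReal C = ∫⁻ _ in s, ENNReal.ofReal C := by
      rw [setLIntegral_const, mul_comm]
    rw [this, ← lintegral_add_left measurable_const]
    exact setLIntegral_congr_fun hs fun y hy => ereal_const_sub_toENNReal hC (huC y hy)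
  have h2 : volume s * ((C : EReal) - u z).toENNReal + volume s * (u z).toENNReal =
      volume s * ENNReal.ofReal C + volume s * (-u z).toENNReal := by
    rw [← mul_add, ereal_const_sub_toENNReal hC (huC z hz), mul_add]
  set X := ∫⁻ y in s, ((C : EReal) - u y).toENNReal with hX
  set Y := volume s * ((C : EReal) - u z).toENNReal with hY
  set A := volume s * (u z).toENNReal with hA
  set Bq := volume s * (-u z).toENNReal with hBq
  have hCt : volume s * ENNReal.ofReal C ≠ ⊤ := ENNReal.mul_ne_top hs' ENNReal.ofReal_ne_top
  -- The subtraction-free forms of both inequalities become identical after adding the finite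
  -- quantities `volume s * C`, `P` and `A`.
  rw [← ENNReal.add_le_add_iff_right hCt, ← ENNReal.add_le_add_iff_right (a := P) (b := X) hP,
    ← ENNReal.add_le_add_iff_right (a := A) (b := X + P) ha, h1]
  have e1 : volume s * ENNReal.ofReal C + Q + A = A + Q + volume s * ENNReal.ofReal C := by ring
  have e2 : Y + P + A = P + Bq + volume s * ENNReal.ofReal C := by
    rw [add_right_comm, h2]
    ring
  rw [e1, e2]

theorem aemeasurable_of_upperSemicontinuousOn {Ω : Set (CSpace N)} (hΩ : IsOpen Ω)
    {u : CSpace N → EReal} (hu : UpperSemicontinuousOn u Ω) {s : Set (CSpace N)}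
    (hs : MeasurableSet s) (hsΩ : s ⊆ Ω) : AEMeasurable u (volume.restrict s) := by
  classical
  -- Extended by `-∞` outside `Ω`, the function has Borel strict sublevel sets: an open subset of
  -- `Ω`, together with the complement of `Ω` when the level exceeds `-∞`.
  have hm : Measurable (Ω.piecewise u fun _ => ⊥) := by
    refine measurable_of_Iio fun c => ?_
    have : Ω.piecewise u (fun _ => ⊥) ⁻¹' Iio c =
        (Ω ∩ {z | u z < c}) ∪ (Ωᶜ ∩ {_z | (⊥ : EReal) < c}) := by
      ext z
      by_cases hz : z ∈ Ω <;> simp [hz]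
    rw [this]
    refine MeasurableSet.union (IsOpen.measurableSet ?_)
      (hΩ.measurableSet.compl.inter (MeasurableSet.const _))
    rw [isOpen_iff_mem_nhds]
    intro z hz
    have h1 := hu z hz.1 c hz.2
    rw [hΩ.nhdsWithin_eq hz.1] at h1
    exact inter_mem (hΩ.mem_nhds hz.1) h1
  refine ⟨_, hm, ?_⟩
  filter_upwards [ae_restrict_mem hs] with z hz
  rw [piecewise_eq_of_mem _ _ _ (hsΩ hz)]

theorem volume_closedBall_ne_zero (z : CSpace N) {r : ℝ} (hr : 0 < r) :
    volume (Metric.closedBall z r) ≠ 0 :=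
  (Metric.measure_closedBall_pos volume z hr).ne'

theorem volume_closedBall_ne_top (z : CSpace N) (r : ℝ) : volume (Metric.closedBall z r) ≠ ⊤ :=
  (isCompact_closedBall z r).measure_lt_top.ne

theorem exists_upper_bound {Ω : Set (CSpace N)} {u : CSpace N → EReal}
    (hu : UpperSemicontinuousOn u Ω) (ht : ∀ z ∈ Ω, u z < ⊤) {K : Set (CSpace N)}
    (hK : IsCompact K) (hKΩ : K ⊆ Ω) : ∃ C : ℝ, 0 ≤ C ∧ ∀ z ∈ K, u z ≤ C := by
  rcases K.eq_empty_or_nonempty with h | h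
  · exact ⟨0, le_rfl, by simp [h]⟩
  · obtain ⟨a, haK, ha⟩ := (hu.mono hKΩ).exists_isMaxOn h hK
    obtain ⟨C, hC⟩ := EReal.lt_iff_exists_real_btwn.mp (ht a (hKΩ haK))
    exact ⟨max C 0, le_max_right _ _, fun z hz => (ha hz).trans
      (hC.1.le.trans (EReal.coe_le_coe_iff.mpr (le_max_left _ _)))⟩

/-- A continuous real function with the mean value inequality on circles is subharmonic. -/
theorem isSubharmonicOn_of_circle_submean {Ω : Set (CSpace N)}
    {u : CSpace N → ℝ} (hu : ContinuousOn u Ω)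
    (hcirc : ∀ z x : CSpace N, (∀ ζ : ℂ, ‖ζ‖ ≤ 1 → z + ζ • x ∈ Ω) →
      2 * π * u z ≤ ∫ θ in (0 : ℝ)..(2 * π), u (z + Complex.exp (θ * Complex.I) • x)) :
    IsSubharmonicOn (fun z => (u z : EReal)) Ω where
  usc := (continuous_coe_real_ereal.comp_continuousOn hu).upperSemicontinuousOn
  lt_top := fun z _ => EReal.coe_lt_top _
  submean := by
    intro z hz r hr hball
    have h1 := ball_submean_of_circle_submean (hu.mono hball) fun x hx => hcirc z x fun ζ hζ => by
      refine hball ?_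
      rw [Metric.mem_closedBall, dist_eq_norm, add_sub_cancel_left, norm_smul]
      have : ‖x‖ ≤ r := by simpa using hx
      calc ‖ζ‖ * ‖x‖ ≤ 1 * r := mul_le_mul hζ this (norm_nonneg _) zero_le_one
        _ = r := one_mul r
    have hint : IntegrableOn u (Metric.closedBall z r) :=
      (hu.mono hball).integrableOn_compact (isCompact_closedBall z r)
    have hP : ∫⁻ y in Metric.closedBall z r, ENNReal.ofReal (u y) ≠ ⊤ :=
      ne_top_of_le_ne_top hint.2.ne (lintegral_mono fun y => Real.ofReal_le_enorm _)
    have hQ : ∫⁻ y in Metric.closedBall z r, ENNReal.ofReal (-u y) ≠ ⊤ :=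
      ne_top_of_le_ne_top hint.neg.2.ne (lintegral_mono fun y => Real.ofReal_le_enorm _)
    have h2 : extIntegral (Metric.closedBall z r) (fun z => (u z : EReal)) =
        ((∫ y in Metric.closedBall z r, u y : ℝ) : EReal) := by
      have e : ∀ y, (-(u y : EReal)).toENNReal = ENNReal.ofReal (-u y) := fun y => rfl
      simp only [extIntegral, e, EReal.real_coe_toENNReal]
      rw [integral_eq_lintegral_pos_part_sub_lintegral_neg_part hint, EReal.coe_sub,
        EReal.coe_ennreal_toReal hP, EReal.coe_ennreal_toReal hQ]
    rw [h2, ← ENNReal.ofReal_toReal (volume_closedBall_ne_top z r), EReal.coe_ennreal_ofReal,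
      max_eq_left ENNReal.toReal_nonneg, ← EReal.coe_mul]
    exact EReal.coe_le_coe_iff.mpr h1

/-- Smooth functions with nonnegative Levi form are `k`-subharmonic. -/
theorem isKSubharmonicOn_of_leviForm_nonneg {k : ℕ} (hk : 1 ≤ k) (hkN : k ≤ N)
    {Ω : Set (CSpace N)} (hΩ : IsOpen Ω) {u : CSpace N → ℝ} (hu : ContDiffOn ℝ ∞ u Ω)
    (hlevi : ∀ z ∈ Ω, ∀ v, 0 ≤ leviForm (sndDeriv u z) v) :
    IsKSubharmonicOn k (fun z => (u z : EReal)) Ω where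
  subharmonic := isSubharmonicOn_of_circle_submean hu.continuousOn fun _ _ hx =>
    circle_submean_of_leviForm_nonneg hΩ hu hlevi hx
  current_nonneg := by
    refine Or.inr fun α hα χ hχ hc hs hpos => ?_
    obtain ⟨ι, _, c, v, w, h⟩ := exists_wedgeCoeff_hessOf_eq_sum (by omega : 0 < N) α k
    have h1 : ∀ z, (wedgeCoeff fun i : Fin N => if (i : ℕ) = 0 then complexHessian χ z else
        if (i : ℕ) < k then α i else 1).re = ∑ i, c i * sndDeriv χ z (v i) (w i) := fun z => by
      rw [← h, complexHessian_eq (hχ.contDiffAt.of_le two_le_infty)]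
    simp only [EReal.toReal_coe, h1]
    rw [integral_mul_sum_sndDeriv hΩ hu hχ hc hs]
    refine integral_nonneg fun z => ?_
    by_cases hz : z ∈ tsupport χ
    · refine mul_nonneg ?_ (hpos z)
      rw [← h]
      have hsym := sndDeriv_symm ((hu.contDiffAt (hΩ.mem_nhds (hs hz))).of_le two_le_infty)
      -- Slot `0` is the Hessian of `u`, a positive form and therefore also an element of `Γ_k`.
      refine garding_inequality hkN (fun i hi => ?_) fun i hi => ?_
      · split_ifs
        · exact posSemidef_mem_gammaCone ((hessOf_posSemidef_iff hsym).mpr (hlevi z (hs hz))) k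
        · exact hα i
      · rw [if_neg (by omega), if_neg (by omega)]
    · simp [image_eq_zero_of_notMem_tsupport hz]

/-- An infinite negative part would make the ball integral `-∞`, whereas the submean inequality
bounds it below by a finite number. -/
theorem lintegral_neg_ne_top_of_submean {Ω : Set (CSpace N)} {u : CSpace N → EReal}
    (hu : IsSubharmonicOn u Ω) {z : CSpace N} (hz : z ∈ Ω) (hz' : u z ≠ ⊥) {r : ℝ} (hr : 0 < r)
    (hball : Metric.closedBall z r ⊆ Ω) :
    ∫⁻ y in Metric.closedBall z r, (-u y).toENNReal ≠ ⊤ := by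
  intro h
  have h1 := hu.submean z hz r hr hball
  rw [extIntegral, h] at h1
  have h2 : ((∫⁻ z in Metric.closedBall z r, (u z).toENNReal : ENNReal) : EReal) -
      ((⊤ : ENNReal) : EReal) = ⊥ := by simp
  rw [h2, le_bot_iff] at h1
  have h3 := (hu.lt_top z hz).ne
  lift u z to ℝ using ⟨h3, hz'⟩ with x
  rw [← ENNReal.ofReal_toReal (volume_closedBall_ne_top z r), EReal.coe_ennreal_ofReal,
    ← EReal.coe_mul] at h1
  exact EReal.coe_ne_bot _ h1

/-- A subharmonic function on a connected open set is `-∞` or locally integrable. -/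
theorem eq_bot_or_locally_integrable {Ω : Set (CSpace N)} (hΩ : IsOpen Ω) (hΩ' : IsConnected Ω)
    {u : CSpace N → EReal} (hu : IsSubharmonicOn u Ω) :
    (∀ z ∈ Ω, u z = ⊥) ∨ ∀ z ∈ Ω, ∃ r > 0, Metric.closedBall z r ⊆ Ω ∧
      ∫⁻ y in Metric.closedBall z r, (-u y).toENNReal ≠ ⊤ := by
  -- Points near which `u` is identically `-∞`, against points with a ball on which the negative
  -- part is integrable. Both sets are open, they cover `Ω`, and no point of `Ω` is in both.
  set A : Set (CSpace N) := {z | ∀ᶠ y in 𝓝 z, u y = ⊥} with hA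
  set D : Set (CSpace N) := {z | ∃ r > 0, Metric.closedBall z r ⊆ Ω ∧
      ∫⁻ y in Metric.closedBall z r, (-u y).toENNReal ≠ ⊤} with hD
  have hAo : IsOpen A := isOpen_setOfPred_eventually_nhds
  have hmono : ∀ {y z : CSpace N} {r s : ℝ}, Metric.closedBall y s ⊆ Metric.closedBall z r →
      ∫⁻ y in Metric.closedBall z r, (-u y).toENNReal ≠ ⊤ →
      ∫⁻ y in Metric.closedBall y s, (-u y).toENNReal ≠ ⊤ := fun hsub h =>
    ne_top_of_le_ne_top h (lintegral_mono_set hsub)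
  have hDo : IsOpen D := by
    rw [Metric.isOpen_iff]
    rintro z ⟨r, hr, h1, h2⟩
    refine ⟨r / 2, half_pos hr, fun y hy => ⟨r / 2, half_pos hr, ?_, ?_⟩⟩
    · refine (Metric.closedBall_subset_closedBall' ?_).trans h1
      have := Metric.mem_ball.mp hy
      linarith
    · refine hmono (Metric.closedBall_subset_closedBall' ?_) h2
      have := Metric.mem_ball.mp hy
      linarith
  have hcover : Ω ⊆ A ∪ D := by
    intro z hz
    by_cases hzA : z ∈ A
    · exact Or.inl hzA
    · right
      obtain ⟨R, hR, hRb⟩ := Metric.nhds_basis_closedBall.mem_iff.mp (hΩ.mem_nhds hz)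
      have h1 : ∃ᶠ y in 𝓝 z, ¬ u y = ⊥ := not_eventually.mp hzA
      -- A point within `R/3` of `z` where `u` is finite. The radii fit because `R/3 + R/2 ≤ R` and
      -- `R/8 + R/3 ≤ R/2`.
      obtain ⟨y, hy, hyz⟩ := (h1.and_eventually (Metric.ball_mem_nhds z (by positivity : 0 < R / 3))
        ).exists
      have hyz' := Metric.mem_ball.mp hyz
      have hsub : Metric.closedBall y (R / 2) ⊆ Metric.closedBall z R :=
        Metric.closedBall_subset_closedBall' (by linarith)
      have hsub2 : Metric.closedBall z (R / 8) ⊆ Metric.closedBall y (R / 2) :=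
        Metric.closedBall_subset_closedBall' (by rw [dist_comm]; linarith)
      exact ⟨R / 8, by positivity, hsub2.trans (hsub.trans hRb), hmono hsub2
        (lintegral_neg_ne_top_of_submean hu (hRb (hsub (Metric.mem_closedBall_self (by positivity))))
          hy (by positivity) (hsub.trans hRb))⟩
  have hdisj : Ω ∩ (A ∩ D) = ∅ := by
    rw [eq_empty_iff_forall_notMem]
    rintro z ⟨-, hzA, r, hr, -, h2⟩
    obtain ⟨s, hs, hsb⟩ := Metric.nhds_basis_closedBall.mem_iff.mp hzA
    have h3 : ∫⁻ y in Metric.closedBall z (min r s), (-u y).toENNReal ≠ ⊤ :=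
      hmono (Metric.closedBall_subset_closedBall (min_le_left _ _)) h2
    apply h3
    rw [setLIntegral_congr_fun Metric.isClosed_closedBall.measurableSet
      (g := fun _ => ⊤) fun y hy => by
        have : u y = ⊥ := hsb (Metric.closedBall_subset_closedBall (min_le_right _ _) hy)
        simp [this], setLIntegral_const,
      ENNReal.top_mul (volume_closedBall_ne_zero z (lt_min hr hs))]
  rcases isPreconnected_iff_subset_of_disjoint.mp hΩ'.isPreconnected A D hAo hDo hcover hdisj
    with h | h
  · exact Or.inl fun z hz => (h hz).self_of_nhds
  · exact Or.inr fun z hz => h hz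

theorem lintegral_neg_ne_top_of_isCompact {Ω : Set (CSpace N)} {u : CSpace N → EReal}
    (h : ∀ z ∈ Ω, ∃ r > 0, Metric.closedBall z r ⊆ Ω ∧
      ∫⁻ y in Metric.closedBall z r, (-u y).toENNReal ≠ ⊤) {K : Set (CSpace N)}
    (hK : IsCompact K) (hKΩ : K ⊆ Ω) : ∫⁻ y in K, (-u y).toENNReal ≠ ⊤ := by
  refine hK.induction_on (p := fun s => ∫⁻ y in s, (-u y).toENNReal ≠ ⊤) (by simp)
    (fun s t hst ht => ne_top_of_le_ne_top ht (lintegral_mono_set hst))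
    (fun s t hs ht => ?_) fun z hz => ?_
  · exact ne_top_of_le_ne_top (ENNReal.add_ne_top.mpr ⟨hs, ht⟩) (lintegral_union_le _ _ _)
  · obtain ⟨r, hr, -, h2⟩ := h z (hKΩ hz)
    exact ⟨_, mem_nhdsWithin_of_mem_nhds (Metric.closedBall_mem_nhds z hr), h2⟩

theorem ae_ne_bot_of_lintegral_neg_ne_top {u : CSpace N → EReal} {K : Set (CSpace N)}
    (hu : AEMeasurable u (volume.restrict K)) (h : ∫⁻ y in K, (-u y).toENNReal ≠ ⊤) :
    ∀ᵐ y ∂volume.restrict K, u y ≠ ⊥ := by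
  filter_upwards [ae_lt_top' (hu.neg.ereal_toENNReal) h] with y hy hbot
  simp [hbot] at hy

theorem integrableOn_toReal {u : CSpace N → EReal} {K : Set (CSpace N)} (hK : IsCompact K)
    (hu : AEMeasurable u (volume.restrict K)) (h : ∫⁻ y in K, (-u y).toENNReal ≠ ⊤) {C : ℝ}
    (hC : ∀ y ∈ K, u y ≤ C) : IntegrableOn (fun y => (u y).toReal) K := by
  refine ⟨hu.ereal_toReal.aestronglyMeasurable, ?_⟩
  have h1 : ∫⁻ y in K, (ENNReal.ofReal C + (-u y).toENNReal) < ⊤ := by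
    rw [lintegral_add_left measurable_const, setLIntegral_const]
    exact ENNReal.add_lt_top.mpr ⟨ENNReal.mul_lt_top ENNReal.ofReal_lt_top hK.measure_lt_top,
      h.lt_top⟩
  refine lt_of_le_of_lt (setLIntegral_mono' hK.isClosed.measurableSet fun y hy => ?_) h1
  have hy := hC y hy
  induction hx : u y with
  | bot => simp
  | coe x =>
    rw [hx] at hy
    have hxC : x ≤ C := by exact_mod_cast hy
    have e3 : (-(x : EReal)).toENNReal = ENNReal.ofReal (-x) := rfl
    simp only [hx]
    rw [e3, EReal.toReal_coe, ← ofReal_norm, Real.norm_eq_abs]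
    rcases le_total 0 x with h | h
    · rw [abs_of_nonneg h]
      exact (ENNReal.ofReal_le_ofReal hxC).trans le_self_add
    · rw [abs_of_nonpos h]
      exact le_add_self
  | top => simp [hx] at hy

end Subharmonic

/-! ### Regularization -/

section Mollifier

open Filter Topology

variable {N : ℕ} {ε : ℝ}

/-- An unnormalized smooth radial kernel supported in the ball of radius `ε`. -/
noncomputable def bumpKernel (ε : ℝ) (x : CSpace N) : ℝ := expNegInvGlue (ε ^ 2 - ‖x‖ ^ 2)

/-- A smooth radially decreasing probability density supported in the ball of radius `ε`. -/
noncomputable def mollifier (ε : ℝ) (x : CSpace N) : ℝ :=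
  bumpKernel ε x / ∫ y : CSpace N, bumpKernel ε y

theorem contDiff_bumpKernel : ContDiff ℝ ∞ (bumpKernel (N := N) ε) :=
  expNegInvGlue.contDiff.comp (contDiff_const.sub (contDiff_norm_sq ℝ))

theorem bumpKernel_eq_zero (hε : 0 < ε) {x : CSpace N} (hx : ε ≤ ‖x‖) : bumpKernel ε x = 0 :=
  expNegInvGlue.zero_of_nonpos (by nlinarith)

theorem tsupport_bumpKernel (hε : 0 < ε) :
    tsupport (bumpKernel (N := N) ε) ⊆ Metric.closedBall 0 ε := by
  refine closure_minimal (fun x hx => ?_) Metric.isClosed_closedBall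
  by_contra h
  refine hx (bumpKernel_eq_zero hε ?_)
  simp only [Metric.mem_closedBall, dist_zero_right, not_le] at h
  exact h.le

theorem hasCompactSupport_bumpKernel (hε : 0 < ε) :
    HasCompactSupport (bumpKernel (N := N) ε) :=
  (isCompact_closedBall 0 ε).of_isClosed_subset (isClosed_tsupport _) (tsupport_bumpKernel hε)

theorem integral_bumpKernel_pos (hε : 0 < ε) : 0 < ∫ y : CSpace N, bumpKernel ε y := by
  refine contDiff_bumpKernel.continuous.integral_pos_of_hasCompactSupport_nonneg_nonzero
    (hasCompactSupport_bumpKernel hε) (fun x => expNegInvGlue.nonneg _) (x := 0) ?_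
  refine (expNegInvGlue.pos_of_pos ?_).ne'
  simpa using pow_pos hε 2

theorem contDiff_mollifier : ContDiff ℝ ∞ (mollifier (N := N) ε) :=
  contDiff_bumpKernel.div_const _

theorem mollifier_nonneg (x : CSpace N) : 0 ≤ mollifier ε x :=
  div_nonneg (expNegInvGlue.nonneg _) (integral_nonneg fun _ => expNegInvGlue.nonneg _)

theorem mollifier_eq_zero (hε : 0 < ε) {x : CSpace N} (hx : ε ≤ ‖x‖) : mollifier ε x = 0 := by
  rw [mollifier, bumpKernel_eq_zero hε hx, zero_div]

theorem tsupport_mollifier (hε : 0 < ε) :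
    tsupport (mollifier (N := N) ε) ⊆ Metric.closedBall 0 ε := by
  refine closure_minimal (fun x hx => ?_) Metric.isClosed_closedBall
  by_contra h
  refine hx (mollifier_eq_zero hε ?_)
  simp only [Metric.mem_closedBall, dist_zero_right, not_le] at h
  exact h.le

theorem hasCompactSupport_mollifier (hε : 0 < ε) : HasCompactSupport (mollifier (N := N) ε) :=
  (isCompact_closedBall 0 ε).of_isClosed_subset (isClosed_tsupport _) (tsupport_mollifier hε)

theorem mollifier_antitone {x y : CSpace N} (h : ‖x‖ ≤ ‖y‖) : mollifier ε y ≤ mollifier ε x := by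
  refine div_le_div_of_nonneg_right (expNegInvGlue.monotone ?_)
    (integral_nonneg fun _ => expNegInvGlue.nonneg _)
  have := norm_nonneg x
  nlinarith

theorem integral_mollifier (hε : 0 < ε) : ∫ y : CSpace N, mollifier ε y = 1 := by
  simp only [mollifier]
  rw [integral_div, div_self (integral_bumpKernel_pos hε).ne']

theorem continuous_mollifier_sub (w : CSpace N) : Continuous fun y => mollifier ε (w - y) :=
  contDiff_mollifier.continuous.comp (by fun_prop)

theorem integrable_mollifier_sub (hε : 0 < ε) (w : CSpace N) :
    Integrable fun y => mollifier ε (w - y) :=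
  (contDiff_mollifier.continuous.integrable_of_hasCompactSupport
    (hasCompactSupport_mollifier hε)).comp_sub_left w

theorem mollifier_sub_eq_zero (hε : 0 < ε) {w y : CSpace N} (hy : y ∉ Metric.closedBall w ε) :
    mollifier ε (w - y) = 0 := by
  refine mollifier_eq_zero hε ?_
  rw [Metric.mem_closedBall, dist_comm, dist_eq_norm, not_le] at hy
  exact hy.le

theorem setIntegral_mollifier_sub (hε : 0 < ε) (w : CSpace N) :
    ∫ y in Metric.closedBall w ε, mollifier ε (w - y) = 1 := by
  rw [setIntegral_eq_integral_of_forall_compl_eq_zero fun y hy => mollifier_sub_eq_zero hε hy,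
    integral_sub_left_eq_self (fun y => mollifier ε y), integral_mollifier hε]

/-- Mean values with respect to the mollifier are averages of mean values over balls. -/
theorem lintegral_mul_mollifier_le (hN : 0 < N) (hε : 0 < ε) {v : CSpace N → ENNReal}
    {w : CSpace N} {v₀ : ENNReal}
    (hv : AEMeasurable v (volume.restrict (Metric.closedBall w ε)))
    (h : ∀ r, 0 < r → r ≤ ε →
      ∫⁻ y in Metric.closedBall w r, v y ≤ volume (Metric.closedBall w r) * v₀) :
    ∫⁻ y in Metric.closedBall w ε, v y * ENNReal.ofReal (mollifier ε (w - y)) ≤ v₀ := by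
  have : Nonempty (Fin N) := ⟨⟨0, hN⟩⟩
  set B := Metric.closedBall w ε with hB
  set f : CSpace N → ℝ := fun y => mollifier ε (w - y) with hf
  have hfm : Measurable f := (continuous_mollifier_sub w).measurable
  have hset : ∀ t > 0, (volume.restrict B).withDensity v {y | t ≤ f y} ≤
      volume.restrict B {y | t ≤ f y} * v₀ := by
    intro t ht
    set S := {y | t ≤ f y} with hS
    have hSm : MeasurableSet S := measurableSet_le measurable_const hfm
    have hSB : S ⊆ B := by
      intro y hy
      by_contra hyB
      have : f y = 0 := mollifier_sub_eq_zero hε hyB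
      have : t ≤ f y := hy
      linarith
    rw [withDensity_apply _ hSm, Measure.restrict_restrict hSm, Measure.restrict_apply hSm,
      inter_eq_left.mpr hSB]
    have hScomp : IsCompact S := (isCompact_closedBall w ε).of_isClosed_subset
      (isClosed_le continuous_const (continuous_mollifier_sub w)) hSB
    rcases S.eq_empty_or_nonempty with hemp | hne
    · simp [hemp]
    · obtain ⟨y₀, hy₀, hmax⟩ := hScomp.exists_isMaxOn hne
        (f := fun y => ‖w - y‖) (by fun_prop : Continuous fun y => ‖w - y‖).continuousOn
      -- The kernel decreases with the distance from `w`, so a superlevel set is the closed ball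
      -- reaching to its farthest point.
      have hSball : S = Metric.closedBall w ‖w - y₀‖ := by
        ext y
        rw [Metric.mem_closedBall, dist_comm, dist_eq_norm]
        refine ⟨fun hy => hmax hy, fun hy => ?_⟩
        have h1 : t ≤ f y₀ := hy₀
        exact h1.trans (mollifier_antitone hy)
      -- A superlevel set reduced to the centre is null because the dimension is positive.
      rcases (norm_nonneg (w - y₀)).eq_or_lt with h0 | h0
      · rw [← h0, Metric.closedBall_zero] at hSball
        rw [hSball, Measure.restrict_singleton]
        simp
      · rw [hSball]
        refine h _ h0 ?_
        have := hSB hy₀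
        rwa [hB, Metric.mem_closedBall, dist_comm, dist_eq_norm] at this
  have hf0 : ∀ y, 0 ≤ f y := fun y => mollifier_nonneg _
  -- Layer-cake formula with respect to the measure `v dy`: the ball inequality is applied to each
  -- superlevel set, and the layers are reassembled into the total mass `1` of the kernel.
  calc ∫⁻ y in B, v y * ENNReal.ofReal (f y)
      = ∫⁻ y, ENNReal.ofReal (f y) ∂((volume.restrict B).withDensity v) :=
        (lintegral_withDensity_eq_lintegral_mul₀ hv hfm.ennreal_ofReal.aemeasurable).symm
    _ = ∫⁻ t in Ioi 0, (volume.restrict B).withDensity v {y | t ≤ f y} :=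
        lintegral_eq_lintegral_meas_le _ (Eventually.of_forall hf0) hfm.aemeasurable
    _ ≤ ∫⁻ t in Ioi 0, volume.restrict B {y | t ≤ f y} * v₀ :=
        setLIntegral_mono' measurableSet_Ioi hset
    _ = (∫⁻ t in Ioi 0, volume.restrict B {y | t ≤ f y}) * v₀ := by
        refine lintegral_mul_const'' _ (Measurable.aemeasurable ?_)
        have hanti : Antitone fun t : ℝ => volume.restrict B {y | t ≤ f y} := fun s t hst =>
          measure_mono fun y hy => le_trans hst hy
        exact hanti.measurable
    _ = v₀ := by
        rw [← lintegral_eq_lintegral_meas_le _ (Eventually.of_forall hf0) hfm.aemeasurable,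
          ← ofReal_integral_eq_lintegral_ofReal (integrable_mollifier_sub hε w).integrableOn
            (Eventually.of_forall hf0), setIntegral_mollifier_sub hε, ENNReal.ofReal_one, one_mul]

/-- The regularization of `u` restricted to `K`. -/
noncomputable def regularize (K : Set (CSpace N)) (u : CSpace N → EReal) (ε : ℝ) :
    CSpace N → ℝ :=
  convolution (K.indicator fun y => (u y).toReal) (mollifier ε) (ContinuousLinearMap.mul ℝ ℝ)
    volume

theorem regularize_apply (K : Set (CSpace N)) (u : CSpace N → EReal) (ε : ℝ) (w : CSpace N) :
    regularize K u ε w =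
      ∫ y, K.indicator (fun y => (u y).toReal) y * mollifier ε (w - y) := rfl

theorem regularize_eq_setIntegral (hε : 0 < ε) {K : Set (CSpace N)} {u : CSpace N → EReal}
    {w : CSpace N} (hw : Metric.closedBall w ε ⊆ K) :
    regularize K u ε w = ∫ y in Metric.closedBall w ε, (u y).toReal * mollifier ε (w - y) := by
  rw [regularize_apply, ← setIntegral_eq_integral_of_forall_compl_eq_zero
    (s := Metric.closedBall w ε) fun y hy => by rw [mollifier_sub_eq_zero hε hy, mul_zero]]
  refine setIntegral_congr_fun Metric.isClosed_closedBall.measurableSet fun y hy => ?_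
  simp only [indicator_of_mem (hw hy)]

theorem fderiv_convolution_apply {g : CSpace N → ℝ} (hg : LocallyIntegrable g)
    {ρ : CSpace N → ℝ} (hρ : ContDiff ℝ ∞ ρ) (hc : HasCompactSupport ρ) (w v : CSpace N) :
    fderiv ℝ (convolution g ρ (ContinuousLinearMap.mul ℝ ℝ) volume) w v =
      convolution g (fun x => fderiv ℝ ρ x v) (ContinuousLinearMap.mul ℝ ℝ) volume w := by
  rw [(hc.hasFDerivAt_convolution_right _ hg (hρ.of_le (by simp)) w).fderiv]
  exact convolution_precompR_apply _ hg (hc.fderiv ℝ) (hρ.continuous_fderiv (by simp)) w v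

theorem sndDeriv_convolution {g : CSpace N → ℝ} (hg : LocallyIntegrable g)
    {ρ : CSpace N → ℝ} (hρ : ContDiff ℝ ∞ ρ) (hc : HasCompactSupport ρ) (w v v' : CSpace N) :
    sndDeriv (convolution g ρ (ContinuousLinearMap.mul ℝ ℝ) volume) w v v' =
      ∫ y, g y * sndDeriv ρ (w - y) v v' := by
  have hcd : ContDiff ℝ ∞ (convolution g ρ (ContinuousLinearMap.mul ℝ ℝ) volume) :=
    hc.contDiff_convolution_right _ hg hρ
  have hρ' : ContDiff ℝ ∞ (fun x => fderiv ℝ ρ x v') :=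
    (hρ.fderiv_right (m := ∞) (by simp)).clm_apply contDiff_const
  rw [← fderiv_fderiv_apply (hcd.contDiffAt.of_le two_le_infty)]
  simp only [fderiv_convolution_apply hg hρ hc]
  rw [fderiv_convolution_apply hg hρ' (hc.fderiv_apply ℝ v')]
  rw [convolution_def]
  refine integral_congr_ae (Eventually.of_forall fun y => ?_)
  simp only [ContinuousLinearMap.mul_apply', fderiv_fderiv_apply (hρ.contDiffAt.of_le two_le_infty)]

/-- The reflection contributes a sign for each of the two derivatives. This identifies derivatives
of a convolution in `w` with those of the test function in `y`. -/
theorem sndDeriv_comp_sub_left {ρ : CSpace N → ℝ} (hρ : ContDiff ℝ ∞ ρ) (w y v v' : CSpace N) :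
    sndDeriv (fun y => ρ (w - y)) y v v' = sndDeriv ρ (w - y) v v' := by
  have hsub : ∀ y, HasFDerivAt (fun y : CSpace N => w - y) (-ContinuousLinearMap.id ℝ (CSpace N)) y :=
    fun y => (hasFDerivAt_id y).const_sub w
  have h1 : ∀ {f : CSpace N → ℝ}, ContDiff ℝ ∞ f → ∀ y v,
      fderiv ℝ (fun y => f (w - y)) y v = - fderiv ℝ f (w - y) v := by
    intro f hf y v
    have := ((hf.differentiable (by simp) (w - y)).hasFDerivAt).comp y (hsub y)
    rw [show (fun y => f (w - y)) = f ∘ fun y => w - y from rfl, this.fderiv]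
    simp
  have hρ' : ContDiff ℝ ∞ (fun x => fderiv ℝ ρ x v') :=
    (hρ.fderiv_right (m := ∞) (by simp)).clm_apply contDiff_const
  have hcomp : ContDiff ℝ ∞ (fun y => ρ (w - y)) := hρ.comp (by fun_prop)
  rw [← fderiv_fderiv_apply (hcomp.contDiffAt.of_le two_le_infty)]
  simp only [h1 hρ]
  rw [fderiv_fun_neg, neg_apply, h1 hρ', neg_neg,
    fderiv_fderiv_apply (hρ.contDiffAt.of_le two_le_infty)]

/-! ### Regularizations of subharmonic functions -/

section Properties

variable {Ω K : Set (CSpace N)} {u : CSpace N → EReal}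

theorem integrable_indicator_toReal (hΩ : IsOpen Ω) (hu : IsSubharmonicOn u Ω) (hK : IsCompact K)
    (hKΩ : K ⊆ Ω) (hQ : ∫⁻ y in K, (-u y).toENNReal ≠ ⊤) :
    Integrable (K.indicator fun y => (u y).toReal) := by
  obtain ⟨C, hC, huC⟩ := exists_upper_bound hu.usc hu.lt_top hK hKΩ
  exact (integrableOn_toReal hK (aemeasurable_of_upperSemicontinuousOn hΩ hu.usc
    hK.isClosed.measurableSet hKΩ) hQ huC).integrable_indicator hK.isClosed.measurableSet

theorem contDiff_regularize (hΩ : IsOpen Ω) (hu : IsSubharmonicOn u Ω) (hK : IsCompact K)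
    (hKΩ : K ⊆ Ω) (hQ : ∫⁻ y in K, (-u y).toENNReal ≠ ⊤) (hε : 0 < ε) :
    ContDiff ℝ ∞ (regularize K u ε) :=
  (hasCompactSupport_mollifier hε).contDiff_convolution_right _
    (integrable_indicator_toReal hΩ hu hK hKΩ hQ).locallyIntegrable contDiff_mollifier

theorem integrableOn_mul_mollifier (hΩ : IsOpen Ω) (hu : IsSubharmonicOn u Ω) (hK : IsCompact K)
    (hKΩ : K ⊆ Ω) (hQ : ∫⁻ y in K, (-u y).toENNReal ≠ ⊤) {w : CSpace N}
    (hw : Metric.closedBall w ε ⊆ K) :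
    IntegrableOn (fun y => (u y).toReal * mollifier ε (w - y)) (Metric.closedBall w ε) := by
  obtain ⟨C, hC, huC⟩ := exists_upper_bound hu.usc hu.lt_top hK hKΩ
  have h1 := (integrableOn_toReal hK (aemeasurable_of_upperSemicontinuousOn hΩ hu.usc
    hK.isClosed.measurableSet hKΩ) hQ huC).mono_set hw
  exact h1.mul_continuousOn (continuous_mollifier_sub w).continuousOn (isCompact_closedBall w ε)

theorem ae_ne_bot_closedBall (hΩ : IsOpen Ω) (hu : IsSubharmonicOn u Ω) (hK : IsCompact K)
    (hKΩ : K ⊆ Ω) (hQ : ∫⁻ y in K, (-u y).toENNReal ≠ ⊤) {w : CSpace N}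
    (hw : Metric.closedBall w ε ⊆ K) :
    ∀ᵐ y ∂volume.restrict (Metric.closedBall w ε), u y ≠ ⊥ ∧ y ∈ Metric.closedBall w ε := by
  have h1 := ae_ne_bot_of_lintegral_neg_ne_top (aemeasurable_of_upperSemicontinuousOn hΩ hu.usc
    hK.isClosed.measurableSet hKΩ) hQ
  filter_upwards [ae_restrict_of_ae_restrict_of_subset hw h1,
    ae_restrict_mem Metric.isClosed_closedBall.measurableSet] with y h2 h3
  exact ⟨h2, h3⟩

/-- A weighted average does not exceed an upper bound. With upper semicontinuity this later bounds
the regularizations from above in the limit. -/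
theorem regularize_le (hΩ : IsOpen Ω) (hu : IsSubharmonicOn u Ω) (hK : IsCompact K)
    (hKΩ : K ⊆ Ω) (hQ : ∫⁻ y in K, (-u y).toENNReal ≠ ⊤) (hε : 0 < ε) {w : CSpace N}
    (hw : Metric.closedBall w ε ⊆ K) {c : ℝ} (hc : ∀ y ∈ Metric.closedBall w ε, u y ≤ c) :
    regularize K u ε w ≤ c := by
  rw [regularize_eq_setIntegral hε hw]
  calc ∫ y in Metric.closedBall w ε, (u y).toReal * mollifier ε (w - y)
      ≤ ∫ y in Metric.closedBall w ε, c * mollifier ε (w - y) := by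
        refine integral_mono_ae (integrableOn_mul_mollifier hΩ hu hK hKΩ hQ hw)
          ((integrable_mollifier_sub hε w).integrableOn.const_mul c) ?_
        filter_upwards [ae_ne_bot_closedBall hΩ hu hK hKΩ hQ hw] with y hy
        refine mul_le_mul_of_nonneg_right ?_ (mollifier_nonneg _)
        have := EReal.toReal_le_toReal (hc y hy.2) hy.1 (EReal.coe_ne_top c)
        simpa using this
    _ = c := by rw [integral_const_mul, setIntegral_mollifier_sub hε, mul_one]

/-- The submean inequality over all concentric balls implies the one for the radial weight. It is
run on the nonnegative function `C - u`, for which lower integrals need no integrability, and then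
translated back to a real integral. -/
theorem le_regularize (hN : 0 < N) (hΩ : IsOpen Ω) (hu : IsSubharmonicOn u Ω) (hK : IsCompact K)
    (hKΩ : K ⊆ Ω) (hQ : ∫⁻ y in K, (-u y).toENNReal ≠ ⊤) (hε : 0 < ε) {w : CSpace N}
    (hw : Metric.closedBall w ε ⊆ K) : u w ≤ (regularize K u ε w : EReal) := by
  obtain ⟨C, hC, huC⟩ := exists_upper_bound hu.usc hu.lt_top hK hKΩ
  have hwK : w ∈ K := hw (Metric.mem_closedBall_self hε.le)
  have hm : ∀ s : Set (CSpace N), MeasurableSet s → s ⊆ K → AEMeasurable u (volume.restrict s) :=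
    fun s hs hsK => aemeasurable_of_upperSemicontinuousOn hΩ hu.usc hs (hsK.trans hKΩ)
  by_cases hbot : u w = ⊥
  · rw [hbot]
    exact bot_le
  obtain ⟨x, hx⟩ : ∃ x : ℝ, u w = x :=
    ⟨(u w).toReal, (EReal.coe_toReal (hu.lt_top w (hKΩ hwK)).ne hbot).symm⟩
  have hxC : x ≤ C := by
    have := huC w hwK
    rw [hx] at this
    exact_mod_cast this
  have hball := hm _ Metric.isClosed_closedBall.measurableSet hw
  have hlay := lintegral_mul_mollifier_le hN hε (v := fun y => ((C : EReal) - u y).toENNReal)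
    (v₀ := ((C : EReal) - u w).toENNReal) (w := w)
    (AEMeasurable.ereal_toENNReal (f := fun y => (C : EReal) - u y)
      (aemeasurable_const.sub hball)) fun r hr hrε => by
      have hsub := Metric.closedBall_subset_closedBall (x := w) hrε
      rw [← mul_le_extIntegral_iff hC Metric.isClosed_closedBall.measurableSet
        (volume_closedBall_ne_zero w hr) (volume_closedBall_ne_top w r)
        (hm _ Metric.isClosed_closedBall.measurableSet (hsub.trans hw))
        (fun y hy => huC y (hw (hsub hy))) (Metric.mem_closedBall_self hr.le)]
      exact hu.submean w (hKΩ hwK) r hr ((hsub.trans hw).trans hKΩ)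
  have e0 : ((C : EReal) - u w).toENNReal = ENNReal.ofReal (C - x) := by rw [hx]; rfl
  rw [e0] at hlay
  have hint := integrableOn_mul_mollifier hΩ hu hK hKΩ hQ hw
  have hintC : IntegrableOn (fun y => C * mollifier ε (w - y)) (Metric.closedBall w ε) :=
    (integrable_mollifier_sub hε w).integrableOn.const_mul C
  have hae := ae_ne_bot_closedBall hΩ hu hK hKΩ hQ hw
  have hreal : ∀ y, u y ≠ ⊥ → y ∈ Metric.closedBall w ε → u y = ((u y).toReal : EReal) ∧
      (u y).toReal ≤ C := by
    intro y h1 h2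
    have h3 := EReal.coe_toReal (hu.lt_top y (hKΩ (hw h2))).ne h1
    refine ⟨h3.symm, ?_⟩
    have := huC y (hw h2)
    rw [← h3] at this
    exact_mod_cast this
  have h1 : C - regularize K u ε w =
      ∫ y in Metric.closedBall w ε, (C - (u y).toReal) * mollifier ε (w - y) := by
    simp only [sub_mul]
    rw [integral_sub hintC hint, integral_const_mul, setIntegral_mollifier_sub hε, mul_one,
      regularize_eq_setIntegral hε hw]
  have hint2 : IntegrableOn (fun y => (C - (u y).toReal) * mollifier ε (w - y))
      (Metric.closedBall w ε) := by
    simp only [sub_mul]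
    exact hintC.sub hint
  have h2 : ENNReal.ofReal (C - regularize K u ε w) ≤ ENNReal.ofReal (C - x) := by
    rw [h1, ofReal_integral_eq_lintegral_ofReal hint2]
    · refine le_trans (le_of_eq (lintegral_congr_ae ?_)) hlay
      filter_upwards [hae] with y hy
      obtain ⟨h3, h4⟩ := hreal y hy.1 hy.2
      rw [ENNReal.ofReal_mul (by linarith)]
      congr 1
      conv_rhs => rw [h3]
      rfl
    · filter_upwards [hae] with y hy
      exact mul_nonneg (by linarith [(hreal y hy.1 hy.2).2]) (mollifier_nonneg _)
  rw [ENNReal.ofReal_le_ofReal_iff (by linarith)] at h2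
  rw [hx]
  exact EReal.coe_le_coe_iff.mpr (by linarith)

/-- Regularization preserves the inequalities defining `k`-subharmonic functions. -/
theorem wedgeCoeff_regularize_nonneg {k : ℕ} (hN : 0 < N) (hΩ : IsOpen Ω)
    (hu : IsKSubharmonicOn k u Ω) (hK : IsCompact K) (hKΩ : K ⊆ Ω)
    (hQ : ∫⁻ y in K, (-u y).toENNReal ≠ ⊤) (hε : 0 < ε) {w : CSpace N}
    (hw : Metric.closedBall w ε ⊆ K) {α : ℕ → Matrix (Fin N) (Fin N) ℂ}
    (hα : ∀ i, α i ∈ GammaCone N k) :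
    0 ≤ (wedgeCoeff fun i : Fin N => if (i : ℕ) = 0 then
      hessOf N (sndDeriv (regularize K u ε) w) else if (i : ℕ) < k then α i else 1).re := by
  -- Finiteness of the negative part on `K` excludes the degenerate alternative, so the current is
  -- available.
  have hne : ¬ ∀ z ∈ Ω, u z = ⊥ := by
    intro h
    have h1 := ae_ne_bot_closedBall hΩ hu.subharmonic hK hKΩ hQ hw
    have h2 : ∀ᵐ y ∂volume.restrict (Metric.closedBall w ε), False := by
      filter_upwards [h1] with y hy
      exact hy.1 (h y (hKΩ (hw hy.2)))
    rw [eventually_false_iff_eq_bot, ae_eq_bot, Measure.restrict_eq_zero] at h2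
    exact volume_closedBall_ne_zero w hε h2
  have hts : (tsupport fun y => mollifier ε (w - y)) ⊆ Metric.closedBall w ε := by
    refine closure_minimal (fun y hy => ?_) Metric.isClosed_closedBall
    by_contra h
    exact hy (mollifier_sub_eq_zero hε h)
  have hχ : ContDiff ℝ ∞ (fun y : CSpace N => mollifier ε (w - y)) :=
    contDiff_mollifier.comp (by fun_prop)
  -- The reflected kernel centred at `w` is itself an admissible test function; the current
  -- evaluated on it is the desired mixed product at `w`.
  have h0 := (hu.current_nonneg.resolve_left hne) α hα (fun y => mollifier ε (w - y)) hχ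
    ((isCompact_closedBall w ε).of_isClosed_subset (isClosed_tsupport _) hts)
    (hts.trans (hw.trans hKΩ)) fun y => mollifier_nonneg _
  obtain ⟨ι, _, c, v, v', h⟩ := exists_wedgeCoeff_hessOf_eq_sum hN α k
  rw [h]
  have hgi := integrable_indicator_toReal hΩ hu.subharmonic hK hKΩ hQ
  have h1 : ∀ i, sndDeriv (regularize K u ε) w (v i) (v' i) =
      ∫ y, K.indicator (fun y => (u y).toReal) y * sndDeriv (mollifier ε) (w - y) (v i) (v' i) :=
    fun i => sndDeriv_convolution hgi.locallyIntegrable contDiff_mollifier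
      (hasCompactSupport_mollifier hε) _ _ _
  have hsupp : ∀ y ∉ K, ∀ a b, sndDeriv (mollifier ε) (w - y) a b = 0 := by
    intro y hy a b
    rw [← sndDeriv_comp_sub_left contDiff_mollifier,
      ← fderiv_fderiv_apply (hχ.contDiffAt.of_le two_le_infty)]
    have h2 : y ∉ tsupport fun y => mollifier ε (w - y) := fun h => hy (hw (hts h))
    exact image_eq_zero_of_notMem_tsupport
      (f := fun x => fderiv ℝ (fun x => fderiv ℝ (fun y => mollifier ε (w - y)) x b) x a) fun h => h2
      ((tsupport_fderiv_apply_subset ℝ b) ((tsupport_fderiv_apply_subset ℝ a) h))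
  have hcont2 : ∀ a b, Continuous fun y => sndDeriv (mollifier (N := N) ε) (w - y) a b := by
    intro a b
    have h2 : Continuous fun y => sndDeriv (mollifier (N := N) ε) y a b :=
      ((((contDiff_mollifier.fderiv_right (m := ∞) (by simp)).continuous_fderiv
        (by simp)).clm_apply continuous_const).clm_apply continuous_const)
    exact h2.comp (by fun_prop)
  have hint : ∀ i, Integrable fun y => c i * (K.indicator (fun y => (u y).toReal) y *
      sndDeriv (mollifier ε) (w - y) (v i) (v' i)) := by
    intro i
    refine Integrable.const_mul ?_ _
    have h2 : IntegrableOn (fun y => K.indicator (fun y => (u y).toReal) y *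
        sndDeriv (mollifier ε) (w - y) (v i) (v' i)) K :=
      hgi.integrableOn.mul_continuousOn (hcont2 _ _).continuousOn hK
    refine (integrableOn_iff_integrable_of_support_subset fun y hy => ?_).mp h2
    by_contra hyK
    exact hy (by simp [hyK])
  simp only [h1, ← integral_const_mul]
  rw [← integral_finsetSum _ fun i _ => hint i]
  refine h0.trans (le_of_eq (integral_congr_ae (Eventually.of_forall fun y => ?_)))
  simp only [complexHessian_eq (hχ.contDiffAt.of_le two_le_infty), h,
    sndDeriv_comp_sub_left contDiff_mollifier]
  rw [Finset.mul_sum]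
  refine Finset.sum_congr rfl fun i _ => ?_
  by_cases hy : y ∈ K
  · rw [indicator_of_mem hy]
    ring
  · rw [hsupp y hy]
    ring

end Properties

end Mollifier

/-! ### Pluriharmonic functions and holomorphic functions -/

section Pluriharmonic

open Filter Topology

variable {N : ℕ} {Ω : Set (CSpace N)} {u : CSpace N → ℝ}

theorem regularize_neg (K : Set (CSpace N)) (u : CSpace N → ℝ) (ε : ℝ) (w : CSpace N) :
    regularize K (fun y => ((-u y : ℝ) : EReal)) ε w =
      -regularize K (fun y => (u y : EReal)) ε w := by
  simp only [regularize_apply, EReal.toReal_coe]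
  rw [← integral_neg]
  refine integral_congr_ae (Eventually.of_forall fun y => ?_)
  by_cases hy : y ∈ K <;> simp [hy]

theorem lintegral_neg_ne_top_of_isSubharmonicOn_neg
    (hu : IsSubharmonicOn (fun z => ((-u z : ℝ) : EReal)) Ω) {K : Set (CSpace N)}
    (hK : IsCompact K) (hKΩ : K ⊆ Ω) : ∫⁻ y in K, (-(u y : EReal)).toENNReal ≠ ⊤ := by
  obtain ⟨C, -, huC⟩ := exists_upper_bound hu.usc hu.lt_top hK hKΩ
  exact lintegral_toENNReal_ne_top hK.isClosed.measurableSet hK.measure_lt_top.ne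
    (u := fun y => -(u y : EReal)) huC

/-- The submean inequality for `u` and for `-u` gives the two opposite estimates. -/
theorem eq_regularize (hN : 0 < N) (hΩ : IsOpen Ω) (hu : IsSubharmonicOn (fun z => (u z : EReal)) Ω)
    (hu' : IsSubharmonicOn (fun z => ((-u z : ℝ) : EReal)) Ω) {K : Set (CSpace N)}
    (hK : IsCompact K) (hKΩ : K ⊆ Ω) {ε : ℝ} (hε : 0 < ε) {w : CSpace N}
    (hw : Metric.closedBall w ε ⊆ K) : u w = regularize K (fun y => (u y : EReal)) ε w := by
  have h1 := le_regularize hN hΩ hu hK hKΩ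
    (lintegral_neg_ne_top_of_isSubharmonicOn_neg hu' hK hKΩ) hε hw
  have h2 := le_regularize hN hΩ hu' hK hKΩ
    (lintegral_neg_ne_top_of_isSubharmonicOn_neg (u := fun y => -u y) (by simpa using hu) hK hKΩ)
    hε hw
  rw [EReal.coe_le_coe_iff] at h1 h2
  rw [regularize_neg] at h2
  linarith

theorem closedBall_subset_closedBall_of_mem_ball {z w : CSpace N} {r : ℝ}
    (hw : w ∈ Metric.ball z r) : Metric.closedBall w r ⊆ Metric.closedBall z (2 * r) :=
  Metric.closedBall_subset_closedBall' (by linarith [Metric.mem_ball.mp hw])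

theorem exists_closedBall_two_mul_subset (hΩ : IsOpen Ω) {z : CSpace N} (hz : z ∈ Ω) :
    ∃ r > 0, Metric.closedBall z (2 * r) ⊆ Ω := by
  obtain ⟨δ, hδ, h⟩ := Metric.nhds_basis_closedBall.mem_iff.mp (hΩ.mem_nhds hz)
  exact ⟨δ / 2, by positivity, by rwa [mul_div_cancel₀ _ two_ne_zero]⟩

/-- Weyl's lemma in this setting: locally `u` coincides with a convolution with a smooth kernel. -/
theorem contDiffOn_of_isSubharmonicOn_neg (hN : 0 < N) (hΩ : IsOpen Ω)
    (hu : IsSubharmonicOn (fun z => (u z : EReal)) Ω)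
    (hu' : IsSubharmonicOn (fun z => ((-u z : ℝ) : EReal)) Ω) : ContDiffOn ℝ ∞ u Ω := by
  intro z hz
  obtain ⟨r, hr, hball⟩ := exists_closedBall_two_mul_subset hΩ hz
  have hK := isCompact_closedBall z (2 * r)
  refine ContDiffAt.contDiffWithinAt ?_
  refine (contDiff_regularize hΩ hu hK hball
    (lintegral_neg_ne_top_of_isSubharmonicOn_neg hu' hK hball) hr).contDiffAt.congr_of_eventuallyEq ?_
  filter_upwards [Metric.ball_mem_nhds z hr] with w hw
  exact eq_regularize hN hΩ hu hu' hK hball hr (closedBall_subset_closedBall_of_mem_ball hw)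

/-- If `u` and `-u` are `k`-subharmonic for some `k ≥ 2`, then `u` is pluriharmonic. -/
theorem hessOf_eq_zero_of_isKSubharmonicOn_neg {k : ℕ} (hk : 1 < k) (hkN : k ≤ N)
    (hΩ : IsOpen Ω) (hu : IsKSubharmonicOn k (fun z => (u z : EReal)) Ω)
    (hu' : IsKSubharmonicOn k (fun z => ((-u z : ℝ) : EReal)) Ω) {z : CSpace N} (hz : z ∈ Ω) :
    hessOf N (sndDeriv u z) = 0 := by
  have hN : 0 < N := by omega
  obtain ⟨r, hr, hball⟩ := exists_closedBall_two_mul_subset hΩ hz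
  have hK := isCompact_closedBall z (2 * r)
  have hQ := lintegral_neg_ne_top_of_isSubharmonicOn_neg hu'.subharmonic hK hball
  have hQ' := lintegral_neg_ne_top_of_isSubharmonicOn_neg (u := fun y => -u y)
    (by simpa using hu.subharmonic) hK hball
  have hzr := closedBall_subset_closedBall_of_mem_ball (Metric.mem_ball_self (x := z) hr)
  set v := regularize (Metric.closedBall z (2 * r)) (fun y => (u y : EReal)) r with hv
  have hneg : regularize (Metric.closedBall z (2 * r)) (fun y => ((-u y : ℝ) : EReal)) r = -v :=
    funext fun w => regularize_neg _ _ _ _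
  have huv : u =ᶠ[𝓝 z] v := by
    filter_upwards [Metric.ball_mem_nhds z hr] with w hw
    exact eq_regularize hN hΩ hu.subharmonic hu'.subharmonic hK hball hr
      (closedBall_subset_closedBall_of_mem_ball hw)
  have hsd : sndDeriv u z = sndDeriv v z := huv.fderiv.fderiv_eq
  have hsn : sndDeriv (-v) z = -sndDeriv v z := by
    have : fderiv ℝ (-v) = -fderiv ℝ v := funext fun x => fderiv_neg
    rw [sndDeriv, this, fderiv_neg]
    rfl
  have hcd := contDiff_regularize hΩ hu.subharmonic hK hball hQ hr
  rw [hsd]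
  refine eq_zero_of_wedgeCoeff_eq_zero hk hkN (hessOf_isHermitian fun a b =>
    sndDeriv_symm (hcd.contDiffAt.of_le two_le_infty) a b) fun α hα => ?_
  have h1 := wedgeCoeff_regularize_nonneg hN hΩ hu hK hball hQ hr hzr hα
  have h2 := wedgeCoeff_regularize_nonneg hN hΩ hu' hK hball hQ' hr hzr hα
  rw [hneg, hsn] at h2
  obtain ⟨ι, _, c, a, b, h⟩ := exists_wedgeCoeff_hessOf_eq_sum hN α k
  -- The mixed product is linear in the Hessian, so the inequalities for `v` and `-v` together force
  -- it to vanish.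
  rw [h] at h1 h2 ⊢
  simp only [neg_apply, mul_neg, Finset.sum_neg_distrib] at h2
  linarith

/-- The one-variable mean value property on the complex disc `ζ ↦ z + ζ x`. -/
theorem circle_mean_of_differentiableOn {f : CSpace N → ℂ} (hΩ : IsOpen Ω)
    (hf : DifferentiableOn ℂ f Ω) {z x : CSpace N} (hx : ∀ ζ : ℂ, ‖ζ‖ ≤ 1 → z + ζ • x ∈ Ω) :
    ∫ θ in (0 : ℝ)..(2 * Real.pi), f (z + Complex.exp (θ * Complex.I) • x) =
      (2 * Real.pi : ℝ) • f z := by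
  have hd : ∀ ζ ∈ Metric.closedBall (0 : ℂ) |1|, DifferentiableAt ℂ (fun ζ : ℂ => f (z + ζ • x)) ζ := by
    intro ζ hζ
    have h1 : DifferentiableAt ℂ f (z + ζ • x) :=
      (hf _ (hx ζ (by simpa using hζ))).differentiableAt (hΩ.mem_nhds (hx ζ (by simpa using hζ)))
    exact h1.comp ζ (by fun_prop)
  have h := circleAverage_of_differentiable_on_off_countable (s := ∅) countable_empty
    (fun ζ hζ => (hd ζ hζ).continuousAt.continuousWithinAt)
    (fun ζ hζ => hd ζ (Metric.ball_subset_closedBall hζ.1))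
  rw [Real.circleAverage_def] at h
  simp only [circleMap, zero_add, Complex.ofReal_one, one_mul, zero_smul, add_zero] at h
  rw [← h, smul_smul, mul_inv_cancel₀ (by positivity), one_smul]

/-- For each real functional `L`, both `L ∘ f` and its negative have the mean value property on
circles, hence are subharmonic, hence smooth. -/
theorem contDiffOn_real_of_differentiableOn {f : CSpace N → ℂ} (hN : 0 < N) (hΩ : IsOpen Ω)
    (hf : DifferentiableOn ℂ f Ω) : ContDiffOn ℝ ∞ f Ω := by
  have hcirc : ∀ L : ℂ →L[ℝ] ℝ, ∀ z x : CSpace N, (∀ ζ : ℂ, ‖ζ‖ ≤ 1 → z + ζ • x ∈ Ω) →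
      2 * Real.pi * L (f z) ≤
        ∫ θ in (0 : ℝ)..(2 * Real.pi), L (f (z + Complex.exp (θ * Complex.I) • x)) := by
    intro L z x hx
    have hcont : Continuous fun θ : ℝ => f (z + Complex.exp (θ * Complex.I) • x) := by
      rw [← continuousOn_univ]
      exact hf.continuousOn.comp (by fun_prop) fun θ _ =>
        hx _ (Complex.norm_exp_ofReal_mul_I θ).le
    rw [ContinuousLinearMap.intervalIntegral_comp_comm L (hcont.intervalIntegrable _ _),
      circle_mean_of_differentiableOn hΩ hf hx, map_smul, smul_eq_mul]
  have hsub : ∀ L : ℂ →L[ℝ] ℝ, IsSubharmonicOn (fun z => (L (f z) : EReal)) Ω := fun L =>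
    isSubharmonicOn_of_circle_submean (L.continuous.comp_continuousOn hf.continuousOn) (hcirc L)
  have hL : ∀ L : ℂ →L[ℝ] ℝ, ContDiffOn ℝ ∞ (fun z => L (f z)) Ω := fun L =>
    contDiffOn_of_isSubharmonicOn_neg hN hΩ (hsub L) (hsub (-L))
  have h : f = fun z => ((Complex.reCLM (f z) : ℝ) : ℂ) + ((Complex.imCLM (f z) : ℝ) : ℂ) * Complex.I :=
    funext fun z => (Complex.re_add_im _).symm
  rw [h]
  exact (Complex.ofRealCLM.contDiff.comp_contDiffOn (hL Complex.reCLM)).add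
    ((Complex.ofRealCLM.contDiff.comp_contDiffOn (hL Complex.imCLM)).mul contDiffOn_const)

end Pluriharmonic

/-! ### Composition with holomorphic and antiholomorphic maps -/

section Composition

open Filter Topology

variable {N M : ℕ}

theorem fderiv_fderiv_apply_symm {E : Type*} [NormedAddCommGroup E] [NormedSpace ℝ E]
    {F : CSpace N → E} {z : CSpace N} (hF : ContDiffAt ℝ 2 F z) (v w : CSpace N) :
    fderiv ℝ (fun x => fderiv ℝ F x v) z w = fderiv ℝ (fun x => fderiv ℝ F x w) z v := by
  have h : ∀ v w, fderiv ℝ (fun x => fderiv ℝ F x v) z w = fderiv ℝ (fderiv ℝ F) z w v := by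
    intro v w
    have := ((differentiableAt_fderiv hF).hasFDerivAt).clm_apply (hasFDerivAt_const v z)
    rw [this.fderiv]
    simp
  rw [h, h]
  exact (hF.isSymmSndFDerivAt (by simp)) w v

theorem sndDeriv_comp {F : CSpace N → CSpace M} {z : CSpace N} (hF : ContDiffAt ℝ 2 F z)
    {φ : CSpace M → ℝ} (hφ : ContDiffAt ℝ 2 φ (F z)) (v w : CSpace N) :
    sndDeriv (φ ∘ F) z w v = sndDeriv φ (F z) (fderiv ℝ F z w) (fderiv ℝ F z v) +
      fderiv ℝ φ (F z) (fderiv ℝ (fun x => fderiv ℝ F x v) z w) := by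
  have hφ' : ∀ᶠ x in 𝓝 z, DifferentiableAt ℝ φ (F x) :=
    hF.continuousAt.eventually ((hφ.eventually (by simp)).mono fun y hy =>
      hy.differentiableAt two_ne_zero)
  have hF' : ∀ᶠ x in 𝓝 z, DifferentiableAt ℝ F x :=
    (hF.eventually (by simp)).mono fun y hy => hy.differentiableAt two_ne_zero
  have h1 : (fun x => fderiv ℝ (φ ∘ F) x v) =ᶠ[𝓝 z]
      fun x => fderiv ℝ φ (F x) (fderiv ℝ F x v) := by
    filter_upwards [hφ', hF'] with x h1 h2
    rw [fderiv_comp x h1 h2]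
    rfl
  have h2 : HasFDerivAt (fun x => fderiv ℝ φ (F x))
      ((fderiv ℝ (fderiv ℝ φ) (F z)).comp (fderiv ℝ F z)) z :=
    (differentiableAt_fderiv hφ).hasFDerivAt.comp z hF'.self_of_nhds.hasFDerivAt
  have h3 : HasFDerivAt (fun x => fderiv ℝ F x v) (fderiv ℝ (fun x => fderiv ℝ F x v) z) z :=
    ((differentiableAt_fderiv hF).clm_apply (differentiableAt_const v)).hasFDerivAt
  rw [← fderiv_fderiv_apply (hφ.comp z hF), h1.fderiv_eq, (h2.clm_apply h3).fderiv, add_comm]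
  rfl

theorem leviForm_smul {c : ℂ} (hc : c = Complex.I ∨ c = -Complex.I) (B : BilForm N)
    (v : CSpace N) : B (c • v) (c • v) = B (Complex.I • v) (Complex.I • v) := by
  rcases hc with rfl | rfl
  · rfl
  · simp

/-- Differentiating the Cauchy–Riemann relation and using symmetry pulls out the factor `c` twice,
and `c² = -1`. The choice `c = ±i` treats the holomorphic and antiholomorphic cases together. -/
theorem fderiv_fderiv_apply_smul_I {E : Type*} [NormedAddCommGroup E] [NormedSpace ℝ E]
    [NormedSpace ℂ E] [SMulCommClass ℝ ℂ E] {Ω : Set (CSpace N)} (hΩ : IsOpen Ω)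
    {F : CSpace N → E} (hF : ContDiffOn ℝ ∞ F Ω) {c : ℂ} (hc : c = Complex.I ∨ c = -Complex.I)
    (hcF : ∀ z ∈ Ω, ∀ v, fderiv ℝ F z (Complex.I • v) = c • fderiv ℝ F z v)
    {z : CSpace N} (hz : z ∈ Ω) (v : CSpace N) :
    fderiv ℝ (fun x => fderiv ℝ F x (Complex.I • v)) z (Complex.I • v) =
      -fderiv ℝ (fun x => fderiv ℝ F x v) z v := by
  have hFz : ContDiffAt ℝ 2 F z := (hF.contDiffAt (hΩ.mem_nhds hz)).of_le two_le_infty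
  have h1 : ∀ v w, fderiv ℝ (fun x => fderiv ℝ F x (Complex.I • v)) z w =
      c • fderiv ℝ (fun x => fderiv ℝ F x v) z w := by
    intro v w
    have he : (fun x => fderiv ℝ F x (Complex.I • v)) =ᶠ[𝓝 z] fun x => c • fderiv ℝ F x v := by
      filter_upwards [hΩ.mem_nhds hz] with x hx
      exact hcF x hx v
    rw [he.fderiv_eq, fderiv_fun_const_smul
      ((differentiableAt_fderiv hFz).clm_apply (differentiableAt_const v))]
    rfl
  have hcc : c * c = -1 := by rcases hc with rfl | rfl <;> simp
  rw [h1, fderiv_fderiv_apply_symm hFz, h1, smul_smul, hcc, neg_one_smul]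

/-- In the chain rule the terms with the second derivative of `F` cancel between `v` and `iv`; the
rest is the Levi form of `φ` pulled back by the differential. -/
theorem leviForm_sndDeriv_comp {Ω : Set (CSpace N)} (hΩ : IsOpen Ω) {F : CSpace N → CSpace M}
    (hF : ContDiffOn ℝ ∞ F Ω) {c : ℂ} (hc : c = Complex.I ∨ c = -Complex.I)
    (hcF : ∀ z ∈ Ω, ∀ v, fderiv ℝ F z (Complex.I • v) = c • fderiv ℝ F z v)
    {z : CSpace N} (hz : z ∈ Ω) {φ : CSpace M → ℝ} (hφ : ContDiffAt ℝ 2 φ (F z)) (v : CSpace N) :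
    leviForm (sndDeriv (φ ∘ F) z) v = leviForm (sndDeriv φ (F z)) (fderiv ℝ F z v) := by
  have hFz : ContDiffAt ℝ 2 F z := (hF.contDiffAt (hΩ.mem_nhds hz)).of_le two_le_infty
  rw [leviForm, sndDeriv_comp hFz hφ, sndDeriv_comp hFz hφ,
    fderiv_fderiv_apply_smul_I hΩ hF hc hcF hz, hcF z hz, leviForm_smul hc, leviForm, map_neg]
  ring

open scoped ComplexOrder in
/-- An `M`-subharmonic function is, near a compact set, the limit of a sequence of smooth
functions above it with nonnegative Levi form. -/
theorem exists_smooth_approximation {Ω : Set (CSpace M)} (hM : 0 < M) (hΩ : IsOpen Ω)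
    {φ : CSpace M → EReal} (hφ : IsKSubharmonicOn M φ Ω)
    (hint : ∀ K, IsCompact K → K ⊆ Ω → ∫⁻ y in K, (-φ y).toENNReal ≠ ⊤)
    {K₀ : Set (CSpace M)} (hK₀ : IsCompact K₀) (hK₀Ω : K₀ ⊆ Ω) :
    ∃ (U : Set (CSpace M)) (ψ : ℕ → CSpace M → ℝ) (C : ℝ), IsOpen U ∧ K₀ ⊆ U ∧ 0 ≤ C ∧
      (∀ n, ContDiff ℝ ∞ (ψ n)) ∧ (∀ n, ∀ w ∈ U, ∀ v, 0 ≤ leviForm (sndDeriv (ψ n) w) v) ∧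
      (∀ n, ∀ w ∈ U, φ w ≤ ψ n w) ∧ (∀ n, ∀ w ∈ U, ψ n w ≤ C) ∧
      ∀ w ∈ U, Tendsto (fun n => (ψ n w : EReal)) atTop (𝓝 (φ w)) := by
  obtain ⟨δ, hδ, hδΩ⟩ := hK₀.exists_cthickening_subset_open hΩ hK₀Ω
  set K := Metric.cthickening δ K₀ with hKdef
  have hK : IsCompact K := hK₀.cthickening
  have hQ := hint K hK hδΩ
  obtain ⟨C, hC, hφC⟩ := exists_upper_bound hφ.subharmonic.usc hφ.subharmonic.lt_top hK hδΩ
  -- Radii tending to `0` and at most `δ/2`, so that balls centred in the `δ/2`-thickening remain in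
  -- `K`.
  set ε : ℕ → ℝ := fun n => δ / 2 / (n + 1) with hε
  have hε0 : ∀ n, 0 < ε n := fun n => by positivity
  have hεδ : ∀ n, ε n ≤ δ / 2 := fun n =>
    div_le_self (by positivity) (by linarith [n.cast_nonneg (α := ℝ)])
  have hball : ∀ n, ∀ w ∈ Metric.thickening (δ / 2) K₀, Metric.closedBall w (ε n) ⊆ K := by
    intro n w hw y hy
    obtain ⟨x, hx, hxw⟩ := Metric.mem_thickening_iff.mp hw
    refine Metric.mem_cthickening_of_dist_le y x δ K₀ hx ?_
    have h1 := dist_triangle y w x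
    have h2 := Metric.mem_closedBall.mp hy
    linarith [hεδ n]
  have hle : ∀ n, ∀ w ∈ Metric.thickening (δ / 2) K₀, φ w ≤ regularize K φ (ε n) w :=
    fun n w hw => le_regularize hM hΩ hφ.subharmonic hK hδΩ hQ (hε0 n) (hball n w hw)
  have hcd : ∀ n, ContDiff ℝ ∞ (regularize K φ (ε n)) := fun n =>
    contDiff_regularize hΩ hφ.subharmonic hK hδΩ hQ (hε0 n)
  refine ⟨Metric.thickening (δ / 2) K₀, fun n => regularize K φ (ε n), C,
    Metric.isOpen_thickening, Metric.self_subset_thickening (by positivity) _, hC, hcd, ?_, hle,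
    fun n w hw => regularize_le hΩ hφ.subharmonic hK hδΩ hQ (hε0 n) (hball n w hw)
      fun y hy => hφC y (hball n w hw hy), ?_⟩
  · intro n w hw
    have hsymm := fun a b => sndDeriv_symm ((hcd n).contDiffAt.of_le two_le_infty (x := w)) a b
    -- Here the order of subharmonicity equals the dimension: no slot is occupied by `β`, and the
    -- test forms are rich enough to detect every eigenvalue of the Hessian.
    refine (hessOf_posSemidef_iff hsymm).mp
      (posSemidef_of_wedgeCoeff_nonneg hM (hessOf_isHermitian hsymm) fun α hα => ?_)
    exact wedgeCoeff_regularize_nonneg hM hΩ hφ hK hδΩ hQ (hε0 n) (hball n w hw) hα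
  · intro w hw
    have hwΩ : w ∈ Ω := hδΩ (hball 0 w hw (Metric.mem_closedBall_self (hε0 0).le))
    -- The lower estimate is the submean inequality; the upper one is upper semicontinuity on a
    -- small ball once `ε n` is below its radius.
    refine tendsto_order.mpr ⟨fun a ha => Eventually.of_forall fun n => ha.trans_le (hle n w hw),
      fun a ha => ?_⟩
    obtain ⟨x, hx1, hx2⟩ := EReal.lt_iff_exists_real_btwn.mp ha
    have h1 : ∀ᶠ y in 𝓝 w, φ y < x := by
      have := hφ.subharmonic.usc w hwΩ x hx1
      rwa [hΩ.nhdsWithin_eq hwΩ] at this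
    obtain ⟨r, hr, hball'⟩ := Metric.nhds_basis_closedBall.eventually_iff.mp h1
    have hlim : Tendsto ε atTop (𝓝 0) := by
      have := (tendsto_one_div_add_atTop_nhds_zero_nat (𝕜 := ℝ)).const_mul (δ / 2)
      simpa [hε, div_eq_mul_inv] using this
    filter_upwards [hlim.eventually (Iio_mem_nhds hr)] with n hn
    refine lt_of_le_of_lt ?_ hx2
    rw [EReal.coe_le_coe_iff]
    exact regularize_le hΩ hφ.subharmonic hK hδΩ hQ (hε0 n) (hball n w hw) fun y hy =>
      (hball' (Metric.closedBall_subset_closedBall (le_of_lt hn) hy)).le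

end Composition

/-! ### Passage to the limit in the mean value and current inequalities -/

section Limits

open Filter Topology

variable {N : ℕ} {Ω : Set (CSpace N)} {v : CSpace N → EReal}

theorem isSubharmonicOn_bot (h : ∀ z ∈ Ω, v z = ⊥) : IsSubharmonicOn v Ω where
  usc := by
    intro z hz y hy
    filter_upwards [self_mem_nhdsWithin] with x hx
    rw [h x hx, ← h z hz]
    exact hy
  lt_top := fun z hz => by simp [h z hz]
  submean := by
    intro z hz r hr _
    rw [h z hz, ← ENNReal.ofReal_toReal (volume_closedBall_ne_top z r), EReal.coe_ennreal_ofReal,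
      max_eq_left ENNReal.toReal_nonneg, EReal.coe_mul_bot_of_pos
        (ENNReal.toReal_pos (volume_closedBall_ne_zero z hr) (volume_closedBall_ne_top z r))]
    exact bot_le

theorem tendsto_const_sub_toENNReal (C : ℝ) {f : ℕ → EReal} {a : EReal}
    (h : Tendsto f atTop (𝓝 a)) :
    Tendsto (fun n => ((C : EReal) - f n).toENNReal) atTop (𝓝 ((C : EReal) - a).toENNReal) := by
  refine (EReal.continuous_toENNReal.tendsto _).comp ?_
  simp only [sub_eq_add_neg]
  have h1 : ContinuousAt (fun p : EReal × EReal => p.1 + p.2) ((C : EReal), -a) :=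
    EReal.continuousAt_add (by simp) (by simp)
  exact h1.tendsto.comp (tendsto_const_nhds.prodMk_nhds
    ((continuous_neg.tendsto a).comp h))

/-- The mean value inequality passes to limits of sequences that are bounded above. -/
theorem submean_of_tendsto {s : Set (CSpace N)} (hs : MeasurableSet s) (hs0 : volume s ≠ 0)
    (hs' : volume s ≠ ⊤) (hv : AEMeasurable v (volume.restrict s)) {C : ℝ} (hC : 0 ≤ C)
    (hvC : ∀ y ∈ s, v y ≤ C) {w : ℕ → CSpace N → EReal}
    (hw : ∀ n, AEMeasurable (w n) (volume.restrict s)) (hwC : ∀ n, ∀ y ∈ s, w n y ≤ C)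
    {z : CSpace N} (hz : z ∈ s)
    (hmean : ∀ n, ((volume s : ENNReal) : EReal) * w n z ≤ extIntegral s (w n))
    (hlim : ∀ y ∈ s, Tendsto (fun n => w n y) atTop (𝓝 (v y))) :
    ((volume s : ENNReal) : EReal) * v z ≤ extIntegral s v := by
  rw [mul_le_extIntegral_iff hC hs hs0 hs' hv hvC hz]
  have h1 : ∀ n, ∫⁻ y in s, ((C : EReal) - w n y).toENNReal ≤
      volume s * ((C : EReal) - w n z).toENNReal := fun n =>
    (mul_le_extIntegral_iff hC hs hs0 hs' (hw n) (hwC n) hz).mp (hmean n)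
  have h2 : Tendsto (fun n => volume s * ((C : EReal) - w n z).toENNReal) atTop
      (𝓝 (volume s * ((C : EReal) - v z).toENNReal)) :=
    ENNReal.Tendsto.const_mul (tendsto_const_sub_toENNReal C (hlim z hz)) (Or.inr hs')
  -- Fatou's lemma for the nonnegative functions `C - w n`.
  calc ∫⁻ y in s, ((C : EReal) - v y).toENNReal
      = ∫⁻ y in s, liminf (fun n => ((C : EReal) - w n y).toENNReal) atTop :=
        setLIntegral_congr_fun hs fun y hy =>
          (tendsto_const_sub_toENNReal C (hlim y hy)).liminf_eq.symm
    _ ≤ liminf (fun n => ∫⁻ y in s, ((C : EReal) - w n y).toENNReal) atTop :=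
        lintegral_liminf_le' fun n => AEMeasurable.ereal_toENNReal
          (f := fun y => (C : EReal) - w n y) (aemeasurable_const.sub (hw n))
    _ ≤ liminf (fun n => volume s * ((C : EReal) - w n z).toENNReal) atTop :=
        liminf_le_liminf (Eventually.of_forall h1)
    _ = _ := h2.liminf_eq

/-- Dominated convergence: almost everywhere on `K`, `w n` lies between `v` and `C`, so `(|C| + |v|)
|g|` dominates. -/
theorem integral_mul_nonneg_of_tendsto {K : Set (CSpace N)} (hK : IsCompact K)
    (hv : AEMeasurable v (volume.restrict K)) (hQ : ∫⁻ y in K, (-v y).toENNReal ≠ ⊤) {C : ℝ}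
    (hvC : ∀ y ∈ K, v y ≤ C) {g : CSpace N → ℝ} (hg : Continuous g) (hgK : ∀ y ∉ K, g y = 0)
    {w : ℕ → CSpace N → ℝ} (hw : ∀ n, AEStronglyMeasurable fun y => w n y * g y)
    (hwC : ∀ n, ∀ y ∈ K, w n y ≤ C) (hvw : ∀ n, ∀ y ∈ K, v y ≤ w n y)
    (hlim : ∀ y ∈ K, Tendsto (fun n => (w n y : EReal)) atTop (𝓝 (v y)))
    (hpos : ∀ n, 0 ≤ ∫ y, w n y * g y) : 0 ≤ ∫ y, (v y).toReal * g y := by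
  have hKm := hK.isClosed.measurableSet
  have hbound : Integrable fun y => (|C| + |(v y).toReal|) * |g y| := by
    have h1 : IntegrableOn (fun y => |C| + |(v y).toReal|) K :=
      (integrableOn_const hK.measure_lt_top.ne).add (integrableOn_toReal hK hv hQ hvC).abs
    refine (integrableOn_iff_integrable_of_support_subset fun y hy => ?_).mp
      (h1.mul_continuousOn hg.abs.continuousOn hK)
    by_contra hyK
    exact hy (by simp [hgK y hyK])
  have hae : ∀ᵐ y, y ∈ K → v y ≠ ⊥ :=
    (ae_restrict_iff' hKm).mp (ae_ne_bot_of_lintegral_neg_ne_top hv hQ)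
  refine ge_of_tendsto' (tendsto_integral_of_dominated_convergence
    (F := fun n y => w n y * g y) _ hw hbound (fun n => ?_) ?_) hpos
  · filter_upwards [hae] with y hy
    by_cases hyK : y ∈ K
    · rw [Real.norm_eq_abs, abs_mul]
      refine mul_le_mul_of_nonneg_right ?_ (abs_nonneg _)
      have h1 : (v y).toReal ≤ w n y := by
        simpa using EReal.toReal_le_toReal (hvw n y hyK) (hy hyK) (EReal.coe_ne_top _)
      have h2 := hwC n y hyK
      have h3 := le_abs_self C
      have h4 := neg_abs_le (v y).toReal
      have h5 := abs_nonneg C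
      have h6 := abs_nonneg (v y).toReal
      exact abs_le.mpr ⟨by linarith, by linarith⟩
    · simp [hgK y hyK]
  · filter_upwards [hae] with y hy
    by_cases hyK : y ∈ K
    · have h1 : v y ≠ ⊤ := ne_top_of_le_ne_top (EReal.coe_ne_top C) (hvC y hyK)
      have := (EReal.tendsto_toReal h1 (hy hyK)).comp (hlim y hyK)
      exact this.mul_const _
    · simp [hgK y hyK]

end Limits

/-- Composition with a holomorphic or antiholomorphic map preserves plurisubharmonicity. -/
theorem isKSubharmonicOn_comp {N M n : ℕ} (hM : 0 < M) (hn : 1 ≤ n) (hnN : n ≤ N)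
    {ΩN : Set (CSpace N)} {ΩM : Set (CSpace M)} (hΩN : IsOpen ΩN) (hΩN' : IsConnected ΩN)
    (hΩM : IsOpen ΩM) (hΩM' : IsConnected ΩM) {F : CSpace N → CSpace M} (hFm : MapsTo F ΩN ΩM)
    (hF : ContDiffOn ℝ ∞ F ΩN) {c : ℂ} (hc : c = Complex.I ∨ c = -Complex.I)
    (hcF : ∀ z ∈ ΩN, ∀ v, fderiv ℝ F z (Complex.I • v) = c • fderiv ℝ F z v)
    {φ : CSpace M → EReal} (hφ : IsKSubharmonicOn M φ ΩM) :
    IsKSubharmonicOn n (φ ∘ F) ΩN := by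
  rcases eq_bot_or_locally_integrable hΩM hΩM' hφ.subharmonic with hbot | hint
  · have h : ∀ z ∈ ΩN, (φ ∘ F) z = ⊥ := fun z hz => hbot _ (hFm hz)
    exact ⟨isSubharmonicOn_bot h, Or.inl h⟩
  -- Smooth approximations of `φ` near the compact image of `K`, pulled back by `F`, are
  -- `n`-subharmonic on a neighbourhood of `K`. Each defining inequality involves only a compact
  -- subset, so local approximants suffice.
  have happrox : ∀ K, IsCompact K → K ⊆ ΩN → ∃ (V : Set (CSpace N)) (w : ℕ → CSpace N → ℝ) (C : ℝ),
      IsOpen V ∧ K ⊆ V ∧ 0 ≤ C ∧ (∀ m, ContinuousOn (w m) V) ∧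
      (∀ m, IsKSubharmonicOn n (fun z => (w m z : EReal)) V) ∧
      (∀ m, ∀ z ∈ V, φ (F z) ≤ w m z) ∧ (∀ m, ∀ z ∈ V, w m z ≤ C) ∧
      ∀ z ∈ V, Filter.Tendsto (fun m => (w m z : EReal)) Filter.atTop (nhds (φ (F z))) := by
    intro K hK hKΩ
    obtain ⟨U, ψ, C, hU, hKU, hC, hψ, hlevi, hle, hψC, hlim⟩ :=
      exists_smooth_approximation hM hΩM hφ
        (fun K hK hKΩ => lintegral_neg_ne_top_of_isCompact hint hK hKΩ)
        (hK.image_of_continuousOn (hF.continuousOn.mono hKΩ))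
        (image_subset_iff.mpr fun z hz => hFm (hKΩ hz))
    have hV : IsOpen (ΩN ∩ F ⁻¹' U) := hF.continuousOn.isOpen_inter_preimage hΩN hU
    have hs : ∀ m, ContDiffOn ℝ ∞ (ψ m ∘ F) (ΩN ∩ F ⁻¹' U) := fun m =>
      (hψ m).comp_contDiffOn (hF.mono inter_subset_left)
    refine ⟨ΩN ∩ F ⁻¹' U, fun m => ψ m ∘ F, C, hV,
      fun z hz => ⟨hKΩ hz, hKU (mem_image_of_mem F hz)⟩, hC, fun m => (hs m).continuousOn, fun m => ?_,
      fun m z hz => hle m _ hz.2, fun m z hz => hψC m _ hz.2, fun z hz => hlim _ hz.2⟩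
    refine isKSubharmonicOn_of_leviForm_nonneg hn hnN hV (hs m) fun z hz v => ?_
    rw [leviForm_sndDeriv_comp hΩN hF hc hcF hz.1 ((hψ m).contDiffAt.of_le two_le_infty)]
    exact hlevi m _ hz.2 _
  have husc : UpperSemicontinuousOn (φ ∘ F) ΩN := hφ.subharmonic.usc.comp hF.continuousOn hFm
  have hsub : IsSubharmonicOn (φ ∘ F) ΩN := by
    refine ⟨husc, fun z hz => hφ.subharmonic.lt_top _ (hFm hz), fun z hz r hr hball => ?_⟩
    obtain ⟨V, w, C, hV, hKV, hC, hw, hwk, hle, hwC, hlim⟩ :=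
      happrox _ (isCompact_closedBall z r) hball
    have hm := Metric.isClosed_closedBall (x := z) (ε := r) |>.measurableSet
    refine submean_of_tendsto hm (volume_closedBall_ne_zero z hr) (volume_closedBall_ne_top z r)
      (aemeasurable_of_upperSemicontinuousOn hΩN husc hm hball) hC
      (fun y hy => (hle 0 y (hKV hy)).trans (EReal.coe_le_coe_iff.mpr (hwC 0 y (hKV hy))))
      (fun m => aemeasurable_of_upperSemicontinuousOn hV (hwk m).subharmonic.usc hm hKV)
      (fun m y hy => EReal.coe_le_coe_iff.mpr (hwC m y (hKV hy)))
      (Metric.mem_closedBall_self hr.le)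
      (fun m => (hwk m).subharmonic.submean z (hKV (Metric.mem_closedBall_self hr.le)) r hr hKV)
      fun y hy => hlim y (hKV hy)
  refine ⟨hsub, ?_⟩
  rcases eq_bot_or_locally_integrable hΩN hΩN' hsub with hbot | hint'
  · exact Or.inl hbot
  refine Or.inr fun α hα χ hχ hcs hts hpos => ?_
  obtain ⟨V, w, C, hV, hKV, hC, hw, hwk, hle, hwC, hlim⟩ := happrox _ hcs hts
  obtain ⟨ι, _, a, b, b', h⟩ := exists_wedgeCoeff_hessOf_eq_sum (by omega : 0 < N) α n
  set g : CSpace N → ℝ := fun z => (wedgeCoeff fun i : Fin N => if (i : ℕ) = 0 then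
    complexHessian χ z else if (i : ℕ) < n then α i else 1).re with hgdef
  have hg : g = fun z => ∑ i, a i * sndDeriv χ z (b i) (b' i) := funext fun z => by
    simp only [hgdef, complexHessian_eq (hχ.contDiffAt.of_le two_le_infty), h]
  have hgc : Continuous g := by
    rw [hg]
    exact continuous_finsetSum _ fun i _ => continuous_const.mul
      ((((hχ.fderiv_right (m := ∞) (by simp)).continuous_fderiv (by simp)).clm_apply
        continuous_const).clm_apply continuous_const)
  have hgK : ∀ y ∉ tsupport χ, g y = 0 := by
    intro y hy
    rw [hg]
    refine Finset.sum_eq_zero fun i _ => ?_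
    rw [← fderiv_fderiv_apply (hχ.contDiffAt.of_le two_le_infty), image_eq_zero_of_notMem_tsupport
      (f := fun x => fderiv ℝ (fun x => fderiv ℝ χ x (b' i)) x (b i)) fun h => hy
        ((tsupport_fderiv_apply_subset ℝ _) ((tsupport_fderiv_apply_subset ℝ _) h)), mul_zero]
  have hgs : tsupport g ⊆ V := (closure_minimal (fun y hy => by
    by_contra hy'
    exact hy (hgK y hy')) (isClosed_tsupport χ)).trans hKV
  have htm := (isClosed_tsupport χ).measurableSet
  refine integral_mul_nonneg_of_tendsto hcs (aemeasurable_of_upperSemicontinuousOn hΩN husc htm hts)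
    (lintegral_neg_ne_top_of_isCompact hint' hcs hts)
    (fun y hy => (hle 0 y (hKV hy)).trans (EReal.coe_le_coe_iff.mpr (hwC 0 y (hKV hy)))) hgc hgK
    (fun m => (continuous_mul_of_tsupport_subset hV (hw m) hgc hgs).aestronglyMeasurable)
    (fun m y hy => hwC m y (hKV hy)) (fun m y hy => hle m y (hKV hy))
    (fun y hy => hlim y (hKV hy)) fun m => ?_
  -- The approximants are real-valued, so the alternative `-∞` can occur only if the support of `χ`
  -- is empty.
  rcases (hwk m).current_nonneg with hbot | hcur
  · have hg0 : g = 0 := funext fun y => hgK y fun hy => EReal.coe_ne_bot _ (hbot y (hKV hy))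
    change 0 ≤ ∫ y, w m y * g y
    simp [hg0]
  · simpa using hcur α hα χ hχ hcs hKV hpos

/-! ### Complex-valued pluriharmonic functions -/

section ComplexPluriharmonic

open Filter Topology

variable {N M : ℕ} {Ω : Set (CSpace N)} {f g : CSpace N → ℂ}

/-- Smooth complex-valued functions with `∂∂̄f = 0`. -/
structure IsPluriharmonicOn (f : CSpace N → ℂ) (Ω : Set (CSpace N)) : Prop where
  contDiffOn : ContDiffOn ℝ ∞ f Ω
  add_eq_zero : ∀ z ∈ Ω, ∀ v w, fderiv ℝ (fun x => fderiv ℝ f x w) z v +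
    fderiv ℝ (fun x => fderiv ℝ f x (Complex.I • w)) z (Complex.I • v) = 0

theorem fderiv_real_clm_comp (L : ℂ →L[ℝ] ℝ) {z : CSpace N} (hf : DifferentiableAt ℝ f z)
    (v : CSpace N) : fderiv ℝ (fun x => L (f x)) z v = L (fderiv ℝ f z v) := by
  have := (L.hasFDerivAt (x := f z)).comp z hf.hasFDerivAt
  rw [show (fun x => L (f x)) = L ∘ f from rfl, this.fderiv]
  rfl

theorem sndDeriv_clm_comp (L : ℂ →L[ℝ] ℝ) {z : CSpace N} (hf : ContDiffAt ℝ 2 f z)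
    (v w : CSpace N) :
    sndDeriv (fun x => L (f x)) z v w = L (fderiv ℝ (fun x => fderiv ℝ f x w) z v) := by
  have h1 : (fun x => fderiv ℝ (fun x => L (f x)) x w) =ᶠ[𝓝 z] fun x => L (fderiv ℝ f x w) := by
    filter_upwards [hf.eventually (by simp)] with x hx
    exact fderiv_real_clm_comp L (hx.differentiableAt two_ne_zero) w
  rw [← fderiv_fderiv_apply (u := fun x => L (f x)) (L.contDiff.contDiffAt.comp z hf), h1.fderiv_eq,
    fderiv_real_clm_comp L ((differentiableAt_fderiv hf).clm_apply (differentiableAt_const w))]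

theorem complex_eq_zero_of_clm {x : ℂ} (h : ∀ L : ℂ →L[ℝ] ℝ, L x = 0) : x = 0 :=
  Complex.ext (h Complex.reCLM) (h Complex.imCLM)

/-- Composing a subharmonic morphism with a holomorphic function gives a pluriharmonic function. -/
theorem IsSubharmonicMorphism.isPluriharmonicOn_comp {n : ℕ} (hM : 1 ≤ M) (hn : 1 < n)
    (hnN : n ≤ N) {ΩM : Set (CSpace M)} (hΩ : IsOpen Ω) (hΩM : IsOpen ΩM)
    {F : CSpace N → CSpace M} (hF : IsSubharmonicMorphism M n Ω ΩM F) {h : CSpace M → ℂ}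
    (hh : DifferentiableOn ℂ h ΩM) : IsPluriharmonicOn (h ∘ F) Ω := by
  have hN : 0 < N := by omega
  have hcd : ContDiffOn ℝ ∞ h ΩM := contDiffOn_real_of_differentiableOn hM hΩM hh
  have hh' : ∀ z ∈ ΩM, ∀ v, fderiv ℝ h z (Complex.I • v) = Complex.I • fderiv ℝ h z v := by
    intro z hz v
    rw [((hh z hz).differentiableAt (hΩM.mem_nhds hz)).fderiv_restrictScalars ℝ]
    simp
  -- The Levi form of `L ∘ h` vanishes. Since `-L` is again a functional, the negative of each
  -- function is covered as well.
  have hsub : ∀ L : ℂ →L[ℝ] ℝ, IsKSubharmonicOn n (fun z => (L (h (F z)) : EReal)) Ω := by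
    intro L
    refine hF _ (isKSubharmonicOn_of_leviForm_nonneg hM le_rfl hΩM
      (L.contDiff.comp_contDiffOn hcd) fun z hz v => ?_)
    have hz2 := (hcd.contDiffAt (hΩM.mem_nhds hz)).of_le two_le_infty
    refine le_of_eq ?_
    change 0 = leviForm (sndDeriv (fun x => L (h x)) z) v
    rw [leviForm, sndDeriv_clm_comp L hz2, sndDeriv_clm_comp L hz2,
      fderiv_fderiv_apply_smul_I hΩM hcd (Or.inl rfl) hh' hz, map_neg, add_neg_cancel]
  have hLc : ∀ L : ℂ →L[ℝ] ℝ, ContDiffOn ℝ ∞ (fun z => L (h (F z))) Ω := fun L =>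
    contDiffOn_of_isSubharmonicOn_neg hN hΩ (hsub L).subharmonic (hsub (-L)).subharmonic
  have hcdf : ContDiffOn ℝ ∞ (h ∘ F) Ω := by
    have he : h ∘ F = fun z => ((Complex.reCLM (h (F z)) : ℝ) : ℂ) +
        ((Complex.imCLM (h (F z)) : ℝ) : ℂ) * Complex.I :=
      funext fun z => (Complex.re_add_im _).symm
    rw [he]
    exact (Complex.ofRealCLM.contDiff.comp_contDiffOn (hLc Complex.reCLM)).add
      ((Complex.ofRealCLM.contDiff.comp_contDiffOn (hLc Complex.imCLM)).mul contDiffOn_const)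
  refine ⟨hcdf, fun z hz v w => complex_eq_zero_of_clm fun L => ?_⟩
  have hz2 := (hcdf.contDiffAt (hΩ.mem_nhds hz)).of_le two_le_infty
  -- The real part of the sesquilinear identity is the required relation composed with `L`.
  have h0 := sesqPart_eq_zero_of_hessOf_eq_zero
    (hessOf_eq_zero_of_isKSubharmonicOn_neg hn hnN hΩ (hsub L) (hsub (-L)) hz) v w
  have h1 := congrArg Complex.re h0
  simp only [sesqPart, Complex.add_re, Complex.ofReal_re, Complex.mul_re, Complex.I_re, zero_mul,
    Complex.ofReal_im, mul_zero, sub_zero, add_zero, Complex.zero_re] at h1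
  rw [map_add, ← sndDeriv_clm_comp L hz2, ← sndDeriv_clm_comp L hz2]
  exact h1

/-! ### Holomorphic and antiholomorphic parts of the differential -/

/-- Twice the `(1,0)`-part of the differential. -/
noncomputable def delPart (f : CSpace N → ℂ) (z v : CSpace N) : ℂ :=
  fderiv ℝ f z v - Complex.I * fderiv ℝ f z (Complex.I • v)

/-- Twice the `(0,1)`-part of the differential. -/
noncomputable def delbarPart (f : CSpace N → ℂ) (z v : CSpace N) : ℂ :=
  fderiv ℝ f z v + Complex.I * fderiv ℝ f z (Complex.I • v)

theorem delPart_add (z v w : CSpace N) : delPart f z (v + w) = delPart f z v + delPart f z w := by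
  simp only [delPart, smul_add, map_add]
  ring

theorem delbarPart_add (z v w : CSpace N) :
    delbarPart f z (v + w) = delbarPart f z v + delbarPart f z w := by
  simp only [delbarPart, smul_add, map_add]
  ring

theorem differentiableAt_of_delbarPart_eq_zero {z : CSpace N} (hf : DifferentiableAt ℝ f z)
    (h : ∀ v, delbarPart f z v = 0) : DifferentiableAt ℂ f z := by
  rw [differentiableAt_iff_restrictScalars ℝ hf]
  have hI : ∀ v, fderiv ℝ f z (Complex.I • v) = Complex.I * fderiv ℝ f z v := by
    intro v
    have h1 := h v
    rw [delbarPart] at h1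
    linear_combination (-Complex.I) * h1 + fderiv ℝ f z (Complex.I • v) * Complex.I_sq
  refine ⟨⟨{ toFun := fderiv ℝ f z, map_add' := map_add _, map_smul' := fun c v => ?_ },
    (fderiv ℝ f z).continuous⟩, rfl⟩
  rw [complex_smul_eq c v, map_add, map_smul, map_smul, hI, RingHom.id_apply, smul_eq_mul,
    Complex.real_smul, Complex.real_smul]
  conv_rhs => rw [← Complex.re_add_im c]
  ring

theorem fderiv_conj {z : CSpace N} (hf : DifferentiableAt ℝ f z) (v : CSpace N) :
    fderiv ℝ (fun x => conj (f x)) z v = conj (fderiv ℝ f z v) := by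
  have := (Complex.conjCLE.toContinuousLinearMap.hasFDerivAt (x := f z)).comp z hf.hasFDerivAt
  rw [show (fun x => conj (f x)) = Complex.conjCLE.toContinuousLinearMap ∘ f from rfl, this.fderiv]
  rfl

theorem delbarPart_conj {z : CSpace N} (hf : DifferentiableAt ℝ f z) (v : CSpace N) :
    delbarPart (fun x => conj (f x)) z v = conj (delPart f z v) := by
  simp only [delbarPart, delPart, fderiv_conj hf, map_sub, map_mul, Complex.conj_I]
  ring

theorem delPart_conj {z : CSpace N} (hf : DifferentiableAt ℝ f z) (v : CSpace N) :
    delPart (fun x => conj (f x)) z v = conj (delbarPart f z v) := by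
  simp only [delbarPart, delPart, fderiv_conj hf, map_add, map_mul, Complex.conj_I]
  ring

theorem IsPluriharmonicOn.contDiffAt (hf : IsPluriharmonicOn f Ω) (hΩ : IsOpen Ω) {z : CSpace N}
    (hz : z ∈ Ω) : ContDiffAt ℝ 2 f z :=
  (hf.contDiffOn.contDiffAt (hΩ.mem_nhds hz)).of_le two_le_infty

theorem IsPluriharmonicOn.differentiableAt (hf : IsPluriharmonicOn f Ω) (hΩ : IsOpen Ω)
    {z : CSpace N} (hz : z ∈ Ω) : DifferentiableAt ℝ f z :=
  (hf.contDiffAt hΩ hz).differentiableAt two_ne_zero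

theorem IsPluriharmonicOn.conj (hf : IsPluriharmonicOn f Ω) (hΩ : IsOpen Ω) :
    IsPluriharmonicOn (fun x => conj (f x)) Ω where
  contDiffOn := Complex.conjCLE.contDiff.comp_contDiffOn hf.contDiffOn
  add_eq_zero := by
    intro z hz v w
    have h : ∀ v w, fderiv ℝ (fun x => fderiv ℝ (fun x => (starRingEnd ℂ) (f x)) x w) z v =
        (starRingEnd ℂ) (fderiv ℝ (fun x => fderiv ℝ f x w) z v) := by
      intro v w
      have he : (fun x => fderiv ℝ (fun x => (starRingEnd ℂ) (f x)) x w) =ᶠ[𝓝 z]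
          fun x => (starRingEnd ℂ) (fderiv ℝ f x w) := by
        filter_upwards [hΩ.mem_nhds hz] with x hx
        exact fderiv_conj (hf.differentiableAt hΩ hx) w
      rw [he.fderiv_eq, fderiv_conj ((differentiableAt_fderiv (hf.contDiffAt hΩ hz)).clm_apply
        (differentiableAt_const w))]
    rw [h, h, ← map_add, hf.add_eq_zero z hz, map_zero]

/-- The coefficients of `∂f` are annihilated by `∂̄`: their `∂̄`-derivative is a combination of the
relations for the pairs `(w, v)` and `(iw, v)`. -/
theorem IsPluriharmonicOn.differentiableOn_delPart (hf : IsPluriharmonicOn f Ω) (hΩ : IsOpen Ω)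
    (v : CSpace N) : DifferentiableOn ℂ (fun z => delPart f z v) Ω := by
  intro z hz
  have hd : ∀ w, DifferentiableAt ℝ (fun x => fderiv ℝ f x w) z := fun w =>
    (differentiableAt_fderiv (hf.contDiffAt hΩ hz)).clm_apply (differentiableAt_const w)
  have h1 : ∀ w, fderiv ℝ (fun z => delPart f z v) z w =
      fderiv ℝ (fun x => fderiv ℝ f x v) z w -
        Complex.I * fderiv ℝ (fun x => fderiv ℝ f x (Complex.I • v)) z w := by
    intro w
    have := (hd v).hasFDerivAt.sub ((hd (Complex.I • v)).hasFDerivAt.const_mul Complex.I)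
    rw [show (fun z => delPart f z v) = (fun x => fderiv ℝ f x v) -
      fun x => Complex.I * fderiv ℝ f x (Complex.I • v) from rfl, this.fderiv]
    rfl
  refine (differentiableAt_of_delbarPart_eq_zero
    ((hd v).sub ((hd (Complex.I • v)).const_mul Complex.I)) fun w => ?_).differentiableWithinAt
  change delbarPart (fun z => delPart f z v) z w = 0
  rw [delbarPart, h1, h1]
  have e1 := hf.add_eq_zero z hz w v
  have e2 := hf.add_eq_zero z hz (Complex.I • w) v
  rw [I_smul_I_smul, map_neg] at e2
  linear_combination e1 + Complex.I * e2 -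
    fderiv ℝ (fun x => fderiv ℝ f x (Complex.I • v)) z (Complex.I • w) * Complex.I_sq

/-- In `∂∂̄(fg)` the terms `f ∂∂̄g` and `g ∂∂̄f` vanish. The remaining cross terms, evaluated on
`v`, are `2 (Df(v) Dg(v) + Df(iv) Dg(iv))`, which is the left-hand side. -/
theorem IsPluriharmonicOn.delPart_mul_delbarPart (hf : IsPluriharmonicOn f Ω)
    (hg : IsPluriharmonicOn g Ω) (hfg : IsPluriharmonicOn (fun x => f x * g x) Ω) (hΩ : IsOpen Ω)
    {z : CSpace N} (hz : z ∈ Ω) (v : CSpace N) :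
    delPart f z v * delbarPart g z v + delbarPart f z v * delPart g z v = 0 := by
  have h : ∀ v, fderiv ℝ (fun x => fderiv ℝ (fun x => f x * g x) x v) z v =
      f z * fderiv ℝ (fun x => fderiv ℝ g x v) z v + fderiv ℝ g z v * fderiv ℝ f z v +
        (g z * fderiv ℝ (fun x => fderiv ℝ f x v) z v + fderiv ℝ f z v * fderiv ℝ g z v) := by
    intro v
    have he : (fun x => fderiv ℝ (fun x => f x * g x) x v) =ᶠ[𝓝 z]
        (f * fun x => fderiv ℝ g x v) + g * fun x => fderiv ℝ f x v := by
      filter_upwards [hΩ.mem_nhds hz] with x hx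
      rw [fderiv_fun_mul (hf.differentiableAt hΩ hx) (hg.differentiableAt hΩ hx)]
      rfl
    have hdf := (differentiableAt_fderiv (hf.contDiffAt hΩ hz)).clm_apply (differentiableAt_const v)
    have hdg := (differentiableAt_fderiv (hg.contDiffAt hΩ hz)).clm_apply (differentiableAt_const v)
    rw [he.fderiv_eq, (((hf.differentiableAt hΩ hz).hasFDerivAt.mul hdg.hasFDerivAt).add
      ((hg.differentiableAt hΩ hz).hasFDerivAt.mul hdf.hasFDerivAt)).fderiv]
    rfl
  have e := hfg.add_eq_zero z hz v v
  rw [h, h] at e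
  have e1 := hf.add_eq_zero z hz v v
  have e2 := hg.add_eq_zero z hz v v
  simp only [delPart, delbarPart]
  linear_combination e - f z * e2 - g z * e1 -
    2 * fderiv ℝ f z (Complex.I • v) * fderiv ℝ g z (Complex.I • v) * Complex.I_sq

/-- The identity theorem on a connected open set in `ℂ^N`. -/
theorem eq_zero_of_eventually_eq_zero (hΩ : IsOpen Ω) (hΩ' : IsPreconnected Ω)
    (hf : DifferentiableOn ℂ f Ω) {z₀ : CSpace N} (hz₀ : z₀ ∈ Ω) (h₀ : ∀ᶠ y in 𝓝 z₀, f y = 0)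
    {z : CSpace N} (hz : z ∈ Ω) : f z = 0 := by
  have hopen : IsOpen {z | ∀ᶠ y in 𝓝 z, f y = 0} := isOpen_setOfPred_eventually_nhds
  suffices h : Ω ⊆ {z | ∀ᶠ y in 𝓝 z, f y = 0} from (h hz).self_of_nhds
  refine hΩ'.subset_of_closure_inter_subset hopen ⟨z₀, hz₀, h₀⟩ fun a ⟨ha, haΩ⟩ => ?_
  obtain ⟨r, hr, hball⟩ := Metric.isOpen_iff.mp hΩ a haΩ
  obtain ⟨y, hy, hyr⟩ := Metric.mem_closure_iff.mp ha r hr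
  filter_upwards [Metric.ball_mem_nhds a hr] with x hx
  -- The complex line from `y`, near which `f` vanishes, to `x`. It meets the ball in a convex set,
  -- so the one-variable identity theorem applies.
  set e : ℂ → CSpace N := fun ζ => y + ζ • (x - y) with he
  have hec : Continuous e := by fun_prop
  have hconv : Convex ℝ (e ⁻¹' Metric.ball a r) := by
    intro s hs t ht p q hp hq hpq
    have h1 := convex_ball a r hs ht hp hq hpq
    have h2 : e (p • s + q • t) = p • e s + q • e t := by
      simp only [he, smul_add, add_smul, smul_assoc]
      have : y = p • y + q • y := by rw [← add_smul, hpq, one_smul]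
      nth_rewrite 1 [this]
      abel
    rwa [mem_preimage, h2]
  have hd : DifferentiableOn ℂ (f ∘ e) (e ⁻¹' Metric.ball a r) :=
    (hf.mono hball).comp (by fun_prop) fun ζ hζ => hζ
  have h0 : (0 : ℂ) ∈ e ⁻¹' Metric.ball a r := by
    simpa [he, dist_comm] using hyr
  have hev : f ∘ e =ᶠ[𝓝 0] 0 := by
    have h1 : Tendsto e (𝓝 0) (𝓝 y) := by simpa [he] using hec.tendsto 0
    exact h1.eventually hy
  have h1 := (hd.analyticOnNhd (Metric.isOpen_ball.preimage hec)).eqOn_zero_of_preconnected_of_eventuallyEq_zero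
    hconv.isPreconnected h0 hev (x := 1) (by simpa [he] using hx)
  simpa [he] using h1

/-- If products of pluriharmonic functions are pluriharmonic, then the functions are all
holomorphic or all antiholomorphic. -/
theorem delPart_eq_zero_or_delbarPart_eq_zero (hΩ : IsOpen Ω) (hΩ' : IsPreconnected Ω) {ι : Type*}
    {f : ι → CSpace N → ℂ} (hf : ∀ j, IsPluriharmonicOn (f j) Ω)
    (hff : ∀ j k, IsPluriharmonicOn (fun x => f j x * f k x) Ω) :
    (∀ j, ∀ z ∈ Ω, ∀ v, delPart (f j) z v = 0) ∨ ∀ j, ∀ z ∈ Ω, ∀ v, delbarPart (f j) z v = 0 := by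
  by_contra! hcon
  obtain ⟨⟨j, z₀, hz₀, v, hv⟩, k, z₁, hz₁, w, hw⟩ := hcon
  -- After conjugation the coefficients of `∂̄f_k` become holomorphic, so local vanishing spreads
  -- over `Ω`.
  have hbar : ∀ k v z₀, z₀ ∈ Ω → (∀ᶠ z in 𝓝 z₀, delbarPart (f k) z v = 0) →
      ∀ z ∈ Ω, delbarPart (f k) z v = 0 := by
    intro k v z₀ hz₀ h z hz
    have h1 : ∀ z ∈ Ω, delPart (fun x => conj (f k x)) z v = conj (delbarPart (f k) z v) :=
      fun z hz => delPart_conj ((hf k).differentiableAt hΩ hz) v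
    have h2 := eq_zero_of_eventually_eq_zero hΩ hΩ' (((hf k).conj hΩ).differentiableOn_delPart hΩ v)
      hz₀ (by
        filter_upwards [h, hΩ.mem_nhds hz₀] with x hx hxΩ
        rw [h1 x hxΩ, hx, map_zero]) hz
    rw [h1 z hz] at h2
    simpa using h2
  -- The square of `f j` first gives `∂̄f_j(v) = 0` where `∂f_j(v) ≠ 0`, hence everywhere. Then one
  -- cross term for `f j * f k` disappears and the other gives `∂̄f_k(v) = 0`.
  have key : ∀ v, delPart (f j) z₀ v ≠ 0 → ∀ k, ∀ z ∈ Ω, delbarPart (f k) z v = 0 := by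
    intro v hv
    have hne : ∀ᶠ z in 𝓝 z₀, delPart (f j) z v ≠ 0 :=
      (((hf j).differentiableOn_delPart hΩ v).continuousOn.continuousAt
        (hΩ.mem_nhds hz₀)).eventually_ne hv
    have hj : ∀ z ∈ Ω, delbarPart (f j) z v = 0 := by
      refine hbar j v z₀ hz₀ ?_
      filter_upwards [hne, hΩ.mem_nhds hz₀] with x hx hxΩ
      have h1 := (hf j).delPart_mul_delbarPart (hf j) (hff j j) hΩ hxΩ v
      have h2 : delPart (f j) x v * delbarPart (f j) x v = 0 := by linear_combination h1 / 2
      exact (mul_eq_zero.mp h2).resolve_left hx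
    intro k
    refine hbar k v z₀ hz₀ ?_
    filter_upwards [hne, hΩ.mem_nhds hz₀] with x hx hxΩ
    have h1 := (hf j).delPart_mul_delbarPart (hf k) (hff j k) hΩ hxΩ v
    rw [hj x hxΩ, zero_mul, add_zero] at h1
    exact (mul_eq_zero.mp h1).resolve_left hx
  -- The product relation compares a single direction. If `∂f_j(w) = 0`, the directions `v` and `v +
  -- w` are both usable, and additivity recovers `w`.
  by_cases h : delPart (f j) z₀ w = 0
  · have h1 := key (v + w) (by rwa [delPart_add, h, add_zero]) k z₁ hz₁
    rw [delbarPart_add, key v hv k z₁ hz₁, zero_add] at h1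
    exact hw h1
  · exact hw (key w h k z₁ hz₁)

/-- The real linear map given by componentwise complex conjugation. -/
noncomputable def conjCLM (M : ℕ) : CSpace M →L[ℝ] CSpace M :=
  LinearMap.toContinuousLinearMap
    { toFun := conjMap id
      map_add' := fun v w => by ext j; simp [conjMap]
      map_smul' := fun c v => by ext j; simp [conjMap] }

theorem conjMap_eq (F : CSpace N → CSpace M) : conjMap F = conjCLM M ∘ F := rfl

theorem conjMap_conjMap (F : CSpace N → CSpace M) : conjMap (conjMap F) = F := by
  funext z
  ext j
  simp [conjMap]

theorem conjCLM_smul_I (v : CSpace M) :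
    conjCLM M (Complex.I • v) = (-Complex.I) • conjCLM M v := by
  change conjMap id (Complex.I • v) = (-Complex.I) • conjMap id v
  ext j
  simp [conjMap]

theorem contDiffOn_real_of_differentiableOn_map {F : CSpace N → CSpace M} (hN : 0 < N)
    (hΩ : IsOpen Ω) (hF : DifferentiableOn ℂ F Ω) : ContDiffOn ℝ ∞ F Ω :=
  contDiffOn_piLp' 2 fun j =>
    contDiffOn_real_of_differentiableOn hN hΩ (differentiableOn_euclidean.mp hF j)

theorem fderiv_smul_I_of_differentiableOn {F : CSpace N → CSpace M} (hΩ : IsOpen Ω)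
    (hF : DifferentiableOn ℂ F Ω) {z : CSpace N} (hz : z ∈ Ω) (v : CSpace N) :
    fderiv ℝ F z (Complex.I • v) = Complex.I • fderiv ℝ F z v := by
  rw [((hF z hz).differentiableAt (hΩ.mem_nhds hz)).fderiv_restrictScalars ℝ]
  simp

end ComplexPluriharmonic

/-! ### Characterization of subharmonic morphisms -/

theorem mainTheorem4 (N M n : ℕ) (hM : 1 ≤ M) (hn : 1 < n) (hnN : n ≤ N)
    (ΩN : Set (CSpace N)) (ΩM : Set (CSpace M))
    (hΩN : IsOpen ΩN) (hΩN' : IsConnected ΩN) (hΩM : IsOpen ΩM) (hΩM' : IsConnected ΩM)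
    (F : CSpace N → CSpace M) (hF : MapsTo F ΩN ΩM) :
    IsSubharmonicMorphism M n ΩN ΩM F ↔
      (DifferentiableOn ℂ F ΩN ∨ DifferentiableOn ℂ (conjMap F) ΩN) := by
  have hN : 0 < N := by omega
  constructor
  · intro h
    have hproj : ∀ j : Fin M, DifferentiableOn ℂ (fun w : CSpace M => w j) ΩM := fun j =>
      (EuclideanSpace.proj (𝕜 := ℂ) j).differentiable.differentiableOn
    have hf : ∀ j, IsPluriharmonicOn (fun z => F z j) ΩN := fun j =>
      h.isPluriharmonicOn_comp hM hn hnN hΩN hΩM (hproj j)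
    -- The quadratic test functions `w_j w_k` force all components to be holomorphic or
    -- antiholomorphic simultaneously.
    have hff : ∀ j k, IsPluriharmonicOn (fun z => F z j * F z k) ΩN := fun j k =>
      h.isPluriharmonicOn_comp hM hn hnN hΩN hΩM ((hproj j).mul (hproj k))
    rcases delPart_eq_zero_or_delbarPart_eq_zero hΩN hΩN'.isPreconnected hf hff with h0 | h0
    · refine Or.inr (differentiableOn_euclidean.mpr fun j z hz =>
        DifferentiableAt.differentiableWithinAt ?_)
      have hd := (hf j).differentiableAt hΩN hz
      refine differentiableAt_of_delbarPart_eq_zero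
        (((hf j).conj hΩN).differentiableAt hΩN hz) fun v => ?_
      change delbarPart (fun x => conj (F x j)) z v = 0
      rw [delbarPart_conj hd, h0 j z hz, map_zero]
    · exact Or.inl (differentiableOn_euclidean.mpr fun j z hz =>
        (differentiableAt_of_delbarPart_eq_zero ((hf j).differentiableAt hΩN hz)
          (h0 j z hz)).differentiableWithinAt)
  · rintro (h | h) φ hφ
    · exact isKSubharmonicOn_comp hM hn.le hnN hΩN hΩN' hΩM hΩM' hF
        (contDiffOn_real_of_differentiableOn_map hN hΩN h) (Or.inl rfl)
        (fun z hz v => fderiv_smul_I_of_differentiableOn hΩN h hz v) hφ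
    · have hcd := contDiffOn_real_of_differentiableOn_map hN hΩN h
      -- Conjugating a holomorphic map keeps real smoothness and turns the Cauchy–Riemann factor `i`
      -- into `-i`.
      have hFe : F = conjCLM M ∘ conjMap F := by rw [← conjMap_eq, conjMap_conjMap]
      refine isKSubharmonicOn_comp hM hn.le hnN hΩN hΩN' hΩM hΩM' hF
        (by rw [hFe]; exact (conjCLM M).contDiff.comp_contDiffOn hcd) (Or.inr rfl)
        (fun z hz v => ?_) hφ
      have hd : DifferentiableAt ℝ (conjMap F) z :=
        (hcd.contDiffAt (hΩN.mem_nhds hz)).differentiableAt (by simp)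
      have hfd : fderiv ℝ F z = (conjCLM M).comp (fderiv ℝ (conjMap F) z) := by
        conv_lhs => rw [hFe]
        exact ((conjCLM M).hasFDerivAt.comp z hd.hasFDerivAt).fderiv
      rw [hfd]
      change conjCLM M (fderiv ℝ (conjMap F) z (Complex.I • v)) = _
      rw [fderiv_smul_I_of_differentiableOn hΩN h hz, conjCLM_smul_I]
      rfl
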